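/- Let $\mathbb{F}_q$ be a finite field. For $n\ge 0$ let $C_n=C(\mathfrak{gl}_n(\mathbb{F}_q))$ be the complex space of functions $f:\mathfrak{gl}_n(\mathbb{F}_q)\to\mathbb{C}$ invariant under the adjoint action of $\mathrm{GL}_n(\mathbb{F}_q)$ (so $C_0=\mathbb{C}$), with the hermitian form $(f,f')=\frac{1}{|\mathrm{GL}_n(\mathbb{F}_q)|}\sum_{x}f(x)\overline{f'(x)}$. For a parabolic subgroup $P$ of $\mathrm{GL}_n$ defined over $\mathbb{F}_q$, with unipotent radical $U_P$ and a Levi subgroup $L$ defined over $\mathbb{F}_q$, write $\mathcal{P},\mathcal{U}_P,\mathcal{L}$ for the $\mathbb{F}_q$-points of the Lie algebras and $\pi_{\mathcal{L}}:\mathcal{P}\to\mathcal{L}$ for the projection along $\mathcal{U}_P$. Harish-Chandra restriction and induction are $${}^*R_{\mathcal L}(f)(x)=\frac{1}{|U_P(\mathbb{F}_q)|}\sum_{y\in\mathcal{U}_P}f(x+y),\qquad R_{\mathcal L}(f)(x)=\frac{1}{|P(\mathbb{F}_q)|}\sum_{g\in \mathrm{GL}_n(\mathbb{F}_q),\ gxg^{-1}\in\mathcal{P}}f(\pi_{\mathcal{L}}(gxg^{-1})).$$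 Call $f\in C_n$ pre-cuspidal if ${}^*R_{\mathcal{L}}(f)=0$ for every Levi subgroup $L$ of every proper parabolic subgroup (both defined over $\mathbb{F}_q$). For a Borel subgroup $B$ of $\mathrm{GL}_n$ over $\mathbb{F}_q$ put $$\mathcal{D}_n(f)=\sum_{P\supseteq B}(-1)^{r(P)}R_{\mathcal{L}_P}\bigl({}^*R_{\mathcal{L}_P}(f)\bigr),$$ where $P$ runs over the parabolic subgroups over $\mathbb{F}_q$ containing $B$, $L_P$ is a Levi subgroup of $P$ over $\mathbb{F}_q$ with Lie algebra $\mathcal{L}_P$, and $r(P)$ is the semisimple $\mathbb{F}_q$-rank of $P$. There is a unique collection $\{\mathbb{D}_n\}_{n\ge0}$ of linear endomorphisms $\mathbb{D}_n$ of $C_n$ such that $\mathbb{D}_0=\mathrm{id}$; for all $n_1,n_2>0$ and $f_i\in C_{n_i}$, $$\mathbb{D}_{n_1+n_2}(R_{n_1,n_2}(f_1\boxtimes f_2))=R_{n_1,n_2}(\mathbb{D}_{n_1}(f_1)\boxtimes\mathbb{D}_{n_2}(f_2)),$$ where $R_{n_1,n_2}$ is Harish-Chandra induction from the block-diagonal matrices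 $\mathfrak{gl}_{n_1}\times\mathfrak{gl}_{n_2}$ through the block upper triangular matrices; and $\mathbb{D}_n(f)=(-1)^{n-1}f$ for every $n>0$ and every pre-cuspidal $f\in C_n$. For every $n\ge0$, $\mathbb{D}_n$ is involutive, $\mathbb{D}_n\circ\mathbb{D}_n=\mathrm{id}$, and isometric, $(\mathbb{D}_n f,\mathbb{D}_n f')=(f,f')$ for all $f,f'\in C_n$. Equivalently, for every choice of $B$ and of the $L_P$, $\mathcal{D}_n=\mathbb{D}_n$, and $\mathcal{D}_n$ is involutive and isometric. -/

import Mathlib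

noncomputable section

section

open scoped Classical

namespace GlDuality

variable {k : Type*} [Field k] {n : ℕ}

/-- The adjoint action `X ↦ g X g⁻¹` of `GL_n(k)` on `gl_n(k)`. -/
def adj (g : GL (Fin n) k) : Matrix (Fin n) (Fin n) k →ₗ[k] Matrix (Fin n) (Fin n) k where
  toFun X := (g : Matrix (Fin n) (Fin n) k) * X * ((g⁻¹ : GL (Fin n) k) : Matrix (Fin n) (Fin n) k)
  map_add' X Y := by rw [mul_add, add_mul]
  map_smul' a X := by simp

theorem adj_apply (g : GL (Fin n) k) (X : Matrix (Fin n) (Fin n) k) :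
    adj g X = (g : Matrix (Fin n) (Fin n) k) * X *
      ((g⁻¹ : GL (Fin n) k) : Matrix (Fin n) (Fin n) k) := rfl

theorem adj_mul (g h : GL (Fin n) k) (X : Matrix (Fin n) (Fin n) k) :
    adj (g * h) X = adj g (adj h X) := by
  simp only [adj_apply, mul_inv_rev, Units.val_mul, mul_assoc]

theorem adj_one (X : Matrix (Fin n) (Fin n) k) : adj (1 : GL (Fin n) k) X = X := by
  simp [adj_apply]

/-! ### Parabolic subgroups with a Levi subgroup

A labelling `b : Fin n → ℕ` of the coordinates cuts matrices into blocks. `stdParabolic b` is the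
group of invertible block upper triangular matrices, `stdLevi b` the group of invertible block
diagonal ones. An arbitrary parabolic subgroup of `GL_n` defined over `k` together with a Levi
subgroup defined over `k` is a `GL_n(k)`-conjugate of such a pair, and is encoded by `b` and the
conjugating element `g`. -/

/-- `P_b(k)`: the invertible block upper triangular matrices. -/
def stdParabolic (k : Type*) [Field k] {n : ℕ} (b : Fin n → ℕ) : Subgroup (GL (Fin n) k) where
  carrier := {x | Matrix.BlockTriangular (x : Matrix (Fin n) (Fin n) k) b}
  mul_mem' hx hy := by
    simpa only [Set.mem_ofPred_eq, Units.val_mul] using Matrix.BlockTriangular.mul hx hy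
  one_mem' := by
    simpa only [Set.mem_ofPred_eq, Units.val_one] using Matrix.blockTriangular_one
  inv_mem' {x} hx := by
    have := x.invertible
    simpa only [Set.mem_ofPred_eq, Matrix.coe_units_inv] using
      Matrix.blockTriangular_inv_of_blockTriangular hx

/-- A matrix is block diagonal for the labelling `b`. -/
def IsBlockDiag (b : Fin n → ℕ) (X : Matrix (Fin n) (Fin n) k) : Prop :=
  ∀ i j, b i ≠ b j → X i j = 0

theorem isBlockDiag_iff (b : Fin n → ℕ) (X : Matrix (Fin n) (Fin n) k) :
    IsBlockDiag b X ↔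
      Matrix.BlockTriangular X b ∧ Matrix.BlockTriangular X (fun i => OrderDual.toDual (b i)) := by
  constructor
  · intro h
    exact ⟨fun i j hij => h i j (ne_of_gt hij), fun i j hij => h i j (ne_of_lt hij)⟩
  · rintro ⟨h1, h2⟩ i j hij
    rcases lt_or_gt_of_ne hij with h | h
    · exact h2 h
    · exact h1 h

/-- `L_b(k)`: the invertible block diagonal matrices. -/
def stdLevi (k : Type*) [Field k] {n : ℕ} (b : Fin n → ℕ) : Subgroup (GL (Fin n) k) where
  carrier := {x | IsBlockDiag b (x : Matrix (Fin n) (Fin n) k)}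
  mul_mem' {x y} hx hy := by
    simp only [Set.mem_ofPred_eq, Units.val_mul, isBlockDiag_iff] at hx hy ⊢
    exact ⟨hx.1.mul hy.1, hx.2.mul hy.2⟩
  one_mem' := by
    simp only [Set.mem_ofPred_eq, Units.val_one, isBlockDiag_iff]
    exact ⟨Matrix.blockTriangular_one, Matrix.blockTriangular_one⟩
  inv_mem' {x} hx := by
    have := x.invertible
    simp only [Set.mem_ofPred_eq, isBlockDiag_iff, Matrix.coe_units_inv] at hx ⊢
    exact ⟨Matrix.blockTriangular_inv_of_blockTriangular hx.1,
      Matrix.blockTriangular_inv_of_blockTriangular hx.2⟩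

/-- The (rational points of the) Lie algebra of `P_b`: block upper triangular matrices. -/
def stdParabolicLie (k : Type*) [Field k] {n : ℕ} (b : Fin n → ℕ) :
    Submodule k (Matrix (Fin n) (Fin n) k) where
  carrier := {X | Matrix.BlockTriangular X b}
  add_mem' hX hY := Matrix.BlockTriangular.add hX hY
  zero_mem' := Matrix.blockTriangular_zero
  smul_mem' a X hX := fun i j hij => by simp [hX hij]

/-- The Lie algebra of `L_b`: block diagonal matrices. -/
def stdLeviLie (k : Type*) [Field k] {n : ℕ} (b : Fin n → ℕ) :
    Submodule k (Matrix (Fin n) (Fin n) k) where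
  carrier := {X | IsBlockDiag b X}
  add_mem' hX hY := fun i j hij => by simp [hX i j hij, hY i j hij]
  zero_mem' := fun i j _ => rfl
  smul_mem' a X hX := fun i j hij => by simp [hX i j hij]

/-- The Lie algebra of the unipotent radical `U_b` of `P_b`: strictly block upper triangular
matrices. -/
def stdNilradLie (k : Type*) [Field k] {n : ℕ} (b : Fin n → ℕ) :
    Submodule k (Matrix (Fin n) (Fin n) k) where
  carrier := {X | ∀ i j, b j ≤ b i → X i j = 0}
  add_mem' hX hY := fun i j hij => by simp [hX i j hij, hY i j hij]
  zero_mem' := fun i j _ => rfl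
  smul_mem' a X hX := fun i j hij => by simp [hX i j hij]

/-- The projection of a matrix onto its block diagonal part. -/
def stdProj (b : Fin n → ℕ) (X : Matrix (Fin n) (Fin n) k) : Matrix (Fin n) (Fin n) k :=
  Matrix.of fun i j => if b i = b j then X i j else 0

variable (b : Fin n → ℕ) (g : GL (Fin n) k)

/-- `P = g P_b g⁻¹` (rational points). -/
def parabolic : Subgroup (GL (Fin n) k) :=
  (stdParabolic k b).comap (MulAut.conj g⁻¹).toMonoidHom

/-- `L = g L_b g⁻¹` (rational points). -/
def levi : Subgroup (GL (Fin n) k) :=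
  (stdLevi k b).comap (MulAut.conj g⁻¹).toMonoidHom

/-- The unipotent radical `U_P = g U_b g⁻¹` (rational points), as a set; `U_b` consists of
the block upper triangular matrices with identity diagonal blocks. -/
def unipRadical : Set (GL (Fin n) k) :=
  {x | ∀ i j, b j ≤ b i →
    ((g⁻¹ * x * g : GL (Fin n) k) : Matrix (Fin n) (Fin n) k) i j =
      (1 : Matrix (Fin n) (Fin n) k) i j}

/-- The Lie algebra of `P = g P_b g⁻¹`. -/
def parabolicLie : Submodule k (Matrix (Fin n) (Fin n) k) :=
  (stdParabolicLie k b).comap (adj g⁻¹)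

/-- The Lie algebra of `L = g L_b g⁻¹`. -/
def leviLie : Submodule k (Matrix (Fin n) (Fin n) k) :=
  (stdLeviLie k b).comap (adj g⁻¹)

/-- The Lie algebra of `U_P = g U_b g⁻¹`. -/
def nilradLie : Submodule k (Matrix (Fin n) (Fin n) k) :=
  (stdNilradLie k b).comap (adj g⁻¹)

/-- The projection onto the Lie algebra of `L`; on the Lie algebra of `P` it is the projection
along the Lie algebra of `U_P`. (The values off the Lie algebra of `P` are never used.) -/
def leviProj (X : Matrix (Fin n) (Fin n) k) : leviLie b g :=
  ⟨adj g (stdProj b (adj g⁻¹ X)), by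
    change IsBlockDiag b (adj g⁻¹ (adj g _))
    rw [← adj_mul, inv_mul_cancel, adj_one]
    intro i j hij
    simp [stdProj, hij]⟩

/-! ### Invariant functions -/

/-- `C(gl_n(k))`: the complex functions on `gl_n(k)` invariant under the adjoint action. -/
def invFun (k : Type*) [Field k] (n : ℕ) : Submodule ℂ (Matrix (Fin n) (Fin n) k → ℂ) where
  carrier := {f | ∀ (x : GL (Fin n) k) X, f (adj x X) = f X}
  add_mem' hf hf' := fun x X => by simp [hf x X, hf' x X]
  zero_mem' := fun _ _ => rfl
  smul_mem' a f hf := fun x X => by simp [hf x X]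

/-- The complex functions on the Lie algebra of `L` invariant under the adjoint action of `L`. -/
def leviInvFun : Submodule ℂ (leviLie b g → ℂ) where
  carrier := {f | ∀ l ∈ levi b g, ∀ X Y : leviLie b g,
    (Y : Matrix (Fin n) (Fin n) k) = adj l (X : Matrix (Fin n) (Fin n) k) → f Y = f X}
  add_mem' hf hf' := fun l hl X Y h => by simp [hf l hl X Y h, hf' l hl X Y h]
  zero_mem' := fun _ _ _ _ _ => rfl
  smul_mem' a f hf := fun l hl X Y h => by simp [hf l hl X Y h]

theorem adj_mem_nilradLie {l : GL (Fin n) k} (hl : l ∈ levi b g)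
    {Y : Matrix (Fin n) (Fin n) k} (hY : Y ∈ nilradLie b g) : adj l Y ∈ nilradLie b g := by
  have hl' : (MulAut.conj g⁻¹) l⁻¹ ∈ stdLevi k b := (levi b g).inv_mem hl
  have hl0 : (MulAut.conj g⁻¹) l ∈ stdLevi k b := hl
  have e : adj g⁻¹ (adj l Y) = adj ((MulAut.conj g⁻¹) l) (adj g⁻¹ Y) := by
    rw [← adj_mul, ← adj_mul]
    congr 1
    simp [mul_assoc]
  have hY' : ∀ i j, b j ≤ b i → adj g⁻¹ Y i j = 0 := hY
  rw [map_inv] at hl'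
  change ∀ i j, b j ≤ b i → adj g⁻¹ (adj l Y) i j = 0
  rw [e]
  generalize adj g⁻¹ Y = Z at hY'
  generalize (MulAut.conj g⁻¹) l = m at hl' hl0
  intro i j hij
  rw [adj_apply, Matrix.mul_apply]
  refine Finset.sum_eq_zero fun t _ => ?_
  rw [Matrix.mul_apply]
  by_cases htj : b t = b j
  · have : ∑ s, (m : Matrix (Fin n) (Fin n) k) i s * Z s t = 0 := by
      refine Finset.sum_eq_zero fun s _ => ?_
      by_cases his : b i = b s
      · rw [hY' s t (by omega), mul_zero]
      · rw [hl0 i s his, zero_mul]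
    rw [this, zero_mul]
  · rw [hl' t j htj, mul_zero]

/-- The labelling of `Fin (n₁ + n₂)` into a first block of size `n₁` and a second one of size
`n₂`. -/
def twoLabel (n₁ n₂ : ℕ) (i : Fin (n₁ + n₂)) : ℕ := if (i : ℕ) < n₁ then 0 else 1

/-- The upper left `n₁ × n₁` block. -/
def blockOne {n₁ n₂ : ℕ} (X : Matrix (Fin (n₁ + n₂)) (Fin (n₁ + n₂)) k) :
    Matrix (Fin n₁) (Fin n₁) k := X.submatrix (Fin.castAdd n₂) (Fin.castAdd n₂)

/-- The lower right `n₂ × n₂` block. -/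
def blockTwo {n₁ n₂ : ℕ} (X : Matrix (Fin (n₁ + n₂)) (Fin (n₁ + n₂)) k) :
    Matrix (Fin n₂) (Fin n₂) k := X.submatrix (Fin.natAdd n₁) (Fin.natAdd n₁)

theorem blockOne_mul {n₁ n₂ : ℕ} {X Y : Matrix (Fin (n₁ + n₂)) (Fin (n₁ + n₂)) k}
    (hX : IsBlockDiag (twoLabel n₁ n₂) X) : blockOne (X * Y) = blockOne X * blockOne Y := by
  ext i j
  simp only [blockOne, Matrix.submatrix_apply, Matrix.mul_apply, Fin.sum_univ_add]
  rw [Finset.sum_eq_zero (s := (Finset.univ : Finset (Fin n₂))), add_zero]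
  intro t _
  rw [hX _ _ (by simp [twoLabel]), zero_mul]

theorem blockTwo_mul {n₁ n₂ : ℕ} {X Y : Matrix (Fin (n₁ + n₂)) (Fin (n₁ + n₂)) k}
    (hX : IsBlockDiag (twoLabel n₁ n₂) X) : blockTwo (X * Y) = blockTwo X * blockTwo Y := by
  ext i j
  simp only [blockTwo, Matrix.submatrix_apply, Matrix.mul_apply, Fin.sum_univ_add]
  rw [Finset.sum_eq_zero (s := (Finset.univ : Finset (Fin n₁))), zero_add]
  intro t _
  rw [hX _ _ (by simp [twoLabel]), zero_mul]

theorem blockOne_one {n₁ n₂ : ℕ} :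
    blockOne (1 : Matrix (Fin (n₁ + n₂)) (Fin (n₁ + n₂)) k) = 1 :=
  Matrix.submatrix_one _ (Fin.castAdd_injective n₁ n₂)

theorem blockTwo_one {n₁ n₂ : ℕ} :
    blockTwo (1 : Matrix (Fin (n₁ + n₂)) (Fin (n₁ + n₂)) k) = 1 :=
  Matrix.submatrix_one _ (Fin.natAdd_injective n₂ n₁)

/-- `f₁ ⊠ f₂`, a function on `gl_{n₁}(k) × gl_{n₂}(k)`, seen as the block diagonal matrices in
`gl_{n₁+n₂}(k)`. -/
def boxProd {n₁ n₂ : ℕ} (f₁ : invFun k n₁) (f₂ : invFun k n₂) :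
    leviInvFun (twoLabel n₁ n₂) (1 : GL (Fin (n₁ + n₂)) k) :=
  ⟨fun X => f₁.1 (blockOne (X : Matrix (Fin (n₁ + n₂)) (Fin (n₁ + n₂)) k)) *
      f₂.1 (blockTwo (X : Matrix (Fin (n₁ + n₂)) (Fin (n₁ + n₂)) k)), by
    intro l hl X Y h
    have hl0 : l ∈ stdLevi k (twoLabel n₁ n₂) := by
      simpa [levi] using hl
    have hl1 : l⁻¹ ∈ stdLevi k (twoLabel n₁ n₂) := inv_mem hl0
    have hX : IsBlockDiag (twoLabel n₁ n₂) (X : Matrix (Fin (n₁ + n₂)) (Fin (n₁ + n₂)) k) := by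
      have := X.2
      change IsBlockDiag _ (adj (1 : GL (Fin (n₁ + n₂)) k)⁻¹ _) at this
      rwa [inv_one, adj_one] at this
    let l₁ : GL (Fin n₁) k := ⟨blockOne l.1, blockOne l⁻¹.1,
      by rw [← blockOne_mul hl0, Units.mul_inv, blockOne_one],
      by rw [← blockOne_mul hl1, Units.inv_mul, blockOne_one]⟩
    let l₂ : GL (Fin n₂) k := ⟨blockTwo l.1, blockTwo l⁻¹.1,
      by rw [← blockTwo_mul hl0, Units.mul_inv, blockTwo_one],
      by rw [← blockTwo_mul hl1, Units.inv_mul, blockTwo_one]⟩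
    have e1 : blockOne (Y : Matrix (Fin (n₁ + n₂)) (Fin (n₁ + n₂)) k) =
        adj l₁ (blockOne (X : Matrix (Fin (n₁ + n₂)) (Fin (n₁ + n₂)) k)) := by
      rw [h, adj_apply, mul_assoc, blockOne_mul hl0, blockOne_mul hX, adj_apply, mul_assoc]
      rfl
    have e2 : blockTwo (Y : Matrix (Fin (n₁ + n₂)) (Fin (n₁ + n₂)) k) =
        adj l₂ (blockTwo (X : Matrix (Fin (n₁ + n₂)) (Fin (n₁ + n₂)) k)) := by
      rw [h, adj_apply, mul_assoc, blockTwo_mul hl0, blockTwo_mul hX, adj_apply, mul_assoc]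
      rfl
    have h1 := f₁.2 l₁ (blockOne (X : Matrix (Fin (n₁ + n₂)) (Fin (n₁ + n₂)) k))
    have h2 := f₂.2 l₂ (blockTwo (X : Matrix (Fin (n₁ + n₂)) (Fin (n₁ + n₂)) k))
    simp only [e1, e2, h1, h2]⟩

/-- A linear endomorphism of `C(gl_n(k))` is involutive. -/
def IsInvolutive (T : invFun k n →ₗ[ℂ] invFun k n) : Prop := T ∘ₗ T = LinearMap.id

/-! ### Harish-Chandra restriction and induction -/

variable [Fintype k]

/-- Harish-Chandra restriction
`(*R f)(X) = |U_P|⁻¹ ∑_{Y ∈ Lie U_P} f (X + Y)`. -/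
def hcRes : invFun k n →ₗ[ℂ] leviInvFun b g where
  toFun f := ⟨fun X => (Nat.card (unipRadical b g) : ℂ)⁻¹ *
      ∑ Y : nilradLie b g, f.1 ((X : Matrix (Fin n) (Fin n) k) + Y), by
    intro l hl X X' h
    have hinv : l⁻¹ ∈ levi b g := inv_mem hl
    change (_ : ℂ) * _ = _ * _
    congr 1
    refine (Fintype.sum_equiv
      (⟨fun Y => ⟨adj l Y, adj_mem_nilradLie b g hl Y.2⟩,
        fun Y => ⟨adj l⁻¹ Y, adj_mem_nilradLie b g hinv Y.2⟩,
        fun Y => Subtype.ext (by simp [← adj_mul, adj_one]),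
        fun Y => Subtype.ext (by simp [← adj_mul, adj_one])⟩ : nilradLie b g ≃ nilradLie b g)
      _ _ fun Y => ?_).symm
    simp only [Equiv.coe_fn_mk]
    rw [h, ← map_add]
    exact (f.2 l _).symm⟩
  map_add' f f' := by
    ext X
    simp [Finset.sum_add_distrib, mul_add]
  map_smul' a f := by
    ext X
    simp only [Submodule.coe_smul, Pi.smul_apply, smul_eq_mul, ← Finset.mul_sum, RingHom.id_apply]
    ring

/-- The function `R f` of `hcInd` below. -/
def hcIndFun (f : leviLie b g → ℂ) (X : Matrix (Fin n) (Fin n) k) : ℂ :=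
  (Nat.card (parabolic b g) : ℂ)⁻¹ *
    ∑ x : GL (Fin n) k, if adj x X ∈ parabolicLie b g then f (leviProj b g (adj x X)) else 0

theorem hcIndFun_adj (f : leviLie b g → ℂ) (y : GL (Fin n) k) (X : Matrix (Fin n) (Fin n) k) :
    hcIndFun b g f (adj y X) = hcIndFun b g f X := by
  have h := Fintype.sum_equiv (Equiv.mulRight y)
    (fun x : GL (Fin n) k => if adj (x * y) X ∈ parabolicLie b g then
      f (leviProj b g (adj (x * y) X)) else 0)
    (fun x : GL (Fin n) k => if adj x X ∈ parabolicLie b g then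
      f (leviProj b g (adj x X)) else 0) (fun x => rfl)
  simp only [adj_mul] at h
  rw [hcIndFun, hcIndFun, h]

/-- Harish-Chandra induction
`(R f)(X) = |P|⁻¹ ∑_{x ∈ GL_n(k), xXx⁻¹ ∈ Lie P} f (π (x X x⁻¹))`. -/
def hcInd : leviInvFun b g →ₗ[ℂ] invFun k n where
  toFun f := ⟨hcIndFun b g f.1, fun y X => hcIndFun_adj b g f.1 y X⟩
  map_add' f f' := by
    ext X
    change hcIndFun b g (f.1 + f'.1) X = hcIndFun b g f.1 X + hcIndFun b g f'.1 X
    simp only [hcIndFun, ← mul_add, ← Finset.sum_add_distrib, Pi.add_apply]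
    congr 1
    refine Finset.sum_congr rfl fun x _ => ?_
    split_ifs <;> simp
  map_smul' a f := by
    ext X
    change hcIndFun b g (a • f.1) X = a * hcIndFun b g f.1 X
    rw [hcIndFun, hcIndFun, mul_left_comm a]
    congr 1
    rw [Finset.mul_sum]
    refine Finset.sum_congr rfl fun x _ => ?_
    split_ifs <;> simp

/-- The hermitian form `(f, f') = |GL_n(k)|⁻¹ ∑_X f(X) conj(f'(X))`. -/
def hermForm (f f' : invFun k n) : ℂ :=
  (Nat.card (GL (Fin n) k) : ℂ)⁻¹ *
    ∑ X : Matrix (Fin n) (Fin n) k, f.1 X * (starRingEnd ℂ) (f'.1 X)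

/-- `f` is pre-cuspidal: its Harish-Chandra restriction to every Levi subgroup of every proper
parabolic subgroup vanishes. (The parabolic is proper iff `b` is not constant.) -/
def IsPreCuspidal (f : invFun k n) : Prop :=
  ∀ (b : Fin n → ℕ) (g : GL (Fin n) k), (∃ i j, b i ≠ b j) → hcRes b g f = 0

/-! ### The duality operation `𝒟_n` -/

/-- The labelling by blocks of a composition `c = (c_1, …, c_r)` of `n`. The standard parabolic
subgroups, i.e. those containing the group `B` of upper triangular matrices, are the groups
`stdParabolic k (compLabel c)`, one for each composition `c`. -/
def compLabel (c : Composition n) (i : Fin n) : ℕ := (c.index i : ℕ)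

/-- A choice of a rational Borel subgroup `h B h⁻¹` and of a rational Levi subgroup in each
parabolic subgroup `P = h P_c h⁻¹` containing it. Levi subgroups of `P` are the groups
`g L_c g⁻¹` with `g ∈ h P_c`. -/
structure BorelLeviChoice (k : Type*) [Field k] (n : ℕ) where
  /-- the element `h` -/
  borel : GL (Fin n) k
  /-- the elements `g`, one for each parabolic subgroup containing the Borel subgroup -/
  elt : Composition n → GL (Fin n) k
  elt_mem : ∀ c, borel⁻¹ * elt c ∈ stdParabolic k (compLabel c)

/-- The semisimple rank of the parabolic subgroup of type `c`, i.e. of `∏ GL_{c_i}`. -/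
def ssRank (c : Composition n) : ℕ := ∑ i, (c.blocksFun i - 1)

/-- The duality operation `𝒟_n = ∑_P (-1)^{r(P)} R ∘ *R`. -/
def duality (χ : BorelLeviChoice k n) : invFun k n →ₗ[ℂ] invFun k n :=
  ∑ c : Composition n, (-1 : ℂ) ^ ssRank c •
    (hcInd (compLabel c) (χ.elt c) ∘ₗ hcRes (compLabel c) (χ.elt c))

/-! ### The characterising properties of the collection `𝔻_n` -/

/-- The conditions that characterise the collection `{𝔻_n}`. -/
structure IsDualityFamily (D : ∀ n : ℕ, invFun k n →ₗ[ℂ] invFun k n) : Prop where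
  zero : D 0 = LinearMap.id
  ind : ∀ n₁ n₂ : ℕ, 0 < n₁ → 0 < n₂ → ∀ (f₁ : invFun k n₁) (f₂ : invFun k n₂),
    D (n₁ + n₂) (hcInd (twoLabel n₁ n₂) 1 (boxProd f₁ f₂)) =
      hcInd (twoLabel n₁ n₂) 1 (boxProd (D n₁ f₁) (D n₂ f₂))
  preCuspidal : ∀ n : ℕ, 0 < n → ∀ f : invFun k n, IsPreCuspidal f →
    D n f = (-1 : ℂ) ^ (n - 1) • f

/-- A linear endomorphism of `C(gl_n(k))` is isometric for the hermitian form. -/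
def IsIsometric (T : invFun k n →ₗ[ℂ] invFun k n) : Prop :=
  ∀ f f' : invFun k n, hermForm (T f) (T f') = hermForm f f'

end GlDuality

end

end

noncomputable section

open scoped Classical

set_option linter.unusedSectionVars false

namespace GlDuality

universe u

/-! ### Class functions on endomorphisms of finite vector spaces -/

/-! Extend every invariant function on gl_n to an isomorphism-invariant function of pairs (finite
k-space, endomorphism), zero in the other dimensions (`extend`). All degrees then live in one space
`ClassFun`. Its Hall product `mul` is Harish-Chandra induction (`hcInd_boxProd`), and `res`, the
average over block triangular endomorphisms with prescribed diagonal blocks, is Harish-Chandra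
restriction in two blocks (`sum_nilradLie_twoLabel`). Viewed as a coproduct, `res` is compatible
with `mul` as in a bialgebra: this is the Mackey formula `res_mul`. No power of q appears in it,
because the number of subspaces of V × V' with given intersection with V and image in V' is exactly
compensated by the number of off-diagonal blocks stabilising one of them.

Counting frames turns R ∘ *R for any parabolic and Levi subgroup into a sum over stable flags
(`hcInd_hcRes`, `parOp_prod`, `parOp_label`), which no longer depends on the conjugating element.
Hence, up to the sign (-1)^n, 𝒟_n is the alternating sum `altSum` over all compositions
(`duality_eq`). This is the antipode S of the bialgebra: peeling off the first step of the flag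
gives its defining recursion `altSum_of_nontrivial`. Pre-cuspidal functions of positive degree are
primitive elements, so S(p) = -p and S(F p) = -p S(F) (`altSum_mul_primitive`).

An antipode only reverses products, so commutativity is needed. Induction is adjoint to restriction
(`hermForm_hcInd`), so a function orthogonal to all products is pre-cuspidal, and C_n is spanned by
products and pre-cuspidal functions (`invFun_induction`). For pre-cuspidal f and g the commutator of
f and g is pre-cuspidal by the Mackey formula and is also a difference of products; it is therefore
orthogonal to itself and vanishes. Thus the product is commutative and S is multiplicative
(`altSum_mul_extend`), which shows that (-1)^n S has the characterising properties.

The same spanning statement gives uniqueness and involutivity by induction on n. Each R ∘ *R is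
self-adjoint, hence so is 𝒟_n, and a self-adjoint involution is an isometry. -/

/-- A finite `k`-vector space with an endomorphism. -/
structure EndoSpace (k : Type u) [Field k] where
  /-- the underlying space -/
  carrier : Type u
  [grp : AddCommGroup carrier]
  [mod : Module k carrier]
  [fin : Finite carrier]
  /-- the endomorphism -/
  endo : Module.End k carrier

section

variable {k : Type u} [Field k]
variable {V V' : Type u} [AddCommGroup V] [Module k V] [Finite V]
  [AddCommGroup V'] [Module k V'] [Finite V']

/-- An endomorphism as an object of `EndoSpace`. -/
abbrev of (X : Module.End k V) : EndoSpace k := ⟨V, X⟩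

/-- Two endomorphisms are intertwined by a linear isomorphism. -/
def Conj (X : Module.End k V) (X' : Module.End k V') : Prop :=
  ∃ e : V ≃ₗ[k] V', ∀ v, e (X v) = X' (e v)

theorem Conj.symm {X : Module.End k V} {X' : Module.End k V'} (h : Conj X X') : Conj X' X := by
  obtain ⟨e, he⟩ := h
  exact ⟨e.symm, fun v => by rw [LinearEquiv.symm_apply_eq, he, LinearEquiv.apply_symm_apply]⟩

variable (k) in
/-- The complex valued functions of pairs (finite `k`-space, endomorphism) that are invariant
under isomorphism. -/
def ClassFun : Submodule ℂ (EndoSpace k → ℂ) where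
  carrier := {f | ∀ (V V' : Type u) [AddCommGroup V] [Module k V] [Finite V]
    [AddCommGroup V'] [Module k V'] [Finite V'] (X : Module.End k V) (X' : Module.End k V'),
    Conj X X' → f (of X) = f (of X')}
  add_mem' hf hg := by
    intro V V' _ _ _ _ _ _ X X' h
    simp [hf V V' X X' h, hg V V' X X' h]
  zero_mem' := by
    intro V V' _ _ _ _ _ _ X X' _
    rfl
  smul_mem' a f hf := by
    intro V V' _ _ _ _ _ _ X X' h
    simp [hf V V' X X' h]

theorem val_congr (F : ClassFun k) {X : Module.End k V} {X' : Module.End k V'}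
    (h : Conj X X') : F.1 (of X) = F.1 (of X') := F.2 V V' X X' h

theorem ClassFun.ext {F G : ClassFun k} (h : ∀ (V : Type u) [AddCommGroup V] [Module k V] [Finite V]
    (X : Module.End k V), F.1 (of X) = G.1 (of X)) : F = G :=
  Subtype.ext (funext fun M => @h M.carrier M.grp M.mod M.fin M.endo)

/-- The subspaces stable under `X`. -/
@[ext] structure Stab (X : Module.End k V) where
  /-- the subspace -/
  carrier : Submodule k V
  stable : ∀ v ∈ carrier, X v ∈ carrier

instance (X : Module.End k V) : Finite (Stab X) :=
  Finite.of_injective (fun W : Stab X => (W.1 : Set V)) fun _ _ h =>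
    Stab.ext (SetLike.coe_injective h)

instance (X : Module.End k V) : Fintype (Stab X) := Fintype.ofFinite _

instance : Finite (V →ₗ[k] V') := Finite.of_injective (fun f => (f : V → V')) DFunLike.coe_injective

instance : Fintype (V →ₗ[k] V') := Fintype.ofFinite _

instance (W : Submodule k V) : Finite (V ⧸ W) := Finite.of_surjective _ W.mkQ_surjective

/-- The restriction of `X` to a stable subspace. -/
def restr (X : Module.End k V) (W : Stab X) : Module.End k W.1 := X.restrict W.2

/-- The endomorphism of the quotient by a stable subspace. -/
def quot (X : Module.End k V) (W : Stab X) : Module.End k (V ⧸ W.1) := W.1.mapQ W.1 X W.2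

theorem conj_restr (X : Module.End k V) (W : Stab X) {X' : Module.End k V'} (ι : V' →ₗ[k] V)
    (hι : Function.Injective ι) (hr : LinearMap.range ι = W.1)
    (h : ∀ v, ι (X' v) = X (ι v)) : Conj (restr X W) X' := by
  refine Conj.symm ⟨(LinearEquiv.ofInjective ι hι).trans (LinearEquiv.ofEq _ _ hr), fun v => ?_⟩
  apply Subtype.ext
  exact h v

theorem conj_quot (X : Module.End k V) (W : Stab X) {X' : Module.End k V'} (π : V →ₗ[k] V')
    (hπ : Function.Surjective π) (hr : LinearMap.ker π = W.1)
    (h : ∀ v, π (X v) = X' (π v)) : Conj (quot X W) X' := by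
  refine ⟨(Submodule.quotEquivOfEq _ _ hr.symm).trans (π.quotKerEquivOfSurjective hπ), fun v => ?_⟩
  obtain ⟨v, rfl⟩ := Submodule.Quotient.mk_surjective _ v
  exact h v

/-- `A ∩ B` as a stable subspace of `B`. -/
def Stab.sub {X : Module.End k V} (A B : Stab X) : Stab (restr X B) :=
  ⟨A.1.comap B.1.subtype, fun _ hv => A.2 _ hv⟩

/-- `(A + B) / A` as a stable subspace of the quotient by `A`. -/
def Stab.quo {X : Module.End k V} (A B : Stab X) : Stab (quot X A) :=
  ⟨B.1.map A.1.mkQ, by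
    rintro _ ⟨v, hv, rfl⟩
    exact ⟨X v, B.2 v hv, rfl⟩⟩

instance (X : Module.End k V) : Bot (Stab X) := ⟨⟨⊥, by simp⟩⟩
instance (X : Module.End k V) : Top (Stab X) := ⟨⟨⊤, by simp⟩⟩
@[simp] theorem Stab.coe_bot (X : Module.End k V) : (⊥ : Stab X).1 = ⊥ := rfl
@[simp] theorem Stab.coe_top (X : Module.End k V) : (⊤ : Stab X).1 = ⊤ := rfl

theorem conj_restr_sub {X : Module.End k V} {A B : Stab X} (h : A.1 ≤ B.1) :
    Conj (restr (restr X B) (A.sub B)) (restr X A) := by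
  refine conj_restr _ _ (Submodule.inclusion h) (Submodule.inclusion_injective h) ?_ fun v => rfl
  rw [Submodule.range_inclusion]
  rfl

/-- The second isomorphism theorem B / (A ∩ B) ≅ (A + B) / A, so no inclusion between A and B is
required. -/
theorem conj_quot_sub {X : Module.End k V} (A B : Stab X) :
    Conj (quot (restr X B) (A.sub B)) (restr (quot X A) (A.quo B)) := by
  refine conj_quot _ _ ((A.1.mkQ.restrict (p := B.1) (q := (A.quo B).1)
    fun w hw => ⟨w, hw, rfl⟩)) ?_ ?_ fun _ => rfl
  · rintro ⟨_, v, hv, rfl⟩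
    exact ⟨⟨v, hv⟩, rfl⟩
  · ext v
    rw [LinearMap.mem_ker, ← Submodule.coe_eq_zero]
    exact Submodule.Quotient.mk_eq_zero _

theorem conj_quot_quo {X : Module.End k V} {A B : Stab X} (h : A.1 ≤ B.1) :
    Conj (quot (quot X A) (A.quo B)) (quot X B) := by
  refine conj_quot _ _ (Submodule.factor h) (Submodule.factor_surjective h) ?_ fun v => ?_
  · ext v
    obtain ⟨v, rfl⟩ := Submodule.Quotient.mk_surjective _ v
    change Submodule.Quotient.mk v = (0 : V ⧸ B.1) ↔ _
    rw [Submodule.Quotient.mk_eq_zero]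
    constructor
    · intro hv
      exact ⟨v, hv, rfl⟩
    · rintro ⟨w, hw, hwv⟩
      have := h ((Submodule.Quotient.eq A.1).1 hwv)
      simpa using B.1.sub_mem hw this
  · obtain ⟨v, rfl⟩ := Submodule.Quotient.mk_surjective _ v
    rfl

/-- Stable subspaces of B are the stable subspaces of V contained in B. Summing over all of `Stab X`
with a condition makes iterated sums interchangeable, since the index type no longer depends on B;
`sum_stab_quot` does the same for quotients. -/
theorem sum_stab_restr {X : Module.End k V} (B : Stab X) (g : Stab (restr X B) → ℂ) :
    ∑ A, g A = ∑ A : Stab X, if A.1 ≤ B.1 then g (A.sub B) else 0 := by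
  rw [← Finset.sum_filter]
  symm
  refine Finset.sum_bij' (fun (A : Stab X) _ => A.sub B)
    (fun (A : Stab (restr X B)) _ => (⟨A.1.map B.1.subtype, ?_⟩ : Stab X)) ?_ ?_ ?_ ?_ ?_
  · rintro _ ⟨v, hv, rfl⟩
    exact ⟨restr X B v, A.2 v hv, rfl⟩
  · simp
  · intro A _
    exact Finset.mem_filter.2 ⟨Finset.mem_univ _, Submodule.map_subtype_le B.1 A.1⟩
  · intro A hA
    apply Stab.ext
    simpa [Stab.sub, Submodule.map_comap_subtype] using hA
  · intro A _
    apply Stab.ext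
    exact Submodule.comap_map_eq_of_injective B.1.subtype_injective _
  · simp

theorem sum_stab_quot {X : Module.End k V} (A : Stab X) (g : Stab (quot X A) → ℂ) :
    ∑ C, g C = ∑ B : Stab X, if A.1 ≤ B.1 then g (A.quo B) else 0 := by
  rw [← Finset.sum_filter]
  symm
  refine Finset.sum_bij' (fun (B : Stab X) _ => A.quo B)
    (fun (C : Stab (quot X A)) _ => (⟨C.1.comap A.1.mkQ, fun v hv => C.2 _ hv⟩ : Stab X)) ?_ ?_ ?_ ?_ ?_
  · simp
  · intro C _
    exact Finset.mem_filter.2 ⟨Finset.mem_univ _, Submodule.le_comap_mkQ A.1 C.1⟩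
  · intro B hB
    apply Stab.ext
    simpa [Stab.quo, Submodule.comap_map_mkQ] using hB
  · intro C _
    apply Stab.ext
    exact Submodule.map_comap_eq_of_surjective A.1.mkQ_surjective _
  · simp

/-- The bijection between stable subspaces induced by an intertwining isomorphism. -/
def stabEquiv {X : Module.End k V} {X' : Module.End k V'} (e : V ≃ₗ[k] V')
    (he : ∀ v, e (X v) = X' (e v)) : Stab X ≃ Stab X' where
  toFun W := ⟨W.1.map (e : V →ₗ[k] V'), by
    rintro _ ⟨v, hv, rfl⟩
    exact ⟨X v, W.2 v hv, he v⟩⟩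
  invFun W := ⟨W.1.comap (e : V →ₗ[k] V'), fun v hv => by
    change e (X v) ∈ W.1
    rw [he]
    exact W.2 _ hv⟩
  left_inv W := Stab.ext (Submodule.comap_map_eq_of_injective e.injective _)
  right_inv W := Stab.ext (Submodule.map_comap_eq_of_surjective e.surjective _)

theorem conj_restr_stabEquiv {X : Module.End k V} {X' : Module.End k V'} (e : V ≃ₗ[k] V')
    (he : ∀ v, e (X v) = X' (e v)) (W : Stab X) :
    Conj (restr X W) (restr X' (stabEquiv e he W)) :=
  ⟨e.submoduleMap W.1, fun v => Subtype.ext (he v)⟩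

theorem conj_quot_stabEquiv {X : Module.End k V} {X' : Module.End k V'} (e : V ≃ₗ[k] V')
    (he : ∀ v, e (X v) = X' (e v)) (W : Stab X) :
    Conj (quot X W) (quot X' (stabEquiv e he W)) := by
  refine ⟨Submodule.Quotient.equiv W.1 (stabEquiv e he W).1 e rfl, fun v => ?_⟩
  obtain ⟨v, rfl⟩ := Submodule.Quotient.mk_surjective _ v
  exact congrArg (Submodule.Quotient.mk (p := (stabEquiv e he W).1)) (he v)

/-! ### The Hall product -/

/-- The Hall product: `(F * G)(X)` is the sum over the stable subspaces `W` of
`F (X | W) G (X | V / W)`. -/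
def mul (F G : ClassFun k) : ClassFun k :=
  ⟨fun M => letI := M.grp; letI := M.mod; haveI := M.fin
    ∑ W : Stab M.endo, F.1 (of (restr M.endo W)) * G.1 (of (quot M.endo W)), by
    rintro V V' _ _ _ _ _ _ X X' ⟨e, he⟩
    refine Fintype.sum_equiv (stabEquiv e he) _ _ fun W => ?_
    exact congrArg₂ (· * ·) (val_congr F (conj_restr_stabEquiv e he W))
      (val_congr G (conj_quot_stabEquiv e he W))⟩

theorem mul_apply (F G : ClassFun k) (X : Module.End k V) :
    (mul F G).1 (of X) = ∑ W : Stab X, F.1 (of (restr X W)) * G.1 (of (quot X W)) := rfl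

/-- Both sides are the sum over flags A ≤ B of F on A, G on B / A and H on V / B. -/
theorem mul_assoc' (F G H : ClassFun k) : mul (mul F G) H = mul F (mul G H) := by
  apply ClassFun.ext
  intro V _ _ _ X
  simp only [mul_apply, sum_stab_restr, sum_stab_quot, Finset.sum_mul, Finset.mul_sum]
  rw [Finset.sum_comm]
  refine Finset.sum_congr rfl fun A _ => Finset.sum_congr rfl fun B _ => ?_
  split_ifs with h
  · rw [val_congr F (conj_restr_sub h), val_congr G (conj_quot_sub A B), val_congr H (conj_quot_quo h)]
    ring
  · simp

theorem mul_add' (F G H : ClassFun k) : mul F (G + H) = mul F G + mul F H := by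
  apply ClassFun.ext
  intro V _ _ _ X
  simp only [mul_apply, Submodule.coe_add, Pi.add_apply, mul_add, Finset.sum_add_distrib]

theorem add_mul' (F G H : ClassFun k) : mul (F + G) H = mul F H + mul G H := by
  apply ClassFun.ext
  intro V _ _ _ X
  simp only [mul_apply, Submodule.coe_add, Pi.add_apply, add_mul, Finset.sum_add_distrib]

theorem mul_smul' (a : ℂ) (F G : ClassFun k) : mul F (a • G) = a • mul F G := by
  apply ClassFun.ext
  intro V _ _ _ X
  simp only [mul_apply, Submodule.coe_smul, Pi.smul_apply, smul_eq_mul, Finset.mul_sum]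
  exact Finset.sum_congr rfl fun W _ => by ring

theorem smul_mul' (a : ℂ) (F G : ClassFun k) : mul (a • F) G = a • mul F G := by
  apply ClassFun.ext
  intro V _ _ _ X
  simp only [mul_apply, Submodule.coe_smul, Pi.smul_apply, smul_eq_mul, Finset.mul_sum]
  exact Finset.sum_congr rfl fun W _ => by ring

variable (k) in
/-- The indicator function of the zero space. -/
def one : ClassFun k :=
  ⟨fun M => if Subsingleton M.carrier then 1 else 0, by
    rintro V V' _ _ _ _ _ _ X X' ⟨e, he⟩
    simp only [e.toEquiv.subsingleton_congr]⟩

theorem one_apply (X : Module.End k V) : (one k).1 (of X) = if Subsingleton V then 1 else 0 := rfl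

theorem conj_restr_top (X : Module.End k V) : Conj (restr X ⊤) X :=
  conj_restr X ⊤ LinearMap.id (fun _ _ h => h) (by simp) fun v => rfl

theorem conj_quot_bot (X : Module.End k V) : Conj (quot X ⊥) X :=
  conj_quot X ⊥ LinearMap.id (fun v => ⟨v, rfl⟩) (by simp) fun v => rfl

theorem one_mul' (F : ClassFun k) : mul (one k) F = F := by
  apply ClassFun.ext
  intro V _ _ _ X
  rw [mul_apply, Finset.sum_eq_single ⊥]
  · rw [one_apply, if_pos (by rw [Stab.coe_bot]; infer_instance), one_mul]
    exact val_congr F (conj_quot_bot X)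
  · intro W _ hW
    rw [one_apply, if_neg, zero_mul]
    intro h
    exact hW (Stab.ext (Submodule.subsingleton_iff_eq_bot.1 h))
  · simp

theorem mul_one' (F : ClassFun k) : mul F (one k) = F := by
  apply ClassFun.ext
  intro V _ _ _ X
  rw [mul_apply, Finset.sum_eq_single ⊤]
  · rw [one_apply, if_pos (by rw [Stab.coe_top]; infer_instance), mul_one]
    exact val_congr F (conj_restr_top X)
  · intro W _ hW
    rw [one_apply, if_neg, mul_zero]
    intro h
    exact hW (Stab.ext (Submodule.Quotient.subsingleton_iff.1 h))
  · simp

/-! ### Restriction -/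

/-- The block upper triangular endomorphism with diagonal blocks `X₁`, `X₂` and upper right
block `Y`. -/
def tri (X₁ : Module.End k V) (Y : V' →ₗ[k] V) (X₂ : Module.End k V') : Module.End k (V × V') :=
  (X₁.coprod Y).prod (X₂ ∘ₗ LinearMap.snd k V V')

@[simp] theorem tri_apply (X₁ : Module.End k V) (Y : V' →ₗ[k] V) (X₂ : Module.End k V')
    (v : V × V') : tri X₁ Y X₂ v = (X₁ v.1 + Y v.2, X₂ v.2) := rfl

/-- The average of `F` over the block upper triangular endomorphisms with diagonal blocks `X₁` and
`X₂`, as a function of `X₂`. -/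
def res (X₁ : Module.End k V) : ClassFun k →ₗ[ℂ] ClassFun k where
  toFun F := ⟨fun M => letI := M.grp; letI := M.mod; haveI := M.fin
    (Nat.card (M.carrier →ₗ[k] V) : ℂ)⁻¹ * ∑ Y : M.carrier →ₗ[k] V, F.1 (of (tri X₁ Y M.endo)), by
    intro V₂ V₂' _ _ _ _ _ _ X X' ⟨e, he⟩
    let E : (V₂ →ₗ[k] V) ≃ₗ[k] (V₂' →ₗ[k] V) := e.arrowCongr (LinearEquiv.refl k V)
    change (Nat.card (V₂ →ₗ[k] V) : ℂ)⁻¹ * _ = (Nat.card (V₂' →ₗ[k] V) : ℂ)⁻¹ * _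
    rw [Nat.card_congr E.toEquiv]
    congr 1
    refine Fintype.sum_equiv E.toEquiv _ _ fun Y => val_congr F ?_
    refine ⟨(LinearEquiv.refl k V).prodCongr e, fun v => ?_⟩
    simp [E, he, LinearEquiv.arrowCongr_apply]⟩
  map_add' F G := by
    apply ClassFun.ext
    intro V _ _ _ X
    simp [Finset.sum_add_distrib, mul_add]
  map_smul' a F := by
    apply ClassFun.ext
    intro V _ _ _ X
    simp only [Submodule.coe_smul, Pi.smul_apply, smul_eq_mul, ← Finset.mul_sum, RingHom.id_apply]
    ring

theorem res_apply (X₁ : Module.End k V) (F : ClassFun k) (X₂ : Module.End k V') :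
    (res X₁ F).1 (of X₂) =
      (Nat.card (V' →ₗ[k] V) : ℂ)⁻¹ * ∑ Y : V' →ₗ[k] V, F.1 (of (tri X₁ Y X₂)) := rfl

theorem res_congr {X : Module.End k V} {X' : Module.End k V'} (h : Conj X X') (F : ClassFun k) :
    res X F = res X' F := by
  obtain ⟨e, he⟩ := h
  apply ClassFun.ext
  intro V₂ _ _ _ X₂
  let E : (V₂ →ₗ[k] V) ≃ₗ[k] (V₂ →ₗ[k] V') := (LinearEquiv.refl k V₂).arrowCongr e
  rw [res_apply, res_apply, Nat.card_congr E.toEquiv]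
  congr 1
  refine Fintype.sum_equiv E.toEquiv _ _ fun Y => val_congr F ?_
  refine ⟨e.prodCongr (LinearEquiv.refl k V₂), fun v => ?_⟩
  simp [E, he, LinearEquiv.arrowCongr_apply]

theorem res_of_subsingleton [Subsingleton V] (X : Module.End k V) (F : ClassFun k) :
    res X F = F := by
  apply ClassFun.ext
  intro V₂ _ _ _ X₂
  have : Unique (V₂ →ₗ[k] V) := ⟨⟨0⟩, fun f => by ext v; exact Subsingleton.elim _ _⟩
  rw [res_apply, Fintype.sum_unique, Nat.card_unique, Nat.cast_one, inv_one, one_mul]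
  refine val_congr F ⟨⟨LinearMap.snd k V V₂, fun v => (0, v), fun v => ?_, fun v => rfl⟩, fun v => rfl⟩
  exact Prod.ext (Subsingleton.elim _ _) rfl

theorem res_apply_of_subsingleton [Subsingleton V'] (X₁ : Module.End k V) (X₂ : Module.End k V')
    (F : ClassFun k) : (res X₁ F).1 (of X₂) = F.1 (of X₁) := by
  have : Unique (V' →ₗ[k] V) := ⟨⟨0⟩, fun f => by
    ext v; rw [Subsingleton.elim v 0, map_zero, map_zero]⟩
  rw [res_apply, Fintype.sum_unique, Nat.card_unique, Nat.cast_one, inv_one, one_mul]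
  refine val_congr F ⟨⟨LinearMap.fst k V V', fun v => (v, 0), fun v => ?_, fun v => rfl⟩, fun v => ?_⟩
  · exact Prod.ext rfl (Subsingleton.elim _ _)
  · change X₁ v.1 + _ = X₁ v.1
    rw [LinearMap.comp_apply, LinearMap.snd_apply, Subsingleton.elim v.2 0, map_zero, add_zero]

end

/-! ### Restriction of a product -/

theorem sum_dite_eq_sum {α β : Type*} [Fintype α] [Fintype β] {p : α → Prop} (e : {x // p x} ≃ β)
    (f : β → ℂ) :
    ∑ x : α, (if h : p x then f (e ⟨x, h⟩) else 0) = ∑ y, f y := by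
  symm
  refine Finset.sum_of_injOn (fun y => (e.symm y : α))
    (Subtype.val_injective.comp e.symm.injective).injOn (fun _ _ => by simp) ?_ ?_
  · intro x _ hx
    rw [dif_neg]
    intro h
    exact hx ⟨e ⟨x, h⟩, by simp, by simp⟩
  · intro y _
    rw [dif_pos (e.symm y).2]
    simp

/-- All fibres of a surjective homomorphism have the size of its kernel, so averaging over M a
function pulled back from N is averaging over N. The case h = 1 computes the size of the kernel. -/
theorem card_mul_sum_comp {M N : Type*} [AddGroup M] [AddGroup N] [Fintype M] [Fintype N]
    (ρ : M →+ N) (hρ : Function.Surjective ρ) (h : N → ℂ) :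
    (Nat.card N : ℂ) * ∑ m, h (ρ m) = Nat.card M * ∑ n, h n := by
  have hfib : ∀ n, (Finset.univ.filter fun m => ρ m = n).card =
      (Finset.univ.filter fun m => ρ m = 0).card := fun n =>
    AddMonoidHom.card_fiber_eq_of_mem_range ρ (hρ n) (hρ 0)
  have key : ∀ g : N → ℂ,
      ∑ m, g (ρ m) = (Finset.univ.filter fun m => ρ m = 0).card * ∑ n, g n := by
    intro g
    rw [← Finset.sum_fiberwise Finset.univ ρ, Finset.mul_sum]
    refine Finset.sum_congr rfl fun n _ => ?_
    rw [Finset.sum_congr rfl (g := fun _ => g n), Finset.sum_const, hfib, nsmul_eq_mul]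
    intro m hm
    rw [(Finset.mem_filter.1 hm).2]
  have h1 := key fun _ => 1
  simp only [Finset.sum_const, Finset.card_univ, nsmul_eq_mul, mul_one] at h1
  rw [key h, Nat.card_eq_fintype_card, Nat.card_eq_fintype_card, h1]
  ring

/-! ### Shears and the subspaces of V × V' -/

section

variable {k : Type u} [Field k]
variable {V V' : Type u} [AddCommGroup V] [Module k V] [Finite V]
  [AddCommGroup V'] [Module k V'] [Finite V']

instance : Finite (Submodule k V) :=
  Finite.of_injective (fun W : Submodule k V => (W : Set V)) SetLike.coe_injective

instance : Fintype (Submodule k V) := Fintype.ofFinite _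

/-- The automorphism `(v, v') ↦ (v + u v', v')` of `V × V'`. -/
def shear (u : V' →ₗ[k] V) : (V × V') ≃ₗ[k] (V × V') where
  toFun v := (v.1 + u v.2, v.2)
  invFun v := (v.1 - u v.2, v.2)
  map_add' v w := by
    ext
    · simp only [Prod.fst_add, Prod.snd_add, map_add]; abel
    · rfl
  map_smul' a v := by ext <;> simp
  left_inv v := by simp
  right_inv v := by simp

theorem mem_map_shear {u : V' →ₗ[k] V} {A : Submodule k V} {B : Submodule k V'} {v : V × V'} :
    v ∈ (A.prod B).map (shear u : V × V' →ₗ[k] V × V') ↔ v.1 - u v.2 ∈ A ∧ v.2 ∈ B := by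
  rw [Submodule.mem_map_equiv]
  rfl

/-- The linear maps `V' → V` that map `B` into `A`. -/
def homFilt (A : Submodule k V) (B : Submodule k V') : Submodule k (V' →ₗ[k] V) where
  carrier := {Y | ∀ b ∈ B, Y b ∈ A}
  add_mem' h h' := fun b hb => A.add_mem (h b hb) (h' b hb)
  zero_mem' := fun _ _ => A.zero_mem
  smul_mem' a _ h := fun b hb => A.smul_mem a (h b hb)

/-- The stabiliser of A × B in the group of shears is `homFilt A B`; the translates of A × B are
therefore counted by the cosets of this subspace of Hom(V', V). -/
theorem map_shear_eq_iff {u u' : V' →ₗ[k] V} {A : Submodule k V} {B : Submodule k V'} :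
    (A.prod B).map (shear u : V × V' →ₗ[k] V × V') =
      (A.prod B).map (shear u' : V × V' →ₗ[k] V × V') ↔ u - u' ∈ homFilt A B := by
  constructor
  · intro h b hb
    have : (u b, b) ∈ (A.prod B).map (shear u : V × V' →ₗ[k] V × V') :=
      mem_map_shear.2 ⟨by simp, hb⟩
    rw [h] at this
    exact (mem_map_shear.1 this).1
  · intro h
    ext v
    rw [mem_map_shear, mem_map_shear]
    refine and_congr_left fun hv => ?_
    have := h _ hv
    rw [LinearMap.sub_apply] at this
    rw [← A.add_mem_iff_left this]
    congr! 1
    abel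

/-- A linear section of the projection of W onto its image in V', followed by the first coordinate
and extended to all of V', is the required u. Hence the subspaces with given trace A and image B
form a single orbit under shears. -/
theorem exists_eq_map_shear (W : Submodule k (V × V')) :
    ∃ u : V' →ₗ[k] V, W = ((W.comap (LinearMap.inl k V V')).prod
      (W.map (LinearMap.snd k V V'))).map (shear u : V × V' →ₗ[k] V × V') := by
  set B := W.map (LinearMap.snd k V V')
  let f : W →ₗ[k] B := (LinearMap.snd k V V').restrict fun w hw => ⟨w, hw, rfl⟩
  have hf : Function.Surjective f := by
    rintro ⟨_, w, hw, rfl⟩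
    exact ⟨⟨w, hw⟩, rfl⟩
  obtain ⟨s, hs⟩ := f.exists_rightInverse_of_surjective (LinearMap.range_eq_top.2 hf)
  obtain ⟨u, hu⟩ := LinearMap.exists_extend ((LinearMap.fst k V V') ∘ₗ W.subtype ∘ₗ s)
  refine ⟨u, ?_⟩
  have key : ∀ b : B, ((u b, (b : V')) : V × V') ∈ W := by
    intro b
    have h1 : u b = (s b : V × V').1 := LinearMap.congr_fun hu b
    have h2 : (s b : V × V').2 = b := congrArg Subtype.val (LinearMap.congr_fun hs b)
    rw [h1, ← h2]
    exact (s b).2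
  ext v
  rw [mem_map_shear]
  constructor
  · intro hv
    have hB : v.2 ∈ B := ⟨v, hv, rfl⟩
    refine ⟨?_, hB⟩
    have := W.sub_mem hv (key ⟨v.2, hB⟩)
    rw [Submodule.mem_comap]
    convert this using 1
    ext <;> simp
  · rintro ⟨h1, h2⟩
    have := W.add_mem h1 (key ⟨v.2, h2⟩)
    convert this using 1
    ext <;> simp

theorem comap_inl_map_shear (u : V' →ₗ[k] V) (A : Submodule k V) (B : Submodule k V') :
    ((A.prod B).map (shear u : V × V' →ₗ[k] V × V')).comap (LinearMap.inl k V V') = A := by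
  ext v
  rw [Submodule.mem_comap, mem_map_shear]
  simp

theorem map_snd_map_shear (u : V' →ₗ[k] V) (A : Submodule k V) (B : Submodule k V') :
    ((A.prod B).map (shear u : V × V' →ₗ[k] V × V')).map (LinearMap.snd k V V') = B := by
  ext v
  constructor
  · rintro ⟨w, hw, rfl⟩
    exact (mem_map_shear.1 hw).2
  · intro hv
    exact ⟨(u v, v), mem_map_shear.2 ⟨by simp, hv⟩, rfl⟩

/-- Conjugation by a shear fixes the diagonal blocks and translates Y by an amount independent of Y.
A sum over all Y is thus unaffected, which is used in `sum_mulTerm_map_shear`. -/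
theorem shear_tri (X₁ : Module.End k V) (Y : V' →ₗ[k] V) (X₂ : Module.End k V') (u : V' →ₗ[k] V)
    (v : V × V') :
    shear u (tri X₁ Y X₂ v) = tri X₁ (Y + (u ∘ₗ X₂ - X₁ ∘ₗ u)) X₂ (shear u v) := by
  ext
  · simp only [shear, tri_apply, LinearEquiv.coe_mk, LinearMap.coe_mk, AddHom.coe_mk, map_add,
      LinearMap.add_apply, LinearMap.sub_apply, LinearMap.comp_apply]
    abel
  · rfl

/-- The summand of `mul F G` at `X` indexed by `W`, zero if `W` is not stable. -/
def mulTerm (F G : ClassFun k) (X : Module.End k V) (W : Submodule k V) : ℂ :=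
  if h : ∀ v ∈ W, X v ∈ W then F.1 (of (restr X ⟨W, h⟩)) * G.1 (of (quot X ⟨W, h⟩)) else 0

theorem mul_apply_eq_sum_mulTerm (F G : ClassFun k) (X : Module.End k V) :
    (mul F G).1 (of X) = ∑ W : Submodule k V, mulTerm F G X W := by
  rw [mul_apply]
  unfold mulTerm
  exact (sum_dite_eq_sum (⟨fun W => ⟨W.1, W.2⟩, fun W => ⟨W.1, W.2⟩, fun _ => rfl, fun _ => rfl⟩ :
    {W : Submodule k V // ∀ v ∈ W, X v ∈ W} ≃ Stab X)
    (fun W : Stab X => F.1 (of (restr X W)) * G.1 (of (quot X W)))).symm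

theorem mulTerm_map (F G : ClassFun k) {X : Module.End k V} {X' : Module.End k V'}
    (e : V ≃ₗ[k] V') (he : ∀ v, e (X v) = X' (e v)) (W : Submodule k V) :
    mulTerm F G X W = mulTerm F G X' (W.map (e : V →ₗ[k] V')) := by
  unfold mulTerm
  by_cases h : ∀ v ∈ W, X v ∈ W
  · have h' : ∀ v ∈ W.map (e : V →ₗ[k] V'), X' v ∈ W.map (e : V →ₗ[k] V') :=
      (stabEquiv e he ⟨W, h⟩).2
    rw [dif_pos h, dif_pos h', val_congr F (conj_restr_stabEquiv e he ⟨W, h⟩),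
      val_congr G (conj_quot_stabEquiv e he ⟨W, h⟩)]
    rfl
  · rw [dif_neg h, dif_neg]
    intro h'
    refine h fun v hv => ?_
    obtain ⟨w, hw, hwe⟩ := h' (e v) ⟨v, hv, rfl⟩
    rw [← he] at hwe
    rwa [← e.injective hwe]

theorem sum_mulTerm_map_shear (F G : ClassFun k) (X₁ : Module.End k V) (X₂ : Module.End k V')
    (u : V' →ₗ[k] V) (W : Submodule k (V × V')) :
    ∑ Y : V' →ₗ[k] V, mulTerm F G (tri X₁ Y X₂) (W.map (shear u : V × V' →ₗ[k] V × V')) =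
      ∑ Y : V' →ₗ[k] V, mulTerm F G (tri X₁ Y X₂) W := by
  symm
  refine Fintype.sum_equiv (Equiv.addRight (u ∘ₗ X₂ - X₁ ∘ₗ u)) _ _ fun Y => ?_
  exact mulTerm_map F G (shear u) (shear_tri X₁ Y X₂ u) W

theorem stable_of_tri {X₁ : Module.End k V} {Y : V' →ₗ[k] V} {X₂ : Module.End k V'}
    {W : Submodule k (V × V')} (h : ∀ v ∈ W, tri X₁ Y X₂ v ∈ W) :
    (∀ v ∈ W.comap (LinearMap.inl k V V'), X₁ v ∈ W.comap (LinearMap.inl k V V')) ∧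
      ∀ v ∈ W.map (LinearMap.snd k V V'), X₂ v ∈ W.map (LinearMap.snd k V V') := by
  constructor
  · intro v hv
    have := h _ hv
    simpa using this
  · rintro _ ⟨w, hw, rfl⟩
    exact ⟨_, h w hw, rfl⟩

/-- The number of `W` of the form `(1 + u)(A × B)`, weighted. -/
theorem card_mul_sum_of_type (F G : ClassFun k) (X₁ : Module.End k V) (X₂ : Module.End k V')
    (A : Submodule k V) (B : Submodule k V') :
    (Nat.card (homFilt A B) : ℂ) * ∑ W : Submodule k (V × V'),
        (if W.comap (LinearMap.inl k V V') = A ∧ W.map (LinearMap.snd k V V') = B then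
          ∑ Y : V' →ₗ[k] V, mulTerm F G (tri X₁ Y X₂) W else 0) =
      Nat.card (V' →ₗ[k] V) * ∑ Y : V' →ₗ[k] V, mulTerm F G (tri X₁ Y X₂) (A.prod B) := by
  have h1 : (Nat.card (V' →ₗ[k] V) : ℂ) * ∑ Y, mulTerm F G (tri X₁ Y X₂) (A.prod B) =
      ∑ u : V' →ₗ[k] V, ∑ Y : V' →ₗ[k] V,
        mulTerm F G (tri X₁ Y X₂) ((A.prod B).map (shear u : V × V' →ₗ[k] V × V')) := by
    rw [Finset.sum_congr rfl fun u _ => sum_mulTerm_map_shear F G X₁ X₂ u (A.prod B),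
      Finset.sum_const, nsmul_eq_mul, Finset.card_univ, Nat.card_eq_fintype_card]
  rw [h1, ← Finset.sum_fiberwise (s := Finset.univ)
    (g := fun u : V' →ₗ[k] V => (A.prod B).map (shear u : V × V' →ₗ[k] V × V')), Finset.mul_sum]
  refine Finset.sum_congr rfl fun W _ => ?_
  have h2 : ∑ u ∈ Finset.univ.filter (fun u : V' →ₗ[k] V =>
        (A.prod B).map (shear u : V × V' →ₗ[k] V × V') = W), ∑ Y : V' →ₗ[k] V,
        mulTerm F G (tri X₁ Y X₂) ((A.prod B).map (shear u : V × V' →ₗ[k] V × V')) =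
      (Finset.univ.filter (fun u : V' →ₗ[k] V =>
        (A.prod B).map (shear u : V × V' →ₗ[k] V × V') = W)).card *
          ∑ Y : V' →ₗ[k] V, mulTerm F G (tri X₁ Y X₂) W := by
    rw [← nsmul_eq_mul]
    refine Finset.sum_eq_card_nsmul fun u hu => ?_
    rw [(Finset.mem_filter.1 hu).2]
  rw [h2]
  split_ifs with hW
  · obtain ⟨u₀, hu₀⟩ := exists_eq_map_shear W
    rw [hW.1, hW.2] at hu₀
    congr 1
    norm_cast
    rw [Nat.card_eq_fintype_card, ← Finset.card_univ]
    refine Finset.card_bij' (fun v _ => u₀ + (v : V' →ₗ[k] V))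
      (fun u hu => ⟨u - u₀, map_shear_eq_iff.1 (((Finset.mem_filter.1 hu).2).trans hu₀)⟩)
      ?_ ?_ ?_ ?_
    · intro v _
      refine Finset.mem_filter.2 ⟨Finset.mem_univ _, ?_⟩
      rw [hu₀, map_shear_eq_iff, add_sub_cancel_left]
      exact v.2
    · simp
    · simp
    · simp
  · rw [mul_zero, Finset.filter_eq_empty_iff.2, Finset.card_empty, Nat.cast_zero, zero_mul]
    rintro u - rfl
    exact hW ⟨comap_inl_map_shear u A B, map_snd_map_shear u A B⟩

end

/-! ### Passage to the associated graded and the Mackey formula -/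

section

variable {k : Type u} [Field k]
variable {V V' : Type u} [AddCommGroup V] [Module k V] [Finite V]
  [AddCommGroup V'] [Module k V'] [Finite V']

/-- The maps `B → A` and `V' / B → V / A` induced by a map `V' → V` that maps `B` into `A`. -/
def homGr (A : Submodule k V) (B : Submodule k V') :
    homFilt A B →ₗ[k] (B →ₗ[k] A) × ((V' ⧸ B) →ₗ[k] (V ⧸ A)) where
  toFun Y := (Y.1.restrict Y.2, B.mapQ A Y.1 Y.2)
  map_add' Y Y' := by
    ext <;> rfl
  map_smul' a Y := by
    ext <;> rfl

/-- Add an extension of y₁ to V', with values in A, to a lift of y₂ through a section of V → V / A.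
The second summand vanishes on B and the first vanishes modulo A, so they do not interfere. -/
theorem homGr_surjective (A : Submodule k V) (B : Submodule k V') :
    Function.Surjective (homGr A B) := by
  rintro ⟨y₁, y₂⟩
  obtain ⟨z₁, hz₁⟩ := LinearMap.exists_extend y₁
  obtain ⟨s, hs⟩ := A.mkQ.exists_rightInverse_of_surjective A.range_mkQ
  have h1 : ∀ b : B, z₁ b = y₁ b := fun b => LinearMap.congr_fun hz₁ b
  have h2 : ∀ v, A.mkQ (s v) = v := fun v => LinearMap.congr_fun hs v
  have h3 : ∀ b : B, (A.subtype ∘ₗ z₁ + s ∘ₗ y₂ ∘ₗ B.mkQ) b = y₁ b := by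
    intro b
    simp [h1, (Submodule.Quotient.mk_eq_zero B).2 b.2]
  refine ⟨⟨A.subtype ∘ₗ z₁ + s ∘ₗ y₂ ∘ₗ B.mkQ, fun b hb => ?_⟩, ?_⟩
  · rw [h3 ⟨b, hb⟩]
    exact (y₁ _).2
  · refine Prod.ext ?_ ?_
    · ext b
      exact h3 b
    · refine LinearMap.ext fun v => ?_
      obtain ⟨v, rfl⟩ := Submodule.Quotient.mk_surjective _ v
      change A.mkQ ((A.subtype ∘ₗ z₁ + s ∘ₗ y₂ ∘ₗ B.mkQ) v) = y₂ (B.mkQ v)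
      have : A.mkQ (A.subtype (z₁ v)) = 0 := (Submodule.Quotient.mk_eq_zero A).2 (z₁ v).2
      simp only [LinearMap.add_apply, LinearMap.comp_apply, map_add, h2, this, zero_add]

theorem mulTerm_tri_prod (F G : ClassFun k) {X₁ : Module.End k V} {X₂ : Module.End k V'}
    (A : Stab X₁) (B : Stab X₂) (Y : homFilt A.1 B.1) :
    mulTerm F G (tri X₁ Y.1 X₂) (A.1.prod B.1) =
      F.1 (of (tri (restr X₁ A) (homGr A.1 B.1 Y).1 (restr X₂ B))) *
      G.1 (of (tri (quot X₁ A) (homGr A.1 B.1 Y).2 (quot X₂ B))) := by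
  have hst : ∀ v ∈ A.1.prod B.1, tri X₁ Y.1 X₂ v ∈ A.1.prod B.1 := fun v hv =>
    ⟨A.1.add_mem (A.2 _ hv.1) (Y.2 _ hv.2), B.2 _ hv.2⟩
  unfold mulTerm
  rw [dif_pos hst]
  congr 1
  · refine val_congr F (conj_restr _ _ (A.1.subtype.prodMap B.1.subtype) ?_ ?_ fun v => rfl)
    · exact A.1.subtype_injective.prodMap B.1.subtype_injective
    · rw [LinearMap.range_prodMap, Submodule.range_subtype, Submodule.range_subtype]
  · refine val_congr G (conj_quot _ _ (A.1.mkQ.prodMap B.1.mkQ) ?_ ?_ fun v => rfl)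
    · exact A.1.mkQ_surjective.prodMap B.1.mkQ_surjective
    · rw [LinearMap.ker_prodMap, Submodule.ker_mkQ, Submodule.ker_mkQ]

/-- For Y preserving the filtrations, the summand depends only on the two graded pieces of Y. These
are equidistributed because `homGr` is surjective, so the average splits into the product of two
averages. -/
theorem sum_mulTerm_tri_prod (F G : ClassFun k) {X₁ : Module.End k V} {X₂ : Module.End k V'}
    (A : Stab X₁) (B : Stab X₂) :
    ∑ Y : V' →ₗ[k] V, mulTerm F G (tri X₁ Y X₂) (A.1.prod B.1) =
      Nat.card (homFilt A.1 B.1) * ((res (restr X₁ A) F).1 (of (restr X₂ B)) *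
        (res (quot X₁ A) G).1 (of (quot X₂ B))) := by
  -- A × B is stable only if Y maps B into A; the other Y contribute zero.
  have h1 : ∑ Y : V' →ₗ[k] V, mulTerm F G (tri X₁ Y X₂) (A.1.prod B.1) =
      ∑ Y : homFilt A.1 B.1, mulTerm F G (tri X₁ Y.1 X₂) (A.1.prod B.1) := by
    rw [← sum_dite_eq_sum (Equiv.refl (homFilt A.1 B.1))]
    refine Finset.sum_congr rfl fun Y _ => ?_
    split_ifs with h
    · rfl
    · unfold mulTerm
      rw [dif_neg]
      intro h'
      refine h fun b hb => ?_
      have := (h' (0, b) ⟨A.1.zero_mem, hb⟩).1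
      simpa using this
  rw [h1, Finset.sum_congr rfl fun Y _ => mulTerm_tri_prod F G A B Y]
  have h2 := card_mul_sum_comp (homGr A.1 B.1).toAddMonoidHom (homGr_surjective A.1 B.1)
    fun y => F.1 (of (tri (restr X₁ A) y.1 (restr X₂ B))) *
      G.1 (of (tri (quot X₁ A) y.2 (quot X₂ B)))
  have h3 : (Nat.card (B.1 →ₗ[k] A.1) : ℂ) ≠ 0 := Nat.cast_ne_zero.2 Nat.card_pos.ne'
  have h4 : (Nat.card ((V' ⧸ B.1) →ₗ[k] (V ⧸ A.1)) : ℂ) ≠ 0 :=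
    Nat.cast_ne_zero.2 Nat.card_pos.ne'
  rw [Nat.card_prod, Nat.cast_mul, Fintype.sum_prod_type, ← Fintype.sum_mul_sum
    (fun y => F.1 (of (tri (restr X₁ A) y (restr X₂ B))))
    (fun y => G.1 (of (tri (quot X₁ A) y (quot X₂ B))))] at h2
  rw [res_apply, res_apply]
  refine mul_left_cancel₀ (mul_ne_zero h3 h4) (h2.trans ?_)
  field_simp

/-- The Mackey formula. The subspaces W of V × V' are grouped by their intersection A with V and
their image B in V'. -/
theorem res_mul_apply (F G : ClassFun k) (X₁ : Module.End k V) (X₂ : Module.End k V') :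
    (res X₁ (mul F G)).1 (of X₂) =
      ∑ A : Stab X₁, (mul (res (restr X₁ A) F) (res (quot X₁ A) G)).1 (of X₂) := by
  simp only [res_apply, mul_apply_eq_sum_mulTerm]
  rw [Finset.sum_comm]
  -- Each W has exactly one type (A, B), and it contributes only when A and B are stable under the
  -- diagonal blocks.
  have h0 : ∀ W : Submodule k (V × V'), ∑ Y, mulTerm F G (tri X₁ Y X₂) W =
      ∑ A : Stab X₁, ∑ B : Stab X₂,
        if W.comap (LinearMap.inl k V V') = A.1 ∧ W.map (LinearMap.snd k V V') = B.1 then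
          ∑ Y : V' →ₗ[k] V, mulTerm F G (tri X₁ Y X₂) W else 0 := by
    intro W
    by_cases hW : (∀ v ∈ W.comap (LinearMap.inl k V V'), X₁ v ∈ W.comap (LinearMap.inl k V V')) ∧
      ∀ v ∈ W.map (LinearMap.snd k V V'), X₂ v ∈ W.map (LinearMap.snd k V V')
    · symm
      rw [Finset.sum_eq_single (⟨_, hW.1⟩ : Stab X₁), Finset.sum_eq_single (⟨_, hW.2⟩ : Stab X₂)]
      · rw [if_pos ⟨rfl, rfl⟩]
      · rintro B - hB
        rw [if_neg]
        rintro ⟨-, h⟩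
        exact hB (Stab.ext h.symm)
      · simp
      · rintro A - hA
        refine Finset.sum_eq_zero fun B _ => if_neg ?_
        rintro ⟨h, -⟩
        exact hA (Stab.ext h.symm)
      · simp
    · have : ∑ Y, mulTerm F G (tri X₁ Y X₂) W = 0 := by
        refine Finset.sum_eq_zero fun Y _ => ?_
        unfold mulTerm
        exact dif_neg fun h => hW (stable_of_tri h)
      simp only [this, ite_self, Finset.sum_const_zero]
  rw [Finset.sum_congr rfl fun W _ => h0 W, Finset.sum_comm, Finset.mul_sum]
  refine Finset.sum_congr rfl fun A _ => ?_
  rw [Finset.sum_comm, ← mul_apply_eq_sum_mulTerm, mul_apply, Finset.mul_sum]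
  refine Finset.sum_congr rfl fun B _ => ?_
  -- There are |Hom(V', V)| / |homFilt A B| subspaces of this type, each contributing |homFilt A B|
  -- times the product of the averages. Dividing by |Hom(V', V)| leaves coefficient one.
  have h1 := card_mul_sum_of_type F G X₁ X₂ A.1 B.1
  have h3 : (Nat.card (V' →ₗ[k] V) : ℂ) ≠ 0 := Nat.cast_ne_zero.2 Nat.card_pos.ne'
  have h4 : (Nat.card (homFilt A.1 B.1) : ℂ) ≠ 0 := Nat.cast_ne_zero.2 Nat.card_pos.ne'
  rw [sum_mulTerm_tri_prod] at h1
  rw [inv_mul_eq_iff_eq_mul₀ h3]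
  refine mul_left_cancel₀ h4 (h1.trans ?_)
  ring

theorem res_mul (F G : ClassFun k) (X₁ : Module.End k V) :
    res X₁ (mul F G) = ∑ A : Stab X₁, mul (res (restr X₁ A) F) (res (quot X₁ A) G) := by
  apply ClassFun.ext
  intro V' _ _ _ X₂
  rw [res_mul_apply, AddSubmonoidClass.coe_finsetSum, Finset.sum_apply]

/-! ### Primitive class functions -/

/-- A class function is primitive if it vanishes at the zero space and its restrictions to pairs
of nonzero spaces vanish. -/
structure IsPrimitive (p : ClassFun k) : Prop where
  zero : ∀ (V : Type u) [AddCommGroup V] [Module k V] [Finite V] (X : Module.End k V),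
    Subsingleton V → p.1 (of X) = 0
  res : ∀ (V V' : Type u) [AddCommGroup V] [Module k V] [Finite V]
    [AddCommGroup V'] [Module k V'] [Finite V'] (X : Module.End k V) (X' : Module.End k V'),
    Nontrivial V → Nontrivial V' → (res X p).1 (of X') = 0

theorem IsPrimitive.res_eq {p : ClassFun k} (hp : IsPrimitive p) [Nontrivial V]
    (X : Module.End k V) : GlDuality.res X p = p.1 (of X) • one k := by
  apply ClassFun.ext
  intro V' _ _ _ X'
  rw [Submodule.coe_smul, Pi.smul_apply, one_apply, smul_eq_mul]
  split_ifs with h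
  · rw [res_apply_of_subsingleton, mul_one]
  · rw [mul_zero]
    exact hp.res V V' X X' ‹_› (not_subsingleton_iff_nontrivial.1 h)

/-- In the Mackey formula the factor coming from p is p itself when A is everything, and otherwise
the scalar p(V / A) times the unit. As p vanishes at the zero space, the scalar terms may be summed
over all A. -/
theorem res_mul_primitive (F : ClassFun k) {p : ClassFun k} (hp : IsPrimitive p)
    (X : Module.End k V) :
    res X (mul F p) = mul (res X F) p +
      ∑ A : Stab X, p.1 (of (quot X A)) • res (restr X A) F := by
  have h : ∀ A : Stab X, mul (res (restr X A) F) (res (quot X A) p) =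
      (if A = ⊤ then mul (res X F) p else 0) + p.1 (of (quot X A)) • res (restr X A) F := by
    intro A
    split_ifs with hA
    · subst hA
      have : Subsingleton (V ⧸ (⊤ : Stab X).1) := Submodule.Quotient.subsingleton_iff.2 rfl
      rw [res_of_subsingleton (quot X ⊤), hp.zero _ _ this, zero_smul, add_zero,
        res_congr (conj_restr_top X)]
    · have : Nontrivial (V ⧸ A.1) := Submodule.Quotient.nontrivial_iff.2 fun h => hA (Stab.ext h)
      rw [hp.res_eq, mul_smul', mul_one', zero_add]
  rw [res_mul, Finset.sum_congr rfl fun A _ => h A, Finset.sum_add_distrib,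
    Finset.sum_ite_eq' Finset.univ ⊤, if_pos (Finset.mem_univ _)]

/-- The right-hand side is symmetric in p and q, so commutators of primitive functions have
vanishing restriction to pairs of nonzero spaces. -/
theorem res_mul_primitive_apply {p q : ClassFun k} (hp : IsPrimitive p) (hq : IsPrimitive q)
    [Nontrivial V] [Nontrivial V'] (X : Module.End k V) (X' : Module.End k V') :
    (res X (mul p q)).1 (of X') = p.1 (of X) * q.1 (of X') + q.1 (of X) * p.1 (of X') := by
  rw [res_mul_primitive p hq, hp.res_eq, smul_mul', one_mul', Submodule.coe_add, Pi.add_apply,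
    Submodule.coe_smul, Pi.smul_apply, smul_eq_mul]
  congr 1
  rw [AddSubmonoidClass.coe_finsetSum, Finset.sum_apply, Finset.sum_eq_single ⊥]
  · have : Subsingleton (⊥ : Stab X).1 := by rw [Stab.coe_bot]; infer_instance
    rw [res_of_subsingleton, Submodule.coe_smul, Pi.smul_apply, smul_eq_mul,
      val_congr q (conj_quot_bot X)]
  · intro A _ hA
    have : Nontrivial A.1 := Submodule.nontrivial_iff_ne_bot.2 fun h => hA (Stab.ext h)
    rw [Submodule.coe_smul, Pi.smul_apply, hp.res _ _ _ _ ‹_› ‹_›, smul_zero]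
  · simp

end

/-! ### Alternating sums over compositions -/

/-- The block lists of the compositions of `n`. -/
def compBlocks (n : ℕ) : Finset (List ℕ) :=
  (Finset.univ : Finset (Composition n)).image Composition.blocks

theorem mem_compBlocks {n : ℕ} {l : List ℕ} :
    l ∈ compBlocks n ↔ (∀ i ∈ l, 0 < i) ∧ l.sum = n := by
  rw [compBlocks, Finset.mem_image]
  constructor
  · rintro ⟨c, -, rfl⟩
    exact ⟨fun i hi => c.blocks_pos hi, c.blocks_sum⟩
  · rintro ⟨h1, h2⟩
    exact ⟨⟨l, fun hi => h1 _ hi, h2⟩, Finset.mem_univ _, rfl⟩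

theorem sum_compBlocks {n : ℕ} (g : List ℕ → ℂ) :
    ∑ l ∈ compBlocks n, g l = ∑ c : Composition n, g c.blocks :=
  Finset.sum_image fun _ _ _ _ h => Composition.ext h

theorem compBlocks_zero : compBlocks 0 = {[]} := by
  ext l
  rw [mem_compBlocks, Finset.mem_singleton]
  constructor
  · rintro ⟨h1, h2⟩
    rw [List.sum_eq_zero_iff] at h2
    refine List.eq_nil_iff_forall_not_mem.2 fun i hi => ?_
    exact (h1 i hi).ne' (h2 i hi)
  · rintro rfl
    simp

/-- A composition of a positive integer is its first block m followed by a composition of n - m;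
this is what makes the alternating sum recursive. -/
theorem sum_compBlocks_of_pos {n : ℕ} (hn : 0 < n) (g : List ℕ → ℂ) :
    ∑ l ∈ compBlocks n, g l = ∑ m ∈ Finset.Icc 1 n, ∑ l ∈ compBlocks (n - m), g (m :: l) := by
  rw [Finset.sum_sigma']
  symm
  refine Finset.sum_bij (fun (x : Σ _ : ℕ, List ℕ) _ => x.1 :: x.2) ?_ ?_ ?_ fun _ _ => rfl
  · rintro ⟨m, l⟩ h
    simp only [Finset.mem_sigma, Finset.mem_Icc, mem_compBlocks] at h
    refine mem_compBlocks.2 ⟨?_, ?_⟩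
    · simp only [List.mem_cons, forall_eq_or_imp]
      exact ⟨h.1.1, h.2.1⟩
    · rw [List.sum_cons, h.2.2]
      exact Nat.add_sub_cancel' h.1.2
  · rintro ⟨m, l⟩ _ ⟨m', l'⟩ _ h
    simp only [List.cons.injEq] at h
    rw [h.1, h.2]
  · intro l hl
    rw [mem_compBlocks] at hl
    cases l with
    | nil => simp at hl; omega
    | cons m l =>
      simp only [List.mem_cons, forall_eq_or_imp, List.sum_cons] at hl
      refine ⟨⟨m, l⟩, ?_, rfl⟩
      have hle : m ≤ n := by omega
      have hs : l.sum = n - m := by omega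
      simp only [Finset.mem_sigma, Finset.mem_Icc, mem_compBlocks]
      exact ⟨⟨hl.1.1, hle⟩, hl.1.2, hs⟩

section

variable {k : Type u} [Field k]
variable {V V' : Type u} [AddCommGroup V] [Module k V] [Finite V]
  [AddCommGroup V'] [Module k V'] [Finite V']

/-- The operator sending `F` to the sum over the stable subspaces `W` of dimension `m` of
`T (res (X | W) F) (X | V / W)`. -/
def stepOp (m : ℕ) (T : ClassFun k →ₗ[ℂ] ClassFun k) : ClassFun k →ₗ[ℂ] ClassFun k where
  toFun F := ⟨fun M => letI := M.grp; letI := M.mod; haveI := M.fin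
    ∑ W : Stab M.endo, if Module.finrank k W.1 = m then
      (T (res (restr M.endo W) F)).1 (of (quot M.endo W)) else 0, by
    rintro V V' _ _ _ _ _ _ X X' ⟨e, he⟩
    refine Fintype.sum_equiv (stabEquiv e he) _ _ fun W => ?_
    have h1 : Module.finrank k (stabEquiv e he W).1 = Module.finrank k W.1 :=
      (LinearEquiv.finrank_eq (e.submoduleMap W.1)).symm
    change (if _ then (T (res (restr X W) F)).1 (of (quot X W)) else 0) =
      if Module.finrank k (stabEquiv e he W).1 = m then
        (T (res (restr X' (stabEquiv e he W)) F)).1 (of (quot X' (stabEquiv e he W))) else 0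
    rw [h1, ← res_congr (conj_restr_stabEquiv e he W),
      val_congr _ (conj_quot_stabEquiv e he W)]⟩
  map_add' F G := by
    apply ClassFun.ext
    intro V _ _ _ X
    simp only [map_add, Submodule.coe_add, Pi.add_apply, ← Finset.sum_add_distrib]
    refine Finset.sum_congr rfl fun W _ => ?_
    split_ifs <;> simp
  map_smul' a F := by
    apply ClassFun.ext
    intro V _ _ _ X
    simp only [map_smul, Submodule.coe_smul, Pi.smul_apply, smul_eq_mul, Finset.mul_sum,
      RingHom.id_apply]
    refine Finset.sum_congr rfl fun W _ => ?_
    split_ifs <;> simp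

theorem stepOp_apply (m : ℕ) (T : ClassFun k →ₗ[ℂ] ClassFun k) (F : ClassFun k)
    (X : Module.End k V) : (stepOp m T F).1 (of X) =
      ∑ W : Stab X, if Module.finrank k W.1 = m then
        (T (res (restr X W) F)).1 (of (quot X W)) else 0 := rfl

variable (k) in
/-- The operator `R ∘ *R` for the parabolic subgroup with block sizes `l`, summed over flags. -/
def flagOp : List ℕ → ClassFun k →ₗ[ℂ] ClassFun k
  | [] =>
    { toFun := fun F => ⟨fun M => (one k).1 M * F.1 M, by
        intro V V' _ _ _ _ _ _ X X' h
        exact congrArg₂ (· * ·) (val_congr (one k) h) (val_congr F h)⟩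
      map_add' := fun F G => by
        ext M
        simp [mul_add]
      map_smul' := fun a F => by
        ext M
        simp [mul_left_comm] }
  | m :: l => stepOp m (flagOp l)

theorem flagOp_nil_apply (F : ClassFun k) (X : Module.End k V) :
    (flagOp k [] F).1 (of X) = if Subsingleton V then F.1 (of X) else 0 := by
  change (one k).1 (of X) * F.1 (of X) = _
  rw [one_apply, ite_mul, one_mul, zero_mul]

theorem flagOp_cons (m : ℕ) (l : List ℕ) : flagOp k (m :: l) = stepOp m (flagOp k l) := rfl

variable (k) in
/-- The alternating sum of the operators `flagOp` over all compositions. -/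
def altSum : ClassFun k →ₗ[ℂ] ClassFun k where
  toFun F := ⟨fun M => letI := M.grp; letI := M.mod
    ∑ l ∈ compBlocks (Module.finrank k M.carrier), (-1) ^ l.length * (flagOp k l F).1 M, by
    intro V V' _ _ _ _ _ _ X X' h
    have h1 : Module.finrank k V = Module.finrank k V' := LinearEquiv.finrank_eq h.choose
    change ∑ l ∈ compBlocks (Module.finrank k V), _ = ∑ l ∈ compBlocks (Module.finrank k V'), _
    rw [h1]
    exact Finset.sum_congr rfl fun l _ => by rw [val_congr _ h]⟩
  map_add' F G := by
    apply ClassFun.ext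
    intro V _ _ _ X
    simp [mul_add, Finset.sum_add_distrib]
  map_smul' a F := by
    apply ClassFun.ext
    intro V _ _ _ X
    simp [Finset.mul_sum, mul_left_comm]

theorem altSum_apply (F : ClassFun k) (X : Module.End k V) :
    (altSum k F).1 (of X) = ∑ l ∈ compBlocks (Module.finrank k V),
      (-1) ^ l.length * (flagOp k l F).1 (of X) := rfl

theorem altSum_of_subsingleton [Subsingleton V] (F : ClassFun k) (X : Module.End k V) :
    (altSum k F).1 (of X) = F.1 (of X) := by
  rw [altSum_apply, Module.finrank_zero_of_subsingleton, compBlocks_zero, Finset.sum_singleton,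
    flagOp_nil_apply, if_pos ‹_›]
  simp

/-- The antipode recursion. The first block of the composition is the dimension of the first nonzero
step W of the flag, so summing over all compositions lets W be any nonzero stable subspace. The sign
is the one block removed. -/
theorem altSum_of_nontrivial [Nontrivial V] (F : ClassFun k) (X : Module.End k V) :
    (altSum k F).1 (of X) = -∑ W : Stab X, if W = ⊥ then 0 else
      (altSum k (res (restr X W) F)).1 (of (quot X W)) := by
  rw [altSum_apply, sum_compBlocks_of_pos Module.finrank_pos, ← Finset.sum_neg_distrib]
  simp only [flagOp_cons, stepOp_apply, Finset.mul_sum]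
  rw [Finset.sum_congr rfl fun m _ => Finset.sum_comm, Finset.sum_comm]
  refine Finset.sum_congr rfl fun W _ => ?_
  have hq : Module.finrank k (V ⧸ W.1) = Module.finrank k V - Module.finrank k W.1 := by
    have := W.1.finrank_quotient_add_finrank
    omega
  have hle : Module.finrank k W.1 ≤ Module.finrank k V := W.1.finrank_le
  split_ifs with hW
  · subst hW
    rw [neg_zero]
    refine Finset.sum_eq_zero fun m hm => Finset.sum_eq_zero fun l _ => ?_
    rw [if_neg, mul_zero]
    rw [Stab.coe_bot, finrank_bot]
    rw [Finset.mem_Icc] at hm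
    omega
  · have hpos : 0 < Module.finrank k W.1 := by
      rw [Nat.pos_iff_ne_zero]
      exact fun h => hW (Stab.ext (Submodule.finrank_eq_zero.1 h))
    rw [Finset.sum_eq_single (Module.finrank k W.1)]
    · rw [altSum_apply, hq, ← Finset.sum_neg_distrib]
      refine Finset.sum_congr rfl fun l _ => ?_
      rw [if_pos rfl, List.length_cons, pow_succ]
      ring
    · intro m _ hm
      refine Finset.sum_eq_zero fun l _ => ?_
      rw [if_neg hm.symm, mul_zero]
    · intro h
      exact absurd (Finset.mem_Icc.2 ⟨hpos, hle⟩) h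

theorem val_add (F G : ClassFun k) (M : EndoSpace k) : (F + G).1 M = F.1 M + G.1 M := rfl

theorem val_smul (a : ℂ) (F : ClassFun k) (M : EndoSpace k) : (a • F).1 M = a * F.1 M := rfl

theorem sum_apply {ι : Type*} (s : Finset ι) (F : ι → ClassFun k) (M : EndoSpace k) :
    (∑ i ∈ s, F i).1 M = ∑ i ∈ s, (F i).1 M := by
  rw [AddSubmonoidClass.coe_finsetSum, Finset.sum_apply]

theorem altSum_one : altSum k (one k) = one k := by
  apply ClassFun.ext
  intro V _ _ _ X
  cases subsingleton_or_nontrivial V with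
  | inl h => exact altSum_of_subsingleton _ _
  | inr h =>
    rw [altSum_of_nontrivial, one_apply, if_neg (not_subsingleton V), neg_eq_zero]
    refine Finset.sum_eq_zero fun W _ => ?_
    split_ifs with hW
    · rfl
    · have : Nontrivial W.1 := Submodule.nontrivial_iff_ne_bot.2 fun h => hW (Stab.ext h)
      have h0 : res (restr X W) (one k) = 0 := by
        apply ClassFun.ext
        intro V' _ _ _ X'
        rw [res_apply, Finset.sum_eq_zero, mul_zero]
        · rfl
        · intro Y _
          rw [one_apply, if_neg]
          exact not_subsingleton _
      rw [h0, map_zero]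
      rfl

/-- An antipode reverses products, and here the right factor is primitive. The proof is by induction
on dim V through the antipode recursion, where `res_mul_primitive` produces two double sums over
flags that cancel except at the zero subspace. -/
theorem altSum_mul_primitive_apply {p : ClassFun k} (hp : IsPrimitive p) (n : ℕ) :
    ∀ (V : Type u) [AddCommGroup V] [Module k V] [Finite V] (X : Module.End k V) (F : ClassFun k),
      Module.finrank k V = n →
        (altSum k (mul F p)).1 (of X) = -(mul p (altSum k F)).1 (of X) := by
  induction n using Nat.strong_induction_on with
  | _ n ih =>
  intro V _ _ _ X F hn
  cases subsingleton_or_nontrivial V with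
  | inl h =>
    rw [altSum_of_subsingleton, mul_apply, mul_apply, Finset.sum_eq_zero, Finset.sum_eq_zero,
      neg_zero]
    · intro W _
      rw [hp.zero _ _ inferInstance, zero_mul]
    · intro W _
      rw [hp.zero _ (quot X W) (Submodule.mkQ_surjective W.1).subsingleton, mul_zero]
  | inr h =>
    -- The weight of a flag A ≤ B: p sees B / A and the alternating sum sees V / B. For W nonzero,
    -- the induction hypothesis gives minus the row of W and the scalar terms give the column of W.
    let t : Stab X → Stab X → ℂ := fun A B => if A.1 ≤ B.1 then
      p.1 (of (restr (quot X A) (A.quo B))) *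
        (altSum k (res (restr X A) F)).1 (of (quot X B)) else 0
    have h1 : ∀ W : Stab X, W ≠ ⊥ →
        (altSum k (res (restr X W) (mul F p))).1 (of (quot X W)) =
          -∑ B, t W B + ∑ A, t A W := by
      intro W hW
      have hlt : Module.finrank k (V ⧸ W.1) < n := by
        have := W.1.finrank_quotient_add_finrank
        have : Module.finrank k W.1 ≠ 0 :=
          fun h => hW (Stab.ext (Submodule.finrank_eq_zero.1 h))
        omega
      have hih := ih _ hlt (V ⧸ W.1) (quot X W) (res (restr X W) F) rfl
      rw [res_mul_primitive F hp, map_add, map_sum, val_add, hih]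
      rw [sum_apply, mul_apply, sum_stab_quot, sum_stab_restr]
      refine congrArg₂ (· + ·) (congrArg Neg.neg ?_) ?_
      · refine Finset.sum_congr rfl fun B _ => ?_
        simp only [t]
        split_ifs with hB
        · rw [val_congr _ (conj_quot_quo hB)]
        · rfl
      · refine Finset.sum_congr rfl fun A _ => ?_
        simp only [t]
        split_ifs with hA
        · rw [map_smul, Submodule.coe_smul, Pi.smul_apply, smul_eq_mul,
            res_congr (conj_restr_sub hA), val_congr p (conj_quot_sub A W)]
        · rfl
    have h2 : ∑ A, t A ⊥ = 0 := by
      refine Finset.sum_eq_zero fun A _ => ?_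
      simp only [t]
      split_ifs with hA
      · rw [hp.zero, zero_mul]
        obtain rfl : A = ⊥ := Stab.ext (le_bot_iff.1 hA)
        change Subsingleton (Submodule.map _ ⊥ : Submodule k (V ⧸ _))
        rw [Submodule.map_bot]
        infer_instance
      · rfl
    have h3 : ∑ B, t ⊥ B = (mul p (altSum k F)).1 (of X) := by
      rw [mul_apply]
      refine Finset.sum_congr rfl fun B _ => ?_
      have hsub : Subsingleton (⊥ : Stab X).1 := by rw [Stab.coe_bot]; infer_instance
      have hle : (⊥ : Stab X).1 ≤ B.1 := bot_le
      simp only [t]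
      rw [if_pos hle, res_of_subsingleton,
        ← val_congr p (conj_quot_sub (⊥ : Stab X) B)]
      congr 1
      refine val_congr p ?_
      refine conj_quot _ _ LinearMap.id (fun v => ⟨v, rfl⟩) ?_ fun v => rfl
      rw [LinearMap.ker_id]
      symm
      exact Submodule.ker_subtype B.1
    -- Column minus row sums to zero over all W, so the sum over nonzero W is minus the term at
    -- zero. There the column vanishes (`h2`) and the row is the product sought (`h3`).
    have h4 : ∀ W : Stab X, (if W = ⊥ then 0 else
        (altSum k (res (restr X W) (mul F p))).1 (of (quot X W))) =
        (∑ A, t A W - ∑ B, t W B) - if W = ⊥ then ∑ A, t A ⊥ - ∑ B, t ⊥ B else 0 := by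
      intro W
      split_ifs with hW
      · rw [hW, sub_self]
      · rw [h1 W hW]
        ring
    rw [altSum_of_nontrivial, Finset.sum_congr rfl fun W _ => h4 W, Finset.sum_sub_distrib,
      Finset.sum_sub_distrib, Finset.sum_ite_eq' Finset.univ ⊥, if_pos (Finset.mem_univ _), h2, h3,
      Finset.sum_comm]
    ring

theorem altSum_mul_primitive (F : ClassFun k) {p : ClassFun k} (hp : IsPrimitive p) :
    altSum k (mul F p) = -mul p (altSum k F) := by
  apply ClassFun.ext
  intro V _ _ _ X
  exact altSum_mul_primitive_apply hp _ V X F rfl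

theorem altSum_primitive {p : ClassFun k} (hp : IsPrimitive p) : altSum k p = -p := by
  have := altSum_mul_primitive (one k) hp
  rwa [one_mul', altSum_one, mul_one'] at this

end

/-! ### Sums over frames -/

section

variable {k : Type u} [Field k]
variable {V V₀ V₀' V₁ V₂ : Type u} [AddCommGroup V] [Module k V] [Finite V]
  [AddCommGroup V₀] [Module k V₀] [Finite V₀] [AddCommGroup V₀'] [Module k V₀'] [Finite V₀']
  [AddCommGroup V₁] [Module k V₁] [Finite V₁] [AddCommGroup V₂] [Module k V₂] [Finite V₂]

instance : Finite (V₁ ≃ₗ[k] V₂) :=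
  Finite.of_injective (fun f => (f : V₁ → V₂)) DFunLike.coe_injective

instance : Fintype (V₁ ≃ₗ[k] V₂) := Fintype.ofFinite _

/-- The automorphisms of `V₁ × V₂` that induce the identity on the quotient `V₂`. -/
def unipEquiv : {z : (V₁ × V₂) ≃ₗ[k] (V₁ × V₂) // ∀ v, (z v).2 = v.2} ≃
    (V₁ ≃ₗ[k] V₁) × (V₂ →ₗ[k] V₁) where
  toFun z :=
    have h : ∀ v, (z.1.symm v).2 = v.2 := fun v => by
      rw [← z.2, LinearEquiv.apply_symm_apply]
    (LinearEquiv.ofLinearMap (LinearMap.fst k V₁ V₂ ∘ₗ z.1.toLinearMap ∘ₗ LinearMap.inl k V₁ V₂)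
      (LinearMap.fst k V₁ V₂ ∘ₗ z.1.symm.toLinearMap ∘ₗ LinearMap.inl k V₁ V₂)
      (by
        ext v
        have h' : ((z.1.symm (v, 0)).1, (0 : V₂)) = z.1.symm (v, 0) :=
          Prod.ext rfl (h (v, 0)).symm
        change (z.1 ((z.1.symm (v, 0)).1, 0)).1 = v
        rw [h', LinearEquiv.apply_symm_apply])
      (by
        ext v
        have h' : ((z.1 (v, 0)).1, (0 : V₂)) = z.1 (v, 0) := Prod.ext rfl (z.2 (v, 0)).symm
        change (z.1.symm ((z.1 (v, 0)).1, 0)).1 = v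
        rw [h', LinearEquiv.symm_apply_apply]),
    LinearMap.fst k V₁ V₂ ∘ₗ z.1.toLinearMap ∘ₗ LinearMap.inr k V₁ V₂)
  invFun y := ⟨(y.1.prodCongr (LinearEquiv.refl k V₂)).trans (shear y.2), fun v => rfl⟩
  left_inv z := by
    apply Subtype.ext
    refine LinearEquiv.ext fun v => Prod.ext ?_ (z.2 v).symm
    have : z.1 v = z.1 (v.1, 0) + z.1 (0, v.2) := by rw [← map_add]; simp
    rw [this]
    rfl
  right_inv y := by
    refine Prod.ext ?_ ?_
    · ext v
      simp [shear]
    · ext v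
      simp [shear]

/-- These frames form a torsor under the automorphisms of V₁ × V₂ that are trivial on the quotient
V₂, and `unipEquiv` counts those. -/
theorem card_frames_over (π : V →ₗ[k] V₂) (x₀ : (V₁ × V₂) ≃ₗ[k] V) (h₀ : ∀ v, π (x₀ v) = v.2) :
    Nat.card {x : (V₁ × V₂) ≃ₗ[k] V // ∀ v, π (x v) = v.2} =
      Nat.card (V₁ ≃ₗ[k] V₁) * Nat.card (V₂ →ₗ[k] V₁) := by
  rw [← Nat.card_prod, ← Nat.card_congr unipEquiv]
  refine Nat.card_congr ⟨fun x => ⟨x.1.trans x₀.symm, fun v => ?_⟩,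
    fun z => ⟨z.1.trans x₀, fun v => ?_⟩, fun x => ?_, fun z => ?_⟩
  · rw [← h₀, LinearEquiv.trans_apply, LinearEquiv.apply_symm_apply, x.2]
  · rw [LinearEquiv.trans_apply, h₀, z.2]
  · ext; simp
  · apply Subtype.ext; ext <;> simp

/-- The subspace and the isomorphism determined by a frame are unique. -/
theorem frame_eq {x : (V₁ × V₂) ≃ₗ[k] V} {W : Submodule k V} {y : V₂ ≃ₗ[k] V ⧸ W}
    (h : ∀ v, W.mkQ (x v) = y v.2) :
    W = LinearMap.range (x.toLinearMap ∘ₗ LinearMap.inl k V₁ V₂) := by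
  ext v
  obtain ⟨w, rfl⟩ := x.surjective v
  rw [← Submodule.Quotient.mk_eq_zero, ← Submodule.mkQ_apply, h, LinearEquiv.map_eq_zero_iff]
  constructor
  · intro hw
    exact ⟨w.1, congrArg x (Prod.ext rfl hw.symm)⟩
  · rintro ⟨u, hu⟩
    rw [← x.injective hu]
    rfl

theorem exists_frame_quot (x : (V₁ × V₂) ≃ₗ[k] V) :
    ∃ (W : Submodule k V) (y : V₂ ≃ₗ[k] V ⧸ W), ∀ v, W.mkQ (x v) = y v.2 := by
  let π : V →ₗ[k] V₂ := LinearMap.snd k V₁ V₂ ∘ₗ x.symm.toLinearMap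
  have hπ : Function.Surjective π :=
    (LinearMap.snd_surjective (R := k) (M := V₁) (M₂ := V₂)).comp x.symm.surjective
  refine ⟨LinearMap.ker π, (π.quotKerEquivOfSurjective hπ).symm, fun v => ?_⟩
  rw [LinearEquiv.eq_symm_apply]
  change π (x v) = v.2
  simp [π]

theorem exists_frame_of_finrank_eq (W : Submodule k V) (y : V₂ ≃ₗ[k] V ⧸ W)
    (h : Module.finrank k W = Module.finrank k V₁) :
    ∃ x : (V₁ × V₂) ≃ₗ[k] V, ∀ v, W.mkQ (x v) = y v.2 := by
  obtain ⟨W', hW⟩ := W.exists_isCompl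
  let a : V₁ ≃ₗ[k] W := LinearEquiv.ofFinrankEq _ _ h.symm
  refine ⟨(a.prodCongr (y.trans (W.quotientEquivOfIsCompl W' hW))).trans
    (W.prodEquivOfIsCompl W' hW), fun v => ?_⟩
  rw [LinearEquiv.trans_apply, Submodule.coe_prodEquivOfIsCompl', map_add]
  have h1 : W.mkQ (a v.1 : V) = 0 := (Submodule.Quotient.mk_eq_zero W).2 (a v.1).2
  have h2 := Submodule.mk_quotientEquivOfIsCompl_apply (p := W) (q := W') hW (y v.2)
  exact (congrArg₂ (· + ·) h1 h2).trans (zero_add _)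

/-- A frame determines the image W of V₁ and an isomorphism of V₂ with V / W. When dim W = dim V₁,
every such pair comes from the same number of frames, by `card_frames_over`. -/
theorem sum_frames (G : ((V₁ × V₂) ≃ₗ[k] V) → ℂ)
    (h : ∀ W : Submodule k V, (V₂ ≃ₗ[k] V ⧸ W) → ℂ)
    (hG : ∀ x W y, (∀ v, W.mkQ (x v) = y v.2) → G x = h W y) :
    ∑ x, G x = Nat.card (V₁ ≃ₗ[k] V₁) * Nat.card (V₂ →ₗ[k] V₁) *
      ∑ W : Submodule k V, if Module.finrank k W = Module.finrank k V₁ then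
        ∑ y, h W y else 0 := by
  have h1 : ∀ x, G x = ∑ W : Submodule k V, ∑ y : V₂ ≃ₗ[k] V ⧸ W,
      if ∀ v, W.mkQ (x v) = y v.2 then h W y else 0 := by
    intro x
    obtain ⟨W₀, y₀, h₀⟩ := exists_frame_quot x
    rw [hG x W₀ y₀ h₀, Finset.sum_eq_single W₀, Finset.sum_eq_single y₀, if_pos h₀]
    · intro y _ hy
      rw [if_neg]
      intro hxy
      refine hy (LinearEquiv.ext fun v => ?_)
      exact (hxy (0, v)).symm.trans (h₀ (0, v))
    · simp
    · intro W _ hW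
      refine Finset.sum_eq_zero fun y _ => if_neg fun hxy => hW ?_
      rw [frame_eq hxy, frame_eq h₀]
    · simp
  rw [Finset.sum_congr rfl fun x _ => h1 x, Finset.sum_comm, Finset.mul_sum]
  refine Finset.sum_congr rfl fun W _ => ?_
  rw [Finset.sum_comm]
  split_ifs with hW
  · rw [Finset.mul_sum]
    refine Finset.sum_congr rfl fun y _ => ?_
    obtain ⟨x₀, hx₀⟩ := exists_frame_of_finrank_eq W y hW
    have h2 := card_frames_over (y.symm.toLinearMap ∘ₗ W.mkQ) x₀ fun v => by
      rw [LinearMap.comp_apply, hx₀]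
      simp
    rw [← Finset.sum_filter, Finset.sum_const, nsmul_eq_mul, ← Nat.cast_mul, ← h2,
      Nat.card_eq_fintype_card, Fintype.card_subtype]
    congr! 4 with x
    refine forall_congr' fun v => ?_
    rw [LinearMap.comp_apply, LinearEquiv.coe_coe, LinearEquiv.symm_apply_eq]
  · rw [mul_zero]
    refine Finset.sum_eq_zero fun y _ => Finset.sum_eq_zero fun x _ => if_neg fun hxy => hW ?_
    rw [frame_eq hxy, LinearMap.finrank_range_of_inj]
    exact x.injective.comp LinearMap.inl_injective

/-! ### Averages attached to parabolic data -/

/-- For a set `p` (a parabolic subalgebra) and a set `u` (its nilradical) of endomorphisms of `V₀`: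
the normalised sum over the frames `x : V₀ ≃ V` with `x⁻¹ X x ∈ p` and over `N ∈ u`
of `F (x⁻¹ X x + N)`. -/
def parOp (p u : Set (Module.End k V₀)) (F : ClassFun k) (X : Module.End k V) : ℂ :=
  (Nat.card {x : V₀ ≃ₗ[k] V₀ // x.toLinearMap ∈ p} * Nat.card u : ℂ)⁻¹ *
    ∑ x : V₀ ≃ₗ[k] V, if x.symm.conj X ∈ p then
      ∑ N : Module.End k V₀, if N ∈ u then F.1 (of (x.symm.conj X + N)) else 0 else 0

theorem parOp_congr (e : V₀ ≃ₗ[k] V₀') {p u : Set (Module.End k V₀)}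
    {p' u' : Set (Module.End k V₀')} (hp : ∀ Z, Z ∈ p ↔ e.conj Z ∈ p')
    (hu : ∀ Z, Z ∈ u ↔ e.conj Z ∈ u') (F : ClassFun k) (X : Module.End k V) :
    parOp p u F X = parOp p' u' F X := by
  unfold parOp
  congr 1
  · congr 3
    · refine Nat.card_congr (Equiv.subtypeEquiv ⟨fun x => (e.symm.trans x).trans e,
        fun x => (e.trans x).trans e.symm, fun x => by ext; simp, fun x => by ext; simp⟩ fun x => ?_)
      rw [hp]
      rfl
    · exact Nat.card_congr (Equiv.subtypeEquiv e.conj.toEquiv hu)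
  · refine Fintype.sum_equiv ⟨fun x => e.symm.trans x, fun x => e.trans x,
      fun x => by ext; simp, fun x => by ext; simp⟩ _ _ fun x => ?_
    have h1 : (e.symm.trans x).symm.conj X = e.conj (x.symm.conj X) := rfl
    simp only [Equiv.coe_fn_mk, h1, ← hp]
    split_ifs
    · refine Fintype.sum_equiv e.conj.toEquiv _ _ fun N => ?_
      change _ = if e.conj N ∈ u' then F.1 (of (e.conj (x.symm.conj X) + e.conj N)) else 0
      rw [← hu, ← map_add]
      congr 1
      refine val_congr F ⟨e, fun v => ?_⟩
      simp [LinearEquiv.conj_apply]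
    · rfl

variable (V₁) in
/-- The parabolic subalgebra of `End (V₁ × V₂)` that preserves `V₁` and induces elements of `p`
on `V₂`. -/
def parProd (p : Set (Module.End k V₂)) : Set (Module.End k (V₁ × V₂)) :=
  {Z | ∃ Z₂ ∈ p, ∀ v, (Z v).2 = Z₂ v.2}

variable (V₁) in
/-- The nilradical of `parProd`. -/
def nilProd (u : Set (Module.End k V₂)) : Set (Module.End k (V₁ × V₂)) :=
  {N | (∀ v, N (v, 0) = 0) ∧ ∃ N₂ ∈ u, ∀ v, (N v).2 = N₂ v.2}

theorem eq_tri {Z : Module.End k (V₁ × V₂)} {Z₂ : Module.End k V₂} (h : ∀ v, (Z v).2 = Z₂ v.2) :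
    Z = tri (LinearMap.fst k V₁ V₂ ∘ₗ Z ∘ₗ LinearMap.inl k V₁ V₂)
      (LinearMap.fst k V₁ V₂ ∘ₗ Z ∘ₗ LinearMap.inr k V₁ V₂) Z₂ := by
  refine LinearMap.ext fun v => Prod.ext ?_ (h v)
  have : Z v = Z (v.1, 0) + Z (0, v.2) := by rw [← map_add]; simp
  rw [this]
  rfl

theorem tri_mem_parProd {p : Set (Module.End k V₂)} {X₁ : Module.End k V₁} {Y : V₂ →ₗ[k] V₁}
    {X₂ : Module.End k V₂} : tri X₁ Y X₂ ∈ parProd V₁ p ↔ X₂ ∈ p := by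
  constructor
  · rintro ⟨Z₂, hZ, h⟩
    have : X₂ = Z₂ := LinearMap.ext fun v => h (0, v)
    rwa [this]
  · intro h
    exact ⟨X₂, h, fun v => rfl⟩

theorem tri_add_tri (X₁ X₁' : Module.End k V₁) (Y Y' : V₂ →ₗ[k] V₁) (X₂ X₂' : Module.End k V₂) :
    tri X₁ Y X₂ + tri X₁' Y' X₂' = tri (X₁ + X₁') (Y + Y') (X₂ + X₂') := by
  refine LinearMap.ext fun v => Prod.ext ?_ rfl
  simp only [LinearMap.add_apply, tri_apply, Prod.fst_add]
  abel

theorem tri_zero_mem_nilProd {u : Set (Module.End k V₂)} (Y : V₂ →ₗ[k] V₁)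
    {X₂ : Module.End k V₂} (h : X₂ ∈ u) : tri 0 Y X₂ ∈ nilProd V₁ u :=
  ⟨fun v => by simp, X₂, h, fun v => rfl⟩

/-- The nilradical of `parProd`, parametrised. -/
def nilProdEquiv (u : Set (Module.End k V₂)) : (V₂ →ₗ[k] V₁) × u ≃ nilProd V₁ u where
  toFun y := ⟨tri 0 y.1 y.2.1, tri_zero_mem_nilProd y.1 y.2.2⟩
  invFun N := (LinearMap.fst k V₁ V₂ ∘ₗ N.1 ∘ₗ LinearMap.inr k V₁ V₂,
    ⟨LinearMap.snd k V₁ V₂ ∘ₗ N.1 ∘ₗ LinearMap.inr k V₁ V₂, by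
      obtain ⟨N₂, hN, h⟩ := N.2.2
      convert hN
      ext v
      exact h (0, v)⟩)
  left_inv y := by
    refine Prod.ext ?_ (Subtype.ext ?_)
    · ext v
      simp
    · ext v
      simp
  right_inv N := by
    obtain ⟨h0, N₂, hN, h⟩ := N.2
    apply Subtype.ext
    refine LinearMap.ext fun v => ?_
    have : N.1 v = N.1 (0, v.2) := by
      rw [← zero_add (N.1 (0, v.2)), ← h0 v.1, ← map_add]
      simp
    refine Eq.trans (b := N.1 (0, v.2)) (Prod.ext ?_ rfl) this.symm
    exact zero_add _

theorem sum_nilProd (u : Set (Module.End k V₂)) (F : ClassFun k) (X₁ : Module.End k V₁)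
    (Y : V₂ →ₗ[k] V₁) (X₂ : Module.End k V₂) :
    (∑ N : Module.End k (V₁ × V₂), if N ∈ nilProd V₁ u then F.1 (of (tri X₁ Y X₂ + N)) else 0) =
      Nat.card (V₂ →ₗ[k] V₁) * ∑ N : Module.End k V₂, if N ∈ u then
        (res X₁ F).1 (of (X₂ + N)) else 0 := by
  have h1 := sum_dite_eq_sum (Equiv.refl (nilProd V₁ u))
    fun N => F.1 (of (tri X₁ Y X₂ + N.1))
  have h2 := sum_dite_eq_sum (Equiv.refl u) fun N => (res X₁ F).1 (of (X₂ + N.1))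
  simp only [Equiv.refl_apply, dite_eq_ite] at h1 h2
  refine h1.trans ?_
  refine Eq.trans ?_ (congrArg _ h2.symm)
  rw [← Fintype.sum_equiv (nilProdEquiv u) _ _ fun _ => rfl, Fintype.sum_prod_type_right,
    Finset.mul_sum]
  refine Finset.sum_congr rfl fun N _ => ?_
  rw [res_apply, mul_inv_cancel_left₀ (Nat.cast_ne_zero.2 Nat.card_pos.ne')]
  refine Fintype.sum_equiv (Equiv.addLeft Y) _ _ fun Y' => ?_
  change F.1 (of (tri X₁ Y X₂ + tri 0 Y' N.1)) = F.1 (of (tri X₁ (Y + Y') (X₂ + N.1)))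
  rw [tri_add_tri, add_zero]

/-- Such an automorphism factors uniquely as one that is trivial on V₂ followed by an automorphism
of V₂ lying in p. -/
theorem card_parProd (p : Set (Module.End k V₂)) :
    Nat.card {x : (V₁ × V₂) ≃ₗ[k] (V₁ × V₂) // x.toLinearMap ∈ parProd V₁ p} =
      Nat.card (V₁ ≃ₗ[k] V₁) * Nat.card (V₂ →ₗ[k] V₁) *
        Nat.card {x : V₂ ≃ₗ[k] V₂ // x.toLinearMap ∈ p} := by
  rw [← Nat.card_prod, ← Nat.card_congr unipEquiv, ← Nat.card_prod]
  symm
  refine Nat.card_congr (Equiv.ofBijective (fun zx => ⟨zx.1.1.trans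
    ((LinearEquiv.refl k V₁).prodCongr zx.2.1), zx.2.1.toLinearMap, zx.2.2, fun v => ?_⟩) ⟨?_, ?_⟩)
  · change zx.2.1 (zx.1.1 v).2 = _
    rw [zx.1.2]
    rfl
  · rintro ⟨⟨z, hz⟩, ⟨x, hx⟩⟩ ⟨⟨z', hz'⟩, ⟨x', hx'⟩⟩ h
    have h1 : ∀ v, ((z v).1, x (z v).2) = ((z' v).1, x' (z' v).2) := fun v =>
      LinearEquiv.congr_fun (congrArg Subtype.val h) v
    have h2 : x = x' := by
      ext v
      have := congrArg Prod.snd (h1 (0, v))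
      simpa [hz, hz'] using this
    have h3 : z = z' := by
      refine LinearEquiv.ext fun v => Prod.ext ?_ ?_
      · exact (Prod.mk.inj (h1 v)).1
      · rw [hz, hz']
    subst h2 h3
    rfl
  · rintro ⟨x, Z₂, hZ, h⟩
    have hsurj : Function.Surjective Z₂ := fun v => by
      obtain ⟨w, hw⟩ := x.surjective (0, v)
      refine ⟨w.2, ?_⟩
      rw [← h]
      exact congrArg Prod.snd hw
    -- The endomorphism induced on V₂ is surjective because x is, hence bijective by finiteness of
    -- dimension.
    let y : V₂ ≃ₗ[k] V₂ := LinearEquiv.ofBijective Z₂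
      ⟨LinearMap.injective_iff_surjective.2 hsurj, hsurj⟩
    refine ⟨⟨⟨x.trans ((LinearEquiv.refl k V₁).prodCongr y.symm), fun v => ?_⟩, ⟨y, hZ⟩⟩, ?_⟩
    · change y.symm (x v).2 = v.2
      rw [LinearEquiv.symm_apply_eq]
      exact h v
    · apply Subtype.ext
      refine LinearEquiv.ext fun v => Prod.ext rfl ?_
      change y (y.symm (x v).2) = (x v).2
      simp

/-- The relation between an endomorphism and its conjugate by a frame. -/
theorem frame_conj {x : (V₁ × V₂) ≃ₗ[k] V} {X : Module.End k V} {W : Stab X}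
    {y : V₂ ≃ₗ[k] V ⧸ W.1} (h : ∀ v, W.1.mkQ (x v) = y v.2) (v : V₁ × V₂) :
    (x.symm.conj X v).2 = y.symm.conj (quot X W) v.2 := by
  change _ = y.symm (quot X W (y v.2))
  rw [LinearEquiv.eq_symm_apply, ← h, ← h]
  change W.1.mkQ (x (x.symm (X (x v)))) = _
  rw [LinearEquiv.apply_symm_apply]
  rfl

theorem frame_stable {x : (V₁ × V₂) ≃ₗ[k] V} {X : Module.End k V} {W : Submodule k V}
    {y : V₂ ≃ₗ[k] V ⧸ W} (h : ∀ v, W.mkQ (x v) = y v.2) {Z₂ : Module.End k V₂}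
    (hZ : ∀ v, (x.symm.conj X v).2 = Z₂ v.2) : ∀ v ∈ W, X v ∈ W := by
  have hW : ∀ v, x v ∈ W ↔ v.2 = 0 := fun v => by
    rw [← Submodule.Quotient.mk_eq_zero, ← Submodule.mkQ_apply, h, LinearEquiv.map_eq_zero_iff]
  intro v hv
  obtain ⟨v, rfl⟩ := x.surjective v
  have h1 : X (x v) = x (x.symm.conj X v) := (x.apply_symm_apply (X (x v))).symm
  rw [h1, hW, hZ, (hW v).1 hv, map_zero]

theorem frame_restr {x : (V₁ × V₂) ≃ₗ[k] V} {X : Module.End k V} {W : Stab X}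
    {y : V₂ ≃ₗ[k] V ⧸ W.1} (h : ∀ v, W.1.mkQ (x v) = y v.2) :
    Conj (restr X W)
      (LinearMap.fst k V₁ V₂ ∘ₗ x.symm.conj X ∘ₗ LinearMap.inl k V₁ V₂) := by
  refine conj_restr X W (x.toLinearMap ∘ₗ LinearMap.inl k V₁ V₂)
    (x.injective.comp LinearMap.inl_injective) (frame_eq h).symm fun v => ?_
  have h1 : x.symm.conj X (v, 0) = ((x.symm.conj X (v, 0)).1, 0) :=
    Prod.ext rfl (by rw [frame_conj h, map_zero])
  change x ((x.symm.conj X (v, 0)).1, 0) = X (x (v, 0))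
  rw [← h1]
  exact x.apply_symm_apply _

/-- Induction in stages. A frame carrying X into the parabolic singles out a stable W, and
integrating over the new part of the nilradical is `res` along X | W. The frames over (W, y) and the
off-diagonal blocks cancel against the normalising cardinals. -/
theorem parOp_prod (p u : Set (Module.End k V₂)) (F : ClassFun k) (X : Module.End k V) :
    parOp (parProd V₁ p) (nilProd V₁ u) F X =
      ∑ W : Stab X, if Module.finrank k W.1 = Module.finrank k V₁ then
        parOp p u (res (restr X W) F) (quot X W) else 0 := by
  have hH : (Nat.card (V₂ →ₗ[k] V₁) : ℂ) ≠ 0 := Nat.cast_ne_zero.2 Nat.card_pos.ne'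
  have hL : (Nat.card (V₁ ≃ₗ[k] V₁) : ℂ) ≠ 0 := Nat.cast_ne_zero.2 Nat.card_pos.ne'
  unfold parOp
  rw [sum_frames _ (fun W y => if hW : ∀ v ∈ W, X v ∈ W then
    if y.symm.conj (quot X ⟨W, hW⟩) ∈ p then Nat.card (V₂ →ₗ[k] V₁) *
      ∑ N : Module.End k V₂, if N ∈ u then
        (res (restr X ⟨W, hW⟩) F).1 (of (y.symm.conj (quot X ⟨W, hW⟩) + N)) else 0 else 0 else 0),
    card_parProd, ← Nat.card_congr (nilProdEquiv u), Nat.card_prod, Finset.mul_sum, Finset.mul_sum]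
  · rw [← sum_dite_eq_sum (⟨fun W => ⟨W.1, W.2⟩, fun W => ⟨W.1, W.2⟩, fun _ => rfl, fun _ => rfl⟩ :
      {W : Submodule k V // ∀ v ∈ W, X v ∈ W} ≃ Stab X)]
    refine Finset.sum_congr rfl fun W _ => ?_
    by_cases hW : ∀ v ∈ W, X v ∈ W
    · simp only [dif_pos hW]
      change _ = if Module.finrank k W = Module.finrank k V₁ then _ else _
      split_ifs
      · rw [← Finset.sum_filter, ← Finset.sum_filter, ← Finset.mul_sum]
        push_cast
        rw [mul_inv, mul_inv, mul_inv, mul_inv, mul_inv]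
        field_simp
        rfl
      · simp
    · simp [dif_neg hW]
  · intro x W y h
    by_cases hW : ∀ v ∈ W, X v ∈ W
    · have h1 := eq_tri (frame_conj (W := ⟨W, hW⟩) h)
      have h2 := frame_restr (W := ⟨W, hW⟩) h
      rw [dif_pos hW, h1]
      simp only [tri_mem_parProd]
      split_ifs
      · rw [sum_nilProd, res_congr h2]
      · rfl
    · rw [dif_neg hW, if_neg]
      rintro ⟨Z₂, -, hZ⟩
      exact hW (frame_stable h hZ)

end

/-! ### Labelled parabolic data -/

section

variable {k : Type u} [Field k] {ι : Type} [Fintype ι]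
variable {V : Type u} [AddCommGroup V] [Module k V] [Finite V]

variable (k) in
/-- The endomorphisms of `k^ι` that are block upper triangular for the labelling `b`. -/
def parSet (b : ι → ℕ) : Set (Module.End k (ι → k)) :=
  {Z | ∀ i v, (∀ j, b i ≤ b j → v j = 0) → Z v i = 0}

variable (k) in
/-- The endomorphisms of `k^ι` that are strictly block upper triangular for the labelling `b`. -/
def nilSet (b : ι → ℕ) : Set (Module.End k (ι → k)) :=
  {Z | ∀ i v, (∀ j, b i < b j → v j = 0) → Z v i = 0}

theorem toLin'_mem_parSet [DecidableEq ι] {b : ι → ℕ} {M : Matrix ι ι k} :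
    Matrix.toLin' M ∈ parSet k b ↔ M.BlockTriangular b := by
  constructor
  · intro h i j hij
    have := h i (Pi.single j 1) fun t ht => Pi.single_eq_of_ne (by rintro rfl; omega) _
    simpa using this
  · intro h i v hv
    rw [Matrix.toLin'_apply, Matrix.mulVec, dotProduct]
    refine Finset.sum_eq_zero fun j _ => ?_
    rcases lt_or_ge (b j) (b i) with hj | hj
    · rw [h hj, zero_mul]
    · rw [hv j hj, mul_zero]

theorem toLin'_mem_nilSet [DecidableEq ι] {b : ι → ℕ} {M : Matrix ι ι k} :
    Matrix.toLin' M ∈ nilSet k b ↔ ∀ i j, b j ≤ b i → M i j = 0 := by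
  constructor
  · intro h i j hij
    have := h i (Pi.single j 1) fun t ht => Pi.single_eq_of_ne (by rintro rfl; omega) _
    simpa using this
  · intro h i v hv
    rw [Matrix.toLin'_apply, Matrix.mulVec, dotProduct]
    refine Finset.sum_eq_zero fun j _ => ?_
    rcases le_or_gt (b j) (b i) with hj | hj
    · rw [h i j hj, zero_mul]
    · rw [hv j hj, mul_zero]

variable (k) in
/-- Splitting the coordinates according to a predicate. -/
def splitEquiv (s : ι → Prop) : (ι → k) ≃ₗ[k] ({i // s i} → k) × ({i // ¬s i} → k) where
  toFun v := (fun i => v i, fun i => v i)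
  invFun w i := if h : s i then w.1 ⟨i, h⟩ else w.2 ⟨i, h⟩
  map_add' _ _ := rfl
  map_smul' _ _ := rfl
  left_inv v := by
    ext i
    simp
  right_inv w := by
    refine Prod.ext ?_ ?_
    · ext i
      simp [i.2]
    · ext i
      simp [i.2]

theorem splitEquiv_symm_pos {s : ι → Prop} {i : ι} (h : s i)
    (w : ({i // s i} → k) × ({i // ¬s i} → k)) : (splitEquiv k s).symm w i = w.1 ⟨i, h⟩ := dif_pos h

theorem splitEquiv_symm_neg {s : ι → Prop} {i : ι} (h : ¬s i)
    (w : ({i // s i} → k) × ({i // ¬s i} → k)) : (splitEquiv k s).symm w i = w.2 ⟨i, h⟩ := dif_neg h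

theorem conj_splitEquiv_apply (s : ι → Prop) (Z : Module.End k (ι → k))
    (w : ({i // s i} → k) × ({i // ¬s i} → k)) :
    (splitEquiv k s).conj Z w = splitEquiv k s (Z ((splitEquiv k s).symm w)) := rfl

/-- Removing the coordinates of smallest label splits off the first invariant subspace;
`mem_nilSet_iff` is the analogue for nilradicals. The block may be empty, as a is only a lower bound
of the labels. -/
theorem mem_parSet_iff {b : ι → ℕ} {a : ℕ} (hb : ∀ i, a ≤ b i) (Z : Module.End k (ι → k)) :
    Z ∈ parSet k b ↔ (splitEquiv k fun i => b i = a).conj Z ∈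
      parProd _ (parSet k fun i : {i // ¬b i = a} => b i) := by
  set e := splitEquiv k fun i => b i = a
  constructor
  · intro hZ
    refine ⟨LinearMap.snd k _ _ ∘ₗ e.conj Z ∘ₗ LinearMap.inr k _ _, ?_, fun w => ?_⟩
    · intro i v hv
      refine hZ i _ fun j hj => ?_
      by_cases h : b j = a
      · exact splitEquiv_symm_pos (s := fun i => b i = a) h _
      · exact (splitEquiv_symm_neg (s := fun i => b i = a) h _).trans (hv ⟨j, h⟩ hj)
    · have : e.conj Z w = e.conj Z (w.1, 0) + e.conj Z (0, w.2) := by rw [← map_add]; simp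
      rw [this, Prod.snd_add]
      refine (congrArg (· + _) ?_).trans (zero_add _)
      ext i
      refine hZ i _ fun j hj => ?_
      have h1 := hb i
      have h2 : ¬ b j = a := fun h => i.2 (by omega)
      exact splitEquiv_symm_neg (s := fun i => b i = a) h2 _
  · rintro ⟨Z₂, hZ₂, h⟩ i v hv
    by_cases hi : b i = a
    · have : v = 0 := funext fun j => hv j (hi ▸ hb j)
      rw [this, map_zero, Pi.zero_apply]
    · have h1 : Z v i = (e.conj Z (e v)).2 ⟨i, hi⟩ := by
        rw [conj_splitEquiv_apply, LinearEquiv.symm_apply_apply]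
        rfl
      rw [h1, h]
      exact hZ₂ ⟨i, hi⟩ _ fun j hj => hv j hj

theorem mem_nilSet_iff {b : ι → ℕ} {a : ℕ} (hb : ∀ i, a ≤ b i) (Z : Module.End k (ι → k)) :
    Z ∈ nilSet k b ↔ (splitEquiv k fun i => b i = a).conj Z ∈
      nilProd _ (nilSet k fun i : {i // ¬b i = a} => b i) := by
  set e := splitEquiv k fun i => b i = a
  constructor
  · intro hZ
    have h0 : ∀ w, e.conj Z (w, 0) = 0 := fun w => by
      refine (LinearEquiv.map_eq_zero_iff e).2 (funext fun i => ?_)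
      refine hZ i _ fun j hj => ?_
      have h1 := hb i
      have h2 : ¬ b j = a := by omega
      exact splitEquiv_symm_neg (s := fun i => b i = a) h2 _
    refine ⟨h0, LinearMap.snd k _ _ ∘ₗ e.conj Z ∘ₗ LinearMap.inr k _ _, ?_, fun w => ?_⟩
    · intro i v hv
      refine hZ i _ fun j hj => ?_
      by_cases h : b j = a
      · exact splitEquiv_symm_pos (s := fun i => b i = a) h _
      · exact (splitEquiv_symm_neg (s := fun i => b i = a) h _).trans (hv ⟨j, h⟩ hj)
    · have : e.conj Z w = e.conj Z (w.1, 0) + e.conj Z (0, w.2) := by rw [← map_add]; simp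
      rw [this, h0, zero_add]
      rfl
  · rintro ⟨h0, Z₂, hZ₂, h⟩ i v hv
    by_cases hi : b i = a
    · have h1 : e v = ((e v).1, 0) := by
        refine Prod.ext rfl (funext fun j => hv j ?_)
        have h1 := hb j
        have h2 := j.2
        omega
      have h2 : e (Z v) = e.conj Z (e v) := by
        rw [conj_splitEquiv_apply, LinearEquiv.symm_apply_apply]
      rw [h1, h0, LinearEquiv.map_eq_zero_iff] at h2
      rw [h2, Pi.zero_apply]
    · have h1 : Z v i = (e.conj Z (e v)).2 ⟨i, hi⟩ := by
        rw [conj_splitEquiv_apply, LinearEquiv.symm_apply_apply]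
        rfl
      rw [h1, h]
      exact hZ₂ ⟨i, hi⟩ _ fun j hj => hv j hj

theorem parOp_of_subsingleton {V₀ : Type u} [AddCommGroup V₀] [Module k V₀] [Finite V₀]
    [Subsingleton V₀] {p u : Set (Module.End k V₀)} (hp : 0 ∈ p) (hu : 0 ∈ u) (F : ClassFun k)
    (X : Module.End k V) : parOp p u F X = if Subsingleton V then F.1 (of X) else 0 := by
  have hE : ∀ Z Z' : Module.End k V₀, Z = Z' := fun Z Z' => by
    ext v
    exact Subsingleton.elim _ _
  have : Unique (Module.End k V₀) := ⟨⟨0⟩, fun Z => hE _ _⟩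
  unfold parOp
  split_ifs with hV
  · have : Unique (V₀ ≃ₗ[k] V) := ⟨⟨0⟩, fun x => by
      ext v
      exact Subsingleton.elim _ _⟩
    have h1 : Nat.card {x : V₀ ≃ₗ[k] V₀ // x.toLinearMap ∈ p} = 1 := by
      have : Unique {x : V₀ ≃ₗ[k] V₀ // x.toLinearMap ∈ p} :=
        ⟨⟨LinearEquiv.refl k V₀, by rwa [hE (LinearEquiv.toLinearMap _) 0]⟩, fun x => by
          apply Subtype.ext
          ext v
          exact Subsingleton.elim _ _⟩
      exact Nat.card_unique
    have h2 : Nat.card u = 1 := by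
      have : Unique u := ⟨⟨0, hu⟩, fun x => Subtype.ext (hE _ _)⟩
      exact Nat.card_unique
    rw [h1, h2, Fintype.sum_unique, if_pos (by rwa [hE (LinearEquiv.conj _ _) 0]),
      Fintype.sum_unique, if_pos (Set.mem_of_eq_of_mem (hE _ 0) hu)]
    simp only [Nat.cast_one, mul_one, inv_one, one_mul]
    refine val_congr F ⟨default, fun v => Subsingleton.elim _ _⟩
  · have : IsEmpty (V₀ ≃ₗ[k] V) := ⟨fun x => hV x.symm.toEquiv.subsingleton⟩
    rw [Finset.univ_eq_empty, Finset.sum_empty, mul_zero]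

/-- Iterating `parOp_prod` builds the flag block by block. The index type and the starting label a
are kept general, so that after removing the block of label a the induction continues on the
remaining coordinates from a + 1 without relabelling. -/
theorem parOp_label [Finite k] (l : List ℕ) : ∀ {ι : Type} [Fintype ι] (b : ι → ℕ) (a : ℕ),
    (∀ i, a ≤ b i ∧ b i < a + l.length) →
    (∀ j (hj : j < l.length), Fintype.card {i // b i = a + j} = l[j]) →
    ∀ (V : Type u) [AddCommGroup V] [Module k V] [Finite V] (X : Module.End k V) (F : ClassFun k),
      parOp (parSet k b) (nilSet k b) F X = (flagOp k l F).1 (of X) := by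
  induction l with
  | nil =>
    intro ι _ b a h1 _ V _ _ _ X F
    have : IsEmpty ι := ⟨fun i => by have := h1 i; simp at this; omega⟩
    rw [parOp_of_subsingleton (fun i => isEmptyElim i) (fun i => isEmptyElim i), flagOp_nil_apply]
  | cons m l ih =>
    intro ι _ b a h1 h2 V _ _ _ X F
    rw [parOp_congr (splitEquiv k fun i => b i = a) (mem_parSet_iff fun i => (h1 i).1)
      (mem_nilSet_iff fun i => (h1 i).1), parOp_prod, flagOp_cons, stepOp_apply]
    have hm : Module.finrank k ({i // b i = a} → k) = m := by
      rw [Module.finrank_fintype_fun_eq_card]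
      exact h2 0 (by simp)
    rw [hm]
    refine Finset.sum_congr rfl fun W _ => ?_
    congr 1
    refine ih _ (a + 1) (fun i => ?_) (fun j hj => ?_) _ _ _
    · have h3 := h1 i
      have h4 := i.2
      simp only [List.length_cons] at h3
      omega
    · have h3 := h2 (j + 1) (by simpa using hj)
      rw [List.getElem_cons_succ] at h3
      rw [← h3]
      refine Fintype.card_congr ((Equiv.subtypeSubtypeEquivSubtypeInter (fun i => ¬b i = a)
        fun i => b i = a + 1 + j).trans (Equiv.subtypeEquivRight fun i => ?_))
      omega

/-! ### Invariant functions as class functions -/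

theorem toMatrix_eq_adj {n : ℕ} (β γ : Module.Basis (Fin n) k V) (X : Module.End k V) :
    ∃ g : GL (Fin n) k, LinearMap.toMatrix γ γ X = adj g (LinearMap.toMatrix β β X) :=
  ⟨⟨γ.toMatrix β, β.toMatrix γ, by rw [Module.Basis.toMatrix_mul_toMatrix_flip],
    by rw [Module.Basis.toMatrix_mul_toMatrix_flip]⟩,
    (basis_toMatrix_mul_linearMap_toMatrix_mul_basis_toMatrix γ β γ β X).symm⟩

/-- An invariant function on `gl_n(k)` as a class function, zero in dimensions other than `n`. -/
def extend (n : ℕ) : invFun k n →ₗ[ℂ] ClassFun k where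
  toFun f := ⟨fun M => letI := M.grp; letI := M.mod; haveI := M.fin
    if h : Module.finrank k M.carrier = n then
      f.1 (LinearMap.toMatrix (Module.finBasisOfFinrankEq k M.carrier h)
        (Module.finBasisOfFinrankEq k M.carrier h) M.endo) else 0, by
    rintro V V' _ _ _ _ _ _ X X' ⟨e, he⟩
    have h1 : Module.finrank k V = Module.finrank k V' := e.finrank_eq
    change (if h : Module.finrank k V = n then f.1 (LinearMap.toMatrix
        (Module.finBasisOfFinrankEq k V h) (Module.finBasisOfFinrankEq k V h) X) else 0) =
      if h : Module.finrank k V' = n then f.1 (LinearMap.toMatrix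
        (Module.finBasisOfFinrankEq k V' h) (Module.finBasisOfFinrankEq k V' h) X') else 0
    by_cases h : Module.finrank k V = n
    · rw [dif_pos h, dif_pos (h1 ▸ h)]
      set β := Module.finBasisOfFinrankEq k V h
      set γ := Module.finBasisOfFinrankEq k V' (h1 ▸ h)
      have h2 : LinearMap.toMatrix β β X = LinearMap.toMatrix (β.map e) (β.map e) X' := by
        ext i j
        simp [LinearMap.toMatrix_apply, ← he]
      obtain ⟨g, hg⟩ := toMatrix_eq_adj (β.map e) γ X'
      rw [hg, f.2, h2]
    · rw [dif_neg h, dif_neg (h1 ▸ h)]⟩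
  map_add' f f' := by
    apply ClassFun.ext
    intro V _ _ _ X
    by_cases h : Module.finrank k V = n
    · simp [h]
    · simp [h]
  map_smul' a f := by
    apply ClassFun.ext
    intro V _ _ _ X
    by_cases h : Module.finrank k V = n
    · simp [h]
    · simp [h]

/-- Any basis may be used, since a change of basis acts on the matrix by the adjoint action. -/
theorem extend_apply {n : ℕ} (f : invFun k n) (β : Module.Basis (Fin n) k V)
    (X : Module.End k V) : (extend n f).1 (of X) = f.1 (LinearMap.toMatrix β β X) := by
  have h : Module.finrank k V = n := by simpa using Module.finrank_eq_card_basis β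
  obtain ⟨g, hg⟩ := toMatrix_eq_adj β (Module.finBasisOfFinrankEq k V h) X
  rw [← f.2 g, ← hg]
  exact dif_pos h

theorem extend_of_ne {n : ℕ} (f : invFun k n) (X : Module.End k V)
    (h : Module.finrank k V ≠ n) : (extend n f).1 (of X) = 0 := dif_neg h

section

variable [Finite k]

theorem extend_toLin' {n : ℕ} (f : invFun k n) (M : Matrix (Fin n) (Fin n) k) :
    (extend n f).1 (of (Matrix.toLin' M)) = f.1 M := by
  rw [extend_apply f (Pi.basisFun k (Fin n)), LinearMap.toMatrix_eq_toMatrix',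
    LinearMap.toMatrix'_toLin']

theorem toLin'_adj {n : ℕ} (g : GL (Fin n) k) (M : Matrix (Fin n) (Fin n) k) :
    Conj (Matrix.toLin' M) (Matrix.toLin' (adj g M)) := by
  refine ⟨LinearEquiv.ofLinearMap (Matrix.toLin' g.1) (Matrix.toLin' g⁻¹.1) ?_ ?_, fun v => ?_⟩
  · rw [← Matrix.toLin'_mul, Units.mul_inv, Matrix.toLin'_one]
  · rw [← Matrix.toLin'_mul, Units.inv_mul, Matrix.toLin'_one]
  · change Matrix.toLin' g.1 (Matrix.toLin' M v) = Matrix.toLin' (adj g M) (Matrix.toLin' g.1 v)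
    rw [← Matrix.toLin'_mul_apply, ← Matrix.toLin'_mul_apply, adj_apply, mul_assoc, mul_assoc,
      Units.inv_mul, mul_one]

variable (k) in
/-- The restriction of a class function to `gl_n(k)`. -/
def toInv (n : ℕ) : ClassFun k →ₗ[ℂ] invFun k n where
  toFun F := ⟨fun M => F.1 (of (Matrix.toLin' M)), fun g M => (val_congr F (toLin'_adj g M)).symm⟩
  map_add' _ _ := rfl
  map_smul' _ _ := rfl

theorem toInv_apply {n : ℕ} (F : ClassFun k) (M : Matrix (Fin n) (Fin n) k) :
    (toInv k n F).1 M = F.1 (of (Matrix.toLin' M)) := rfl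

theorem toInv_extend {n : ℕ} (f : invFun k n) : toInv k n (extend n f) = f :=
  Subtype.ext (funext fun M => extend_toLin' f M)

theorem conj_toLin'_toMatrix {n : ℕ} (β : Module.Basis (Fin n) k V) (X : Module.End k V) :
    Conj X (Matrix.toLin' (LinearMap.toMatrix β β X)) := by
  refine ⟨β.equivFun, fun v => ?_⟩
  rw [Matrix.toLin'_apply]
  exact (LinearMap.toMatrix_mulVec_repr β β X v).symm

theorem extend_toInv_apply {n : ℕ} (F : ClassFun k) (X : Module.End k V)
    (h : Module.finrank k V = n) : (extend n (toInv k n F)).1 (of X) = F.1 (of X) := by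
  rw [extend_apply _ (Module.finBasisOfFinrankEq k V h), toInv_apply]
  exact (val_congr F (conj_toLin'_toMatrix _ X)).symm

end

end

/-! ### Harish-Chandra restriction followed by induction -/

section

variable {k : Type u} [Field k] [Fintype k] {n : ℕ}

variable (k n) in
/-- Invertible matrices as linear automorphisms. -/
def glEquiv : GL (Fin n) k ≃* ((Fin n → k) ≃ₗ[k] (Fin n → k)) :=
  Matrix.GeneralLinearGroup.toLin.trans (LinearMap.GeneralLinearGroup.generalLinearEquiv k _)

theorem toLinearMap_glEquiv (x : GL (Fin n) k) :
    (glEquiv k n x).toLinearMap = Matrix.toLin' x.1 := rfl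

theorem conj_glEquiv (x : GL (Fin n) k) (X : Matrix (Fin n) (Fin n) k) :
    (glEquiv k n x).conj (Matrix.toLin' X) = Matrix.toLin' (adj x X) := by
  have h : (glEquiv k n x).symm = glEquiv k n x⁻¹ := by rw [map_inv]; rfl
  rw [LinearEquiv.conj_apply, h, toLinearMap_glEquiv, toLinearMap_glEquiv, adj_apply,
    Matrix.toLin'_mul, Matrix.toLin'_mul]

variable (b : Fin n → ℕ) (g : GL (Fin n) k)

theorem card_parabolic : Nat.card (parabolic b g) =
    Nat.card {x : (Fin n → k) ≃ₗ[k] (Fin n → k) // x.toLinearMap ∈ parSet k b} := by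
  refine Nat.card_congr (Equiv.subtypeEquiv ((MulAut.conj g⁻¹).trans (glEquiv k n)).toEquiv
    fun x => ?_)
  exact toLin'_mem_parSet.symm

theorem det_one_add_nil {M : Matrix (Fin n) (Fin n) k} (hM : ∀ i j, b j ≤ b i → M i j = 0) :
    (1 + M).det = 1 := by
  have h : (1 + M).BlockTriangular b := Matrix.blockTriangular_one.add fun i j hij => hM i j hij.le
  rw [h.det]
  refine Finset.prod_eq_one fun a _ => ?_
  have : (1 + M).toSquareBlock b a = 1 := by
    ext i j
    rw [Matrix.toSquareBlock_def, Matrix.of_apply, Matrix.add_apply,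
      hM _ _ (j.2.trans i.2.symm).le, add_zero, Matrix.one_apply, Matrix.one_apply]
    simp [Subtype.ext_iff]
  rw [this, Matrix.det_one]

/-- The map x ↦ x - 1, after conjugation by g⁻¹, identifies the unipotent radical with its Lie
algebra; `det_one_add_nil` provides invertibility in the other direction. -/
theorem card_unipRadical : Nat.card (unipRadical b g) = Nat.card (nilSet k b) := by
  refine Nat.card_congr (Equiv.ofBijective
    (fun x => ⟨Matrix.toLin' ((g⁻¹ * x.1 * g : GL (Fin n) k).1 - 1), ?_⟩) ⟨?_, ?_⟩)
  · rw [toLin'_mem_nilSet]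
    intro i j hij
    rw [Matrix.sub_apply, x.2 i j hij, sub_self]
  · intro x y hxy
    have h1 := Matrix.toLin'.injective (congrArg Subtype.val hxy)
    have h2 : g⁻¹ * x.1 * g = g⁻¹ * y.1 * g := Units.ext (sub_left_injective h1)
    exact Subtype.ext (mul_left_cancel (mul_right_cancel h2))
  · rintro ⟨N, hN⟩
    obtain ⟨M, rfl⟩ := Matrix.toLin'.surjective N
    rw [toLin'_mem_nilSet] at hN
    let z : GL (Fin n) k := Matrix.GeneralLinearGroup.mkOfDetNeZero (1 + M)
      (by rw [det_one_add_nil b hN]; exact one_ne_zero)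
    have hz : g⁻¹ * (g * z * g⁻¹) * g = z := by group
    refine ⟨⟨g * z * g⁻¹, ?_⟩, ?_⟩
    · intro i j hij
      rw [hz]
      change (1 + M) i j = _
      rw [Matrix.add_apply, hN i j hij, add_zero]
    · apply Subtype.ext
      change Matrix.toLin' ((g⁻¹ * (g * z * g⁻¹) * g : GL (Fin n) k).1 - 1) = _
      rw [hz]
      change Matrix.toLin' (1 + M - 1) = _
      rw [add_sub_cancel_left]

theorem sum_nilradLie (f : invFun k n) (X : Matrix (Fin n) (Fin n) k) :
    ∑ Y : nilradLie b g, f.1 (X + Y) = ∑ N : Module.End k (Fin n → k), if N ∈ nilSet k b then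
      (extend n f).1 (of (Matrix.toLin' (adj g⁻¹ X) + N)) else 0 := by
  rw [← sum_dite_eq_sum (Equiv.refl (nilradLie b g)) fun Y => f.1 (X + Y.1)]
  refine Fintype.sum_equiv (((glEquiv k n g⁻¹).conj.toEquiv.symm.trans
    Matrix.toLin'.toEquiv.symm).symm) _ _ fun Y => ?_
  change _ = if (glEquiv k n g⁻¹).conj (Matrix.toLin' Y) ∈ nilSet k b then
    (extend n f).1 (of (Matrix.toLin' (adj g⁻¹ X) + (glEquiv k n g⁻¹).conj (Matrix.toLin' Y))) else 0
  rw [conj_glEquiv, toLin'_mem_nilSet, ← map_add, ← map_add, extend_toLin', f.2]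
  rfl

/-- A block triangular matrix and its Levi part differ by an element of the nilradical, which the
sum over the nilradical absorbs. -/
theorem sum_nilSet_stdProj (F : ClassFun k) {Z : Matrix (Fin n) (Fin n) k}
    (hZ : Z.BlockTriangular b) :
    (∑ N : Module.End k (Fin n → k), if N ∈ nilSet k b then
      F.1 (of (Matrix.toLin' (stdProj b Z) + N)) else 0) =
      ∑ N : Module.End k (Fin n → k), if N ∈ nilSet k b then
        F.1 (of (Matrix.toLin' Z + N)) else 0 := by
  refine Fintype.sum_equiv (Equiv.addLeft (Matrix.toLin' (stdProj b Z - Z))) _ _ fun N => ?_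
  obtain ⟨M, rfl⟩ := Matrix.toLin'.surjective N
  change _ = if Matrix.toLin' (stdProj b Z - Z) + Matrix.toLin' M ∈ nilSet k b then
    F.1 (of (Matrix.toLin' Z + (Matrix.toLin' (stdProj b Z - Z) + Matrix.toLin' M))) else 0
  rw [← map_add, ← map_add, ← map_add, toLin'_mem_nilSet, toLin'_mem_nilSet]
  have h : ∀ i j, b j ≤ b i → (stdProj b Z - Z + M) i j = M i j := by
    intro i j hij
    rw [Matrix.add_apply, Matrix.sub_apply, stdProj, Matrix.of_apply]
    split_ifs with h
    · simp
    · rw [hZ (lt_of_le_of_ne hij (Ne.symm h))]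
      simp
  congr 1
  · simp only [eq_iff_iff]
    exact forall₂_congr fun i j => forall_congr' fun hij => by rw [h i j hij]
  · abel_nf

/-- The right-hand side does not involve g: the choice of the parabolic subgroup in its conjugacy
class and of the Levi subgroup is irrelevant to R ∘ *R. -/
theorem hcInd_hcRes (f : invFun k n) (X : Matrix (Fin n) (Fin n) k) :
    (hcInd b g (hcRes b g f)).1 X =
      parOp (parSet k b) (nilSet k b) (extend n f) (Matrix.toLin' X) := by
  change (Nat.card (parabolic b g) : ℂ)⁻¹ * (∑ x : GL (Fin n) k,
    if adj x X ∈ parabolicLie b g then (Nat.card (unipRadical b g) : ℂ)⁻¹ *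
      ∑ Y : nilradLie b g, f.1 ((leviProj b g (adj x X)).1 + Y) else 0) = _
  rw [parOp, card_parabolic, card_unipRadical, mul_inv, mul_assoc]
  congr 1
  rw [Finset.mul_sum]
  -- The frame attached to x is the inverse of g⁻¹ x, so that conjugating by the inverse frame is
  -- the adjoint action of g⁻¹ x.
  refine Fintype.sum_equiv (((Equiv.mulLeft g⁻¹).trans (Equiv.inv _)).trans (glEquiv k n).toEquiv)
    _ _ fun x => ?_
  have hx : (glEquiv k n (g⁻¹ * x)⁻¹).symm = glEquiv k n (g⁻¹ * x) := by
    rw [map_inv]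
    rfl
  change _ = _ * if (glEquiv k n (g⁻¹ * x)⁻¹).symm.conj (Matrix.toLin' X) ∈ parSet k b then
    ∑ N : Module.End k (Fin n → k), if N ∈ nilSet k b then
      (extend n f).1 (of ((glEquiv k n (g⁻¹ * x)⁻¹).symm.conj (Matrix.toLin' X) + N)) else 0 else 0
  rw [hx, conj_glEquiv, toLin'_mem_parSet, adj_mul]
  have hmem : adj x X ∈ parabolicLie b g ↔ (adj g⁻¹ (adj x X)).BlockTriangular b := Iff.rfl
  by_cases h : (adj g⁻¹ (adj x X)).BlockTriangular b
  · rw [if_pos (hmem.2 h), if_pos h, sum_nilradLie, ← sum_nilSet_stdProj b _ h]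
    have hproj : adj g⁻¹ (leviProj b g (adj x X)).1 = stdProj b (adj g⁻¹ (adj x X)) := by
      change adj g⁻¹ (adj g _) = _
      rw [← adj_mul, inv_mul_cancel, adj_one]
    rw [hproj]
  · rw [if_neg fun h' => h (hmem.1 h'), if_neg h, mul_zero]

/-- The semisimple rank and the number of blocks add up to n. -/
theorem neg_one_pow_ssRank (c : Composition n) :
    (-1 : ℂ) ^ ssRank c = (-1) ^ n * (-1) ^ c.blocks.length := by
  have h : ssRank c + c.blocks.length = n := by
    have h1 : ∑ i, (c.blocksFun i - 1 + 1) = ∑ i, c.blocksFun i :=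
      Finset.sum_congr rfl fun i _ => Nat.sub_add_cancel (c.one_le_blocksFun i)
    rw [Finset.sum_add_distrib, c.sum_blocksFun] at h1
    simpa [ssRank] using h1
  have h2 : (-1 : ℂ) ^ c.blocks.length * (-1) ^ c.blocks.length = 1 := by
    rw [← mul_pow]
    norm_num
  calc (-1 : ℂ) ^ ssRank c = (-1) ^ ssRank c * ((-1) ^ c.blocks.length * (-1) ^ c.blocks.length) := by
        rw [h2, mul_one]
    _ = (-1) ^ (ssRank c + c.blocks.length) * (-1) ^ c.blocks.length := by rw [pow_add, mul_assoc]
    _ = _ := by rw [h]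

theorem card_compLabel (c : Composition n) (j : ℕ) (hj : j < c.blocks.length) :
    Fintype.card {i // compLabel c i = 0 + j} = c.blocks[j] := by
  have h : c.blocks[j] = c.blocksFun ⟨j, hj⟩ := rfl
  rw [h, ← Fintype.card_fin (c.blocksFun ⟨j, hj⟩)]
  have h0 : ∀ t, compLabel c (c.embedding ⟨j, hj⟩ t) = 0 + j := fun t => by
    change (c.index (c.embedding ⟨j, hj⟩ t) : ℕ) = 0 + j
    rw [c.index_embedding, zero_add]
  refine (Fintype.card_congr (Equiv.ofBijective
    (fun t => (⟨c.embedding ⟨j, hj⟩ t, h0 t⟩ : {i // compLabel c i = 0 + j})) ⟨?_, ?_⟩)).symm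
  · intro s t hst
    exact (c.embedding _).injective (congrArg Subtype.val hst)
  · rintro ⟨i, hi⟩
    have h1 : (⟨j, hj⟩ : Fin c.length) = c.index i := Fin.ext (by rw [zero_add] at hi; exact hi.symm)
    obtain ⟨t, ht⟩ := c.mem_range_embedding_iff'.2 h1
    exact ⟨t, Subtype.ext ht⟩

theorem duality_eq (χ : BorelLeviChoice k n) (f : invFun k n) :
    duality χ f = (-1 : ℂ) ^ n • toInv k n (altSum k (extend n f)) := by
  apply Subtype.ext
  funext X
  have h1 : (duality χ f).1 X = ∑ c : Composition n, (-1 : ℂ) ^ ssRank c *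
      (hcInd (compLabel c) (χ.elt c) (hcRes (compLabel c) (χ.elt c) f)).1 X := by
    rw [duality, LinearMap.sum_apply, AddSubmonoidClass.coe_finsetSum, Finset.sum_apply]
    rfl
  have h2 : ((-1 : ℂ) ^ n • toInv k n (altSum k (extend n f))).1 X =
      (-1) ^ n * (altSum k (extend n f)).1 (of (Matrix.toLin' X)) := rfl
  rw [h1, h2, altSum_apply, Module.finrank_fin_fun, sum_compBlocks, Finset.mul_sum]
  refine Finset.sum_congr rfl fun c _ => ?_
  rw [neg_one_pow_ssRank, hcInd_hcRes, mul_assoc]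
  congr 2
  refine parOp_label c.blocks (compLabel c) 0 (fun i => ⟨Nat.zero_le _, ?_⟩) (card_compLabel c) _ _ _
  rw [zero_add]
  exact (c.index i).2

end

/-! ### Two blocks -/

section

variable {k : Type u} [Field k] {n₁ n₂ : ℕ}

variable (k n₁ n₂) in
/-- Splitting `k^(n₁ + n₂)` into the first `n₁` and the last `n₂` coordinates. -/
def prodEquiv : (Fin (n₁ + n₂) → k) ≃ₗ[k] (Fin n₁ → k) × (Fin n₂ → k) where
  toFun v := (fun i => v (Fin.castAdd n₂ i), fun i => v (Fin.natAdd n₁ i))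
  invFun w := Fin.append w.1 w.2
  map_add' _ _ := rfl
  map_smul' _ _ := rfl
  left_inv v := Fin.append_castAdd_natAdd
  right_inv w := by
    refine Prod.ext ?_ ?_
    · ext i
      exact Fin.append_left _ _ _
    · ext i
      exact Fin.append_right _ _ _

/-- The upper right `n₁ × n₂` block. -/
def blockOff (X : Matrix (Fin (n₁ + n₂)) (Fin (n₁ + n₂)) k) : Matrix (Fin n₁) (Fin n₂) k :=
  X.submatrix (Fin.castAdd n₂) (Fin.natAdd n₁)

theorem twoLabel_castAdd (i : Fin n₁) : twoLabel n₁ n₂ (Fin.castAdd n₂ i) = 0 := by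
  simp [twoLabel]

theorem twoLabel_natAdd (i : Fin n₂) : twoLabel n₁ n₂ (Fin.natAdd n₁ i) = 1 := by
  simp [twoLabel]

theorem conj_prodEquiv {X : Matrix (Fin (n₁ + n₂)) (Fin (n₁ + n₂)) k}
    (hX : X.BlockTriangular (twoLabel n₁ n₂)) :
    (prodEquiv k n₁ n₂).conj (Matrix.toLin' X) = tri (Matrix.toLin' (blockOne X))
      (Matrix.toLin' (blockOff X)) (Matrix.toLin' (blockTwo X)) := by
  refine LinearMap.ext fun w => Prod.ext ?_ ?_
  · ext i
    change (Matrix.toLin' X (Fin.append w.1 w.2)) (Fin.castAdd n₂ i) =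
      Matrix.toLin' (blockOne X) w.1 i + Matrix.toLin' (blockOff X) w.2 i
    simp only [Matrix.toLin'_apply, Matrix.mulVec, dotProduct, Fin.sum_univ_add, Fin.append_left,
      Fin.append_right]
    rfl
  · ext i
    change (Matrix.toLin' X (Fin.append w.1 w.2)) (Fin.natAdd n₁ i) =
      Matrix.toLin' (blockTwo X) w.2 i
    simp only [Matrix.toLin'_apply, Matrix.mulVec, dotProduct, Fin.sum_univ_add, Fin.append_left,
      Fin.append_right]
    rw [Finset.sum_eq_zero, zero_add]
    · rfl
    · intro j _
      rw [hX (by rw [twoLabel_castAdd, twoLabel_natAdd]; exact one_pos), zero_mul]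

theorem fst_comp_tri_comp_inl {V V' : Type u} [AddCommGroup V] [Module k V] [AddCommGroup V']
    [Module k V'] (X₁ : Module.End k V) (Y : V' →ₗ[k] V) (X₂ : Module.End k V') :
    LinearMap.fst k V V' ∘ₗ tri X₁ Y X₂ ∘ₗ LinearMap.inl k V V' = X₁ := by
  ext v
  simp [tri]

theorem snd_comp_tri_comp_inr {V V' : Type u} [AddCommGroup V] [Module k V] [AddCommGroup V']
    [Module k V'] (X₁ : Module.End k V) (Y : V' →ₗ[k] V) (X₂ : Module.End k V') :
    LinearMap.snd k V V' ∘ₗ tri X₁ Y X₂ ∘ₗ LinearMap.inr k V V' = X₂ := by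
  ext v
  simp [tri]

variable [Fintype k]

theorem blockTriangular_twoLabel_iff {X : Matrix (Fin (n₁ + n₂)) (Fin (n₁ + n₂)) k} :
    X.BlockTriangular (twoLabel n₁ n₂) ↔
      (prodEquiv k n₁ n₂).conj (Matrix.toLin' X) ∈ parProd (Fin n₁ → k) Set.univ := by
  constructor
  · intro hX
    rw [conj_prodEquiv hX, tri_mem_parProd]
    trivial
  · rintro ⟨Z₂, -, h⟩ i j hij
    have h1 : ∀ i' j', X (Fin.natAdd n₁ i') (Fin.castAdd n₂ j') = 0 := by
      intro i' j'
      have h2 : (prodEquiv k n₁ n₂).symm (Pi.single j' 1, 0) = Pi.single (Fin.castAdd n₂ j') 1 := by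
        rw [LinearEquiv.symm_apply_eq]
        refine Prod.ext ?_ ?_
        · ext t
          change _ = (Pi.single (Fin.castAdd n₂ j') 1 : Fin (n₁ + n₂) → k) (Fin.castAdd n₂ t)
          simp [Pi.single_apply]
        · ext t
          symm
          exact Pi.single_eq_of_ne (by simp [Fin.ext_iff]; omega) _
      have h3 := congrFun (h (Pi.single j' 1, 0)) i'
      rw [map_zero] at h3
      change Matrix.toLin' X ((prodEquiv k n₁ n₂).symm _) (Fin.natAdd n₁ i') = 0 at h3
      rw [h2] at h3
      simpa using h3
    refine Fin.addCases (fun i' hi => ?_) (fun i' hi => ?_) i hij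
    · rw [twoLabel_castAdd] at hi
      omega
    · refine Fin.addCases (fun j' _ => h1 i' j') (fun j' hj => ?_) j hi
      rw [twoLabel_natAdd, twoLabel_natAdd] at hj
      omega

theorem card_parabolic_twoLabel (g : GL (Fin (n₁ + n₂)) k) :
    Nat.card (parabolic (twoLabel n₁ n₂) g) =
      Nat.card ((Fin n₁ → k) ≃ₗ[k] (Fin n₁ → k)) * Nat.card ((Fin n₂ → k) →ₗ[k] (Fin n₁ → k)) *
        Nat.card ((Fin n₂ → k) ≃ₗ[k] (Fin n₂ → k)) := by
  have h := card_parProd (V₁ := Fin n₁ → k) (V₂ := Fin n₂ → k) (k := k) Set.univ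
  rw [Nat.card_congr (Equiv.subtypeUnivEquiv fun _ => Set.mem_univ _)] at h
  rw [card_parabolic, ← h]
  refine Nat.card_congr (Equiv.subtypeEquiv
    ⟨fun x => ((prodEquiv k n₁ n₂).symm.trans x).trans (prodEquiv k n₁ n₂),
      fun x => ((prodEquiv k n₁ n₂).trans x).trans (prodEquiv k n₁ n₂).symm,
      fun x => by ext; simp, fun x => by ext : 1; simp⟩ fun x => ?_)
  obtain ⟨M, hM⟩ := Matrix.toLin'.surjective x.toLinearMap
  rw [← hM, toLin'_mem_parSet, blockTriangular_twoLabel_iff, hM]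
  rfl

/-- The sum over the group becomes a sum over frames, and the summand depends only on the image W of
the first n₁ coordinates. The number of frames with given W is the order of the parabolic subgroup,
so the normalisation leaves the plain sum over stable W. -/
theorem hcInd_boxProd_apply (f₁ : invFun k n₁) (f₂ : invFun k n₂)
    (X : Matrix (Fin (n₁ + n₂)) (Fin (n₁ + n₂)) k) :
    (hcInd (twoLabel n₁ n₂) 1 (boxProd f₁ f₂)).1 X =
      (mul (extend n₁ f₁) (extend n₂ f₂)).1 (of (Matrix.toLin' X)) := by
  set e := prodEquiv k n₁ n₂
  let G : Module.End k ((Fin n₁ → k) × (Fin n₂ → k)) → ℂ := fun Z =>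
    if Z ∈ parProd (Fin n₁ → k) Set.univ then
      (extend n₁ f₁).1 (of (LinearMap.fst k _ _ ∘ₗ Z ∘ₗ LinearMap.inl k _ _)) *
      (extend n₂ f₂).1 (of (LinearMap.snd k _ _ ∘ₗ Z ∘ₗ LinearMap.inr k _ _)) else 0
  have h1 : ∑ x : GL (Fin (n₁ + n₂)) k,
      (if adj x X ∈ parabolicLie (twoLabel n₁ n₂) (1 : GL (Fin (n₁ + n₂)) k) then
        (boxProd f₁ f₂).1 (leviProj (twoLabel n₁ n₂) 1 (adj x X)) else 0) =
      ∑ x : ((Fin n₁ → k) × (Fin n₂ → k)) ≃ₗ[k] (Fin (n₁ + n₂) → k),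
        G (x.symm.conj (Matrix.toLin' X)) := by
    refine Fintype.sum_equiv ((glEquiv k (n₁ + n₂)).toEquiv.trans
      ⟨fun x => (x.trans e).symm, fun y => y.symm.trans e.symm, fun x => by ext; simp,
        fun y => by ext : 1; simp⟩) _ _ fun x => ?_
    have hx : (((glEquiv k (n₁ + n₂)) x).trans e).symm.symm.conj (Matrix.toLin' X) =
        e.conj (Matrix.toLin' (adj x X)) := by
      rw [← conj_glEquiv]
      rfl
    change _ = G ((((glEquiv k (n₁ + n₂)) x).trans e).symm.symm.conj (Matrix.toLin' X))
    rw [hx]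
    have hmem : adj x X ∈ parabolicLie (twoLabel n₁ n₂) (1 : GL (Fin (n₁ + n₂)) k) ↔
        (adj x X).BlockTriangular (twoLabel n₁ n₂) := by
      change (adj 1⁻¹ (adj x X)).BlockTriangular (twoLabel n₁ n₂) ↔ _
      rw [inv_one, adj_one]
    simp only [G]
    by_cases h : (adj x X).BlockTriangular (twoLabel n₁ n₂)
    · rw [if_pos (hmem.2 h), if_pos (blockTriangular_twoLabel_iff.1 h), conj_prodEquiv h]
      have h2 : (leviProj (twoLabel n₁ n₂) 1 (adj x X)).1 = stdProj (twoLabel n₁ n₂) (adj x X) := by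
        change adj 1 (stdProj _ (adj 1⁻¹ _)) = _
        rw [inv_one, adj_one, adj_one]
      have h3 : blockOne (stdProj (twoLabel n₁ n₂) (adj x X)) = blockOne (adj x X) := by
        ext i j
        simp [blockOne, stdProj, twoLabel_castAdd]
      have h4 : blockTwo (stdProj (twoLabel n₁ n₂) (adj x X)) = blockTwo (adj x X) := by
        ext i j
        simp [blockTwo, stdProj, twoLabel_natAdd]
      change f₁.1 (blockOne (leviProj (twoLabel n₁ n₂) 1 (adj x X)).1) *
        f₂.1 (blockTwo (leviProj (twoLabel n₁ n₂) 1 (adj x X)).1) = _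
      rw [h2, h3, h4, ← extend_toLin' f₁, ← extend_toLin' f₂, fst_comp_tri_comp_inl,
        snd_comp_tri_comp_inr]
    · rw [if_neg fun h' => h (hmem.1 h'), if_neg fun h' => h (blockTriangular_twoLabel_iff.2 h')]
  have hH : (Nat.card ((Fin n₂ → k) →ₗ[k] (Fin n₁ → k)) : ℂ) ≠ 0 :=
    Nat.cast_ne_zero.2 Nat.card_pos.ne'
  have hL₁ : (Nat.card ((Fin n₁ → k) ≃ₗ[k] (Fin n₁ → k)) : ℂ) ≠ 0 :=
    Nat.cast_ne_zero.2 Nat.card_pos.ne'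
  have hL₂ : (Nat.card ((Fin n₂ → k) ≃ₗ[k] (Fin n₂ → k)) : ℂ) ≠ 0 :=
    Nat.cast_ne_zero.2 Nat.card_pos.ne'
  change (Nat.card (parabolic (twoLabel n₁ n₂) (1 : GL (Fin (n₁ + n₂)) k)) : ℂ)⁻¹ *
    (∑ x : GL (Fin (n₁ + n₂)) k,
      if adj x X ∈ parabolicLie (twoLabel n₁ n₂) (1 : GL (Fin (n₁ + n₂)) k) then
        (boxProd f₁ f₂).1 (leviProj (twoLabel n₁ n₂) 1 (adj x X)) else 0) = _
  rw [h1, card_parabolic_twoLabel, sum_frames _ fun W _ =>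
    mulTerm (extend n₁ f₁) (extend n₂ f₂) (Matrix.toLin' X) W]
  · rw [mul_apply_eq_sum_mulTerm]
    -- The dimension condition can be dropped because `extend n₁ f₁` vanishes on subspaces of
    -- dimension other than n₁.
    have h5 : ∀ W : Submodule k (Fin (n₁ + n₂) → k),
        (if Module.finrank k W = Module.finrank k (Fin n₁ → k) then
          ∑ _y : (Fin n₂ → k) ≃ₗ[k] ((Fin (n₁ + n₂) → k) ⧸ W),
            mulTerm (extend n₁ f₁) (extend n₂ f₂) (Matrix.toLin' X) W else 0) =
        Nat.card ((Fin n₂ → k) ≃ₗ[k] (Fin n₂ → k)) *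
          mulTerm (extend n₁ f₁) (extend n₂ f₂) (Matrix.toLin' X) W := by
      intro W
      split_ifs with hW
      · have hq : Module.finrank k (Fin n₂ → k) =
            Module.finrank k ((Fin (n₁ + n₂) → k) ⧸ W) := by
          have := W.finrank_quotient_add_finrank
          simp only [Module.finrank_fin_fun] at *
          omega
        rw [Finset.sum_const, nsmul_eq_mul, Finset.card_univ, ← Nat.card_eq_fintype_card,
          Nat.card_congr (⟨fun y => y.trans (LinearEquiv.ofFinrankEq _ _ hq).symm,
            fun y => y.trans (LinearEquiv.ofFinrankEq _ _ hq), fun y => by ext : 1; simp,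
            fun y => by ext : 1; simp⟩ :
            ((Fin n₂ → k) ≃ₗ[k] ((Fin (n₁ + n₂) → k) ⧸ W)) ≃
              ((Fin n₂ → k) ≃ₗ[k] (Fin n₂ → k)))]
      · unfold mulTerm
        split_ifs with hst
        · rw [extend_of_ne f₁ _ (by simpa using hW), zero_mul, mul_zero]
        · rw [mul_zero]
    rw [Finset.sum_congr rfl fun W _ => h5 W, ← Finset.mul_sum]
    push_cast
    field_simp
  · intro x W y h
    simp only [G]
    unfold mulTerm
    by_cases hW : ∀ v ∈ W, Matrix.toLin' X v ∈ W
    · rw [dif_pos hW]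
      have h6 := frame_conj (W := ⟨W, hW⟩) h
      have h7 := frame_restr (W := ⟨W, hW⟩) h
      rw [if_pos ⟨_, trivial, h6⟩]
      refine congrArg₂ (· * ·) (val_congr _ h7.symm) (val_congr _ ?_)
      refine ⟨y, fun v => ?_⟩
      change y (x.symm.conj (Matrix.toLin' X) (0, v)).2 = _
      rw [h6]
      change y (y.symm _) = _
      rw [LinearEquiv.apply_symm_apply]
      rfl
    · rw [dif_neg hW, if_neg]
      rintro ⟨Z₂, -, hZ⟩
      exact hW (frame_stable h hZ)

theorem hcInd_boxProd (f₁ : invFun k n₁) (f₂ : invFun k n₂) :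
    hcInd (twoLabel n₁ n₂) 1 (boxProd f₁ f₂) =
      toInv k (n₁ + n₂) (mul (extend n₁ f₁) (extend n₂ f₂)) :=
  Subtype.ext (funext fun X => hcInd_boxProd_apply f₁ f₂ X)

theorem mem_nilradLie_twoLabel {Y : Matrix (Fin (n₁ + n₂)) (Fin (n₁ + n₂)) k} :
    Y ∈ nilradLie (twoLabel n₁ n₂) (1 : GL (Fin (n₁ + n₂)) k) ↔
      ∀ i j, twoLabel n₁ n₂ j ≤ twoLabel n₁ n₂ i → Y i j = 0 := by
  change (∀ i j, twoLabel n₁ n₂ j ≤ twoLabel n₁ n₂ i → adj 1⁻¹ Y i j = 0) ↔ _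
  rw [inv_one, adj_one]

/-- The nilradical of the parabolic subalgebra with two blocks is the upper right block. -/
def nilradTwoEquiv : nilradLie (twoLabel n₁ n₂) (1 : GL (Fin (n₁ + n₂)) k) ≃
    ((Fin n₂ → k) →ₗ[k] (Fin n₁ → k)) :=
  Equiv.trans
    { toFun := fun Y => blockOff Y.1
      invFun := fun y => ⟨(Matrix.fromBlocks 0 y 0 0).submatrix finSumFinEquiv.symm
          finSumFinEquiv.symm, by
        rw [mem_nilradLie_twoLabel]
        intro i j
        refine Fin.addCases (fun i' => ?_) (fun i' => ?_) i
        · refine Fin.addCases (fun j' _ => ?_) (fun j' h => ?_) j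
          · simp
          · rw [twoLabel_castAdd, twoLabel_natAdd] at h
            omega
        · refine Fin.addCases (fun j' _ => ?_) (fun j' _ => ?_) j
          · simp
          · simp⟩
      left_inv := fun Y => by
        have hY := mem_nilradLie_twoLabel.1 Y.2
        apply Subtype.ext
        ext i j
        refine Fin.addCases (fun i' => ?_) (fun i' => ?_) i
        · refine Fin.addCases (fun j' => ?_) (fun j' => ?_) j
          · simpa using (hY _ _ (by rw [twoLabel_castAdd, twoLabel_castAdd])).symm
          · simp [blockOff]
        · refine Fin.addCases (fun j' => ?_) (fun j' => ?_) j
          · simpa using (hY _ _ (by rw [twoLabel_castAdd, twoLabel_natAdd]; simp)).symm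
          · simpa using (hY _ _ (by rw [twoLabel_natAdd, twoLabel_natAdd])).symm
      right_inv := fun y => by
        ext i j
        simp [blockOff] }
    Matrix.toLin'.toEquiv

theorem isBlockDiag_of_mem_leviLie {X : Matrix (Fin (n₁ + n₂)) (Fin (n₁ + n₂)) k}
    (hX : X ∈ leviLie (twoLabel n₁ n₂) (1 : GL (Fin (n₁ + n₂)) k)) :
    IsBlockDiag (twoLabel n₁ n₂) X := by
  change IsBlockDiag _ (adj 1⁻¹ X) at hX
  rwa [inv_one, adj_one] at hX

theorem sum_nilradLie_twoLabel (f : invFun k (n₁ + n₂))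
    (X : leviLie (twoLabel n₁ n₂) (1 : GL (Fin (n₁ + n₂)) k)) :
    ∑ Y : nilradLie (twoLabel n₁ n₂) (1 : GL (Fin (n₁ + n₂)) k), f.1 (X.1 + Y) =
      Nat.card ((Fin n₂ → k) →ₗ[k] (Fin n₁ → k)) *
        (res (Matrix.toLin' (blockOne X.1)) (extend (n₁ + n₂) f)).1
          (of (Matrix.toLin' (blockTwo X.1))) := by
  have hX := isBlockDiag_of_mem_leviLie X.2
  rw [res_apply, mul_inv_cancel_left₀ (Nat.cast_ne_zero.2 Nat.card_pos.ne')]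
  refine Fintype.sum_equiv nilradTwoEquiv _ _ fun Y => ?_
  have hY := mem_nilradLie_twoLabel.1 Y.2
  have h1 : (X.1 + Y.1).BlockTriangular (twoLabel n₁ n₂) := fun i j hij => by
    rw [Matrix.add_apply, hX i j hij.ne', hY i j hij.le, add_zero]
  have h2 : blockOne (X.1 + Y.1) = blockOne X.1 := by
    ext i j
    simp [blockOne, hY _ _ (by rw [twoLabel_castAdd, twoLabel_castAdd] :
      twoLabel n₁ n₂ (Fin.castAdd n₂ j) ≤ twoLabel n₁ n₂ (Fin.castAdd n₂ i))]
  have h3 : blockTwo (X.1 + Y.1) = blockTwo X.1 := by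
    ext i j
    simp [blockTwo, hY _ _ (by rw [twoLabel_natAdd, twoLabel_natAdd] :
      twoLabel n₁ n₂ (Fin.natAdd n₁ j) ≤ twoLabel n₁ n₂ (Fin.natAdd n₁ i))]
  have h4 : blockOff (X.1 + Y.1) = blockOff Y.1 := by
    ext i j
    simp [blockOff, hX (Fin.castAdd n₂ i) (Fin.natAdd n₁ j)
      (by rw [twoLabel_castAdd, twoLabel_natAdd]; exact zero_ne_one)]
  have h5 := conj_prodEquiv h1
  rw [h2, h3, h4] at h5
  change _ = (extend (n₁ + n₂) f).1 (of (tri _ (Matrix.toLin' (blockOff Y.1)) _))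
  rw [← h5, ← extend_toLin' f]
  refine val_congr _ ⟨prodEquiv k n₁ n₂, fun v => ?_⟩
  rw [LinearEquiv.conj_apply_apply, LinearEquiv.symm_apply_apply]

theorem hcRes_twoLabel_eq_zero_iff (f : invFun k (n₁ + n₂)) :
    hcRes (twoLabel n₁ n₂) 1 f = 0 ↔
      ∀ (X₁ : Module.End k (Fin n₁ → k)) (X₂ : Module.End k (Fin n₂ → k)),
        (res X₁ (extend (n₁ + n₂) f)).1 (of X₂) = 0 := by
  have hH : (Nat.card ((Fin n₂ → k) →ₗ[k] (Fin n₁ → k)) : ℂ) ≠ 0 :=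
    Nat.cast_ne_zero.2 Nat.card_pos.ne'
  have hU : (Nat.card (unipRadical (twoLabel n₁ n₂) (1 : GL (Fin (n₁ + n₂)) k)) : ℂ) ≠ 0 := by
    rw [card_unipRadical]
    have : Nonempty (nilSet k (twoLabel n₁ n₂)) := ⟨⟨0, fun _ _ _ => rfl⟩⟩
    exact Nat.cast_ne_zero.2 Nat.card_pos.ne'
  have key : ∀ X, (hcRes (twoLabel n₁ n₂) 1 f).1 X = 0 ↔
      (res (Matrix.toLin' (blockOne X.1)) (extend (n₁ + n₂) f)).1
          (of (Matrix.toLin' (blockTwo X.1))) = 0 := by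
    intro X
    change _ * _ = (0 : ℂ) ↔ _
    rw [mul_eq_zero, or_iff_right (inv_ne_zero hU), sum_nilradLie_twoLabel, mul_eq_zero,
      or_iff_right hH]
  constructor
  · intro h X₁ X₂
    obtain ⟨M₁, rfl⟩ := Matrix.toLin'.surjective X₁
    obtain ⟨M₂, rfl⟩ := Matrix.toLin'.surjective X₂
    let X : Matrix (Fin (n₁ + n₂)) (Fin (n₁ + n₂)) k :=
      (Matrix.fromBlocks M₁ 0 0 M₂).submatrix finSumFinEquiv.symm finSumFinEquiv.symm
    have hX : X ∈ leviLie (twoLabel n₁ n₂) (1 : GL (Fin (n₁ + n₂)) k) := by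
      change IsBlockDiag _ (adj 1⁻¹ X)
      rw [inv_one, adj_one]
      intro i j
      refine Fin.addCases (fun i' => ?_) (fun i' => ?_) i
      · refine Fin.addCases (fun j' h => ?_) (fun j' _ => ?_) j
        · rw [twoLabel_castAdd, twoLabel_castAdd] at h
          exact absurd rfl h
        · simp [X]
      · refine Fin.addCases (fun j' _ => ?_) (fun j' h => ?_) j
        · simp [X]
        · rw [twoLabel_natAdd, twoLabel_natAdd] at h
          exact absurd rfl h
    have h1 : blockOne X = M₁ := by
      ext i j
      simp [X, blockOne]
    have h2 : blockTwo X = M₂ := by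
      ext i j
      simp [X, blockTwo]
    have h3 := (key ⟨X, hX⟩).1 (by rw [h]; rfl)
    rwa [h1, h2] at h3
  · intro h
    apply Subtype.ext
    funext X
    exact (key X).2 (h _ _)

/-! ### Pre-cuspidal functions -/

theorem res_extend_eq_zero {n : ℕ} {f : invFun k n}
    (hf : ∀ (n₁ n₂ : ℕ) (h : n₁ + n₂ = n), 0 < n₁ → 0 < n₂ →
      hcRes (twoLabel n₁ n₂) 1 (h ▸ f) = 0)
    {V V' : Type u} [AddCommGroup V] [Module k V] [Finite V] [AddCommGroup V'] [Module k V']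
    [Finite V'] [Nontrivial V] [Nontrivial V'] (X : Module.End k V) (X' : Module.End k V') :
    (res X (extend n f)).1 (of X') = 0 := by
  by_cases h : Module.finrank k V + Module.finrank k V' = n
  · subst h
    have h1 := (hcRes_twoLabel_eq_zero_iff f).1
      (hf _ _ rfl Module.finrank_pos Module.finrank_pos)
    have h2 := conj_toLin'_toMatrix (Module.finBasis k V) X
    have h3 := conj_toLin'_toMatrix (Module.finBasis k V') X'
    rw [res_congr h2, val_congr _ h3]
    exact h1 _ _
  · rw [res_apply, Finset.sum_eq_zero, mul_zero]
    intro Y _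
    exact extend_of_ne f _ (by rwa [Module.finrank_prod])

theorem isPrimitive_extend {n : ℕ} (hn : 0 < n) {f : invFun k n}
    (hf : ∀ (n₁ n₂ : ℕ) (h : n₁ + n₂ = n), 0 < n₁ → 0 < n₂ →
      hcRes (twoLabel n₁ n₂) 1 (h ▸ f) = 0) : IsPrimitive (extend n f) where
  zero V _ _ _ X hV := extend_of_ne f X (by
    rw [Module.finrank_zero_of_subsingleton]
    exact hn.ne)
  res V V' _ _ _ _ _ _ X X' hV hV' := res_extend_eq_zero hf X X'

theorem IsPreCuspidal.hcRes_twoLabel {n : ℕ} {f : invFun k n} (hf : IsPreCuspidal f) (n₁ n₂ : ℕ)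
    (h : n₁ + n₂ = n) (h₁ : 0 < n₁) (h₂ : 0 < n₂) : hcRes (twoLabel n₁ n₂) 1 (h ▸ f) = 0 := by
  subst h
  refine hf _ _ ⟨Fin.castAdd n₂ ⟨0, h₁⟩, Fin.natAdd n₁ ⟨0, h₂⟩, ?_⟩
  rw [twoLabel_castAdd, twoLabel_natAdd]
  exact zero_ne_one

/-- Every proper parabolic lies in a maximal one, obtained by separating the block of smallest label
from the rest. Its nilradical contains that of the maximal parabolic, and integrating over the
latter first already gives zero. -/
theorem isPreCuspidal_of_hcRes_twoLabel {n : ℕ} {f : invFun k n}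
    (hf : ∀ (n₁ n₂ : ℕ) (h : n₁ + n₂ = n), 0 < n₁ → 0 < n₂ →
      hcRes (twoLabel n₁ n₂) 1 (h ▸ f) = 0) : IsPreCuspidal f := by
  rintro b g ⟨i₀, j₀, hij⟩
  have hne : (Finset.univ : Finset (Fin n)).Nonempty := ⟨i₀, Finset.mem_univ _⟩
  obtain ⟨t, -, ht⟩ := Finset.exists_min_image Finset.univ b hne
  have hb : ∀ i, b t ≤ b i := fun i => ht i (Finset.mem_univ _)
  have hnt : ∃ s, ¬b s = b t := by
    by_contra! h
    exact hij ((h i₀).trans (h j₀).symm)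
  obtain ⟨s, hs⟩ := hnt
  have : Nonempty {i // b i = b t} := ⟨⟨t, rfl⟩⟩
  have : Nonempty {i // ¬b i = b t} := ⟨⟨s, hs⟩⟩
  apply Subtype.ext
  funext X
  change _ * (∑ Y : nilradLie b g, f.1 (X.1 + Y)) = (0 : ℂ)
  have hX : (adj g⁻¹ X.1).BlockTriangular b := ((isBlockDiag_iff b _).1 X.2).1
  set e := splitEquiv k fun i => b i = b t
  have h1 := (mem_parSet_iff hb _).1 (toLin'_mem_parSet.2 hX)
  obtain ⟨Z₂, -, hZ⟩ := h1
  have h2 : (∑ N : Module.End k (Fin n → k), if N ∈ nilSet k b then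
      (extend n f).1 (of (Matrix.toLin' (adj g⁻¹ X.1) + N)) else 0) =
      ∑ N, if N ∈ nilProd ({i // b i = b t} → k) (nilSet k fun i : {i // ¬b i = b t} => b i) then
        (extend n f).1 (of (e.conj (Matrix.toLin' (adj g⁻¹ X.1)) + N)) else 0 := by
    refine Fintype.sum_equiv e.conj.toEquiv _ _ fun N => ?_
    change _ = if e.conj N ∈ _ then (extend n f).1 (of (_ + e.conj N)) else 0
    simp only [mem_nilSet_iff hb N, ← map_add]
    split_ifs
    · refine val_congr _ ⟨e, fun v => ?_⟩
      rw [LinearEquiv.conj_apply_apply, LinearEquiv.symm_apply_apply]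
    · rfl
  rw [sum_nilradLie, h2, eq_tri hZ, sum_nilProd, Finset.sum_eq_zero, mul_zero, mul_zero]
  intro N _
  split_ifs
  · exact res_extend_eq_zero hf _ _
  · rfl

end

/-! ### The hermitian form -/

section

variable {k : Type u} [Field k] [Fintype k] {n : ℕ}

theorem hermForm_add_left (f f' h : invFun k n) :
    hermForm (f + f') h = hermForm f h + hermForm f' h := by
  simp only [hermForm, Submodule.coe_add, Pi.add_apply, add_mul, Finset.sum_add_distrib, mul_add]

theorem hermForm_smul_left (a : ℂ) (f h : invFun k n) :
    hermForm (a • f) h = a * hermForm f h := by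
  rw [hermForm, hermForm, mul_left_comm a, Finset.mul_sum Finset.univ _ a]
  exact congrArg _ (Finset.sum_congr rfl fun X _ => mul_assoc a (f.1 X) _)

theorem conj_hermForm (f h : invFun k n) : (starRingEnd ℂ) (hermForm f h) = hermForm h f := by
  simp only [hermForm, map_mul, map_inv₀, map_natCast, map_sum, Complex.conj_conj]
  congr 1
  exact Finset.sum_congr rfl fun X _ => mul_comm _ _

theorem eq_zero_of_hermForm_self {f : invFun k n} (h : hermForm f f = 0) : f = 0 := by
  have hG : (Nat.card (GL (Fin n) k) : ℂ) ≠ 0 := Nat.cast_ne_zero.2 Nat.card_pos.ne'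
  have h1 : ∑ X : Matrix (Fin n) (Fin n) k, Complex.normSq (f.1 X) = 0 := by
    have := (mul_eq_zero.1 h).resolve_left (inv_ne_zero hG)
    simp only [Complex.mul_conj] at this
    exact_mod_cast this
  rw [Finset.sum_eq_zero_iff_of_nonneg fun X _ => Complex.normSq_nonneg _] at h1
  apply Subtype.ext
  funext X
  exact Complex.normSq_eq_zero.1 (h1 X (Finset.mem_univ X))

/-! ### Adjunction between induction and restriction -/

variable (b : Fin n → ℕ) (g : GL (Fin n) k)

/-- The Lie algebra of a parabolic subgroup is the sum of those of the Levi subgroup and of the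
unipotent radical. -/
def parabolicLieEquiv : leviLie b g × nilradLie b g ≃ parabolicLie b g where
  toFun x := ⟨x.1.1 + x.2.1, by
    have h1 : IsBlockDiag b (adj g⁻¹ x.1.1) := x.1.2
    have h2 : ∀ i j, b j ≤ b i → adj g⁻¹ x.2.1 i j = 0 := x.2.2
    change (adj g⁻¹ _).BlockTriangular b
    rw [map_add]
    exact ((isBlockDiag_iff b _).1 h1).1.add fun i j hij => h2 i j hij.le⟩
  invFun Z := (leviProj b g Z, ⟨Z.1 - (leviProj b g Z).1, by
    have h1 : (adj g⁻¹ Z.1).BlockTriangular b := Z.2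
    change ∀ i j, b j ≤ b i → adj g⁻¹ (Z.1 - adj g (stdProj b (adj g⁻¹ Z.1))) i j = 0
    intro i j hij
    rw [map_sub, ← adj_mul, inv_mul_cancel, adj_one, Matrix.sub_apply, stdProj, Matrix.of_apply]
    split_ifs with h
    · rw [sub_self]
    · rw [h1 (lt_of_le_of_ne hij (Ne.symm h)), sub_zero]⟩)
  left_inv x := by
    have h1 : IsBlockDiag b (adj g⁻¹ x.1.1) := x.1.2
    have h2 : ∀ i j, b j ≤ b i → adj g⁻¹ x.2.1 i j = 0 := x.2.2
    have h3 : (leviProj b g (x.1.1 + x.2.1)).1 = x.1.1 := by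
      change adj g (stdProj b (adj g⁻¹ (x.1.1 + x.2.1))) = _
      have : stdProj b (adj g⁻¹ (x.1.1 + x.2.1)) = adj g⁻¹ x.1.1 := by
        ext i j
        rw [map_add, stdProj, Matrix.of_apply, Matrix.add_apply]
        split_ifs with h
        · rw [h2 i j h.symm.le, add_zero]
        · rw [h1 i j h]
      rw [this, ← adj_mul, mul_inv_cancel, adj_one]
    refine Prod.ext (Subtype.ext h3) (Subtype.ext ?_)
    change x.1.1 + x.2.1 - (leviProj b g (x.1.1 + x.2.1)).1 = _
    rw [h3, add_sub_cancel_left]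
  right_inv Z := Subtype.ext (add_sub_cancel _ _)

theorem card_unipRadical_ne_zero : (Nat.card (unipRadical b g) : ℂ) ≠ 0 := by
  rw [card_unipRadical]
  have : Nonempty (nilSet k b) := ⟨⟨0, fun _ _ _ => rfl⟩⟩
  exact Nat.cast_ne_zero.2 Nat.card_pos.ne'

/-- Harish-Chandra induction and restriction are adjoint, up to the normalisation of the form on
the Levi subgroup. -/
theorem hermForm_hcInd (φ : leviInvFun b g) (f : invFun k n) :
    hermForm (hcInd b g φ) f = (Nat.card (parabolic b g) : ℂ)⁻¹ * Nat.card (unipRadical b g) *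
      ∑ L : leviLie b g, φ.1 L * (starRingEnd ℂ) ((hcRes b g f).1 L) := by
  have hG : (Nat.card (GL (Fin n) k) : ℂ) ≠ 0 := Nat.cast_ne_zero.2 Nat.card_pos.ne'
  let t : Matrix (Fin n) (Fin n) k → ℂ := fun Z =>
    if Z ∈ parabolicLie b g then φ.1 (leviProj b g Z) * (starRingEnd ℂ) (f.1 Z) else 0
  have h1 : ∑ X : Matrix (Fin n) (Fin n) k, (hcInd b g φ).1 X * (starRingEnd ℂ) (f.1 X) =
      (Nat.card (parabolic b g) : ℂ)⁻¹ * (Nat.card (GL (Fin n) k) * ∑ Z, t Z) := by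
    have h2 : ∀ X : Matrix (Fin n) (Fin n) k, (hcInd b g φ).1 X * (starRingEnd ℂ) (f.1 X) =
        (Nat.card (parabolic b g) : ℂ)⁻¹ * ∑ x : GL (Fin n) k, t (adj x X) := by
      intro X
      change (_ * ∑ x : GL (Fin n) k, _) * _ = _
      rw [mul_assoc, Finset.sum_mul]
      congr 1
      refine Finset.sum_congr rfl fun x _ => ?_
      simp only [t]
      split_ifs
      · rw [f.2 x]
      · rw [zero_mul]
    rw [Finset.sum_congr rfl fun X _ => h2 X, ← Finset.mul_sum, Finset.sum_comm]
    congr 1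
    -- Invariance of f lets the sum over X be reindexed by the adjoint action, so each group element
    -- contributes equally.
    have h3 : ∀ x : GL (Fin n) k, ∑ X, t (adj x X) = ∑ Z, t Z := fun x =>
      Fintype.sum_equiv ⟨adj x, adj x⁻¹, fun X => by rw [← adj_mul, inv_mul_cancel, adj_one],
        fun X => by rw [← adj_mul, mul_inv_cancel, adj_one]⟩ _ _ fun X => rfl
    rw [Finset.sum_congr rfl fun x _ => h3 x, Finset.sum_const, nsmul_eq_mul, Finset.card_univ,
      Nat.card_eq_fintype_card]
  have h4 : ∑ Z, t Z = Nat.card (unipRadical b g) *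
      ∑ L : leviLie b g, φ.1 L * (starRingEnd ℂ) ((hcRes b g f).1 L) := by
    have h5 := sum_dite_eq_sum (parabolicLieEquiv b g).symm fun x =>
      φ.1 x.1 * (starRingEnd ℂ) (f.1 (x.1.1 + x.2.1))
    rw [Fintype.sum_prod_type] at h5
    rw [Finset.mul_sum]
    refine (Finset.sum_congr rfl fun Z _ => ?_).trans
      (h5.trans (Finset.sum_congr rfl fun L _ => ?_))
    · simp only [t]
      split_ifs with hZ
      · have h6 : ((parabolicLieEquiv b g).symm ⟨Z, hZ⟩).1.1 +
            ((parabolicLieEquiv b g).symm ⟨Z, hZ⟩).2.1 = Z :=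
          congrArg Subtype.val ((parabolicLieEquiv b g).apply_symm_apply ⟨Z, hZ⟩)
        rw [h6]
        rfl
      · rfl
    · change ∑ Y : nilradLie b g, φ.1 L * (starRingEnd ℂ) (f.1 (L.1 + Y)) =
        _ * (_ * (starRingEnd ℂ) ((Nat.card (unipRadical b g) : ℂ)⁻¹ *
          ∑ Y : nilradLie b g, f.1 (L.1 + Y)))
      rw [← Finset.mul_sum, map_mul, map_inv₀, map_natCast, map_sum]
      have := card_unipRadical_ne_zero b g
      field_simp
  rw [hermForm, h1, h4]
  field_simp

theorem hermForm_hcInd_hcRes (f f' : invFun k n) :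
    hermForm (hcInd b g (hcRes b g f)) f' = hermForm f (hcInd b g (hcRes b g f')) := by
  rw [← conj_hermForm _ f, hermForm_hcInd, hermForm_hcInd]
  simp only [map_mul, map_inv₀, map_natCast, map_sum, Complex.conj_conj]
  congr 1
  exact Finset.sum_congr rfl fun L _ => mul_comm _ _

/-- Each R ∘ *R is self-adjoint by adjunction, and the coefficients are real signs. -/
theorem hermForm_duality (χ : BorelLeviChoice k n) (f f' : invFun k n) :
    hermForm (duality χ f) f' = hermForm f (duality χ f') := by
  have h1 : ∀ (s : Finset (Composition n)) (a : Composition n → ℂ) (F : Composition n → invFun k n)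
      (h : invFun k n), hermForm (∑ c ∈ s, a c • F c) h = ∑ c ∈ s, a c * hermForm (F c) h := by
    intro s a F h
    induction s using Finset.induction_on with
    | empty => simp [hermForm]
    | insert c s hc ih =>
      rw [Finset.sum_insert hc, Finset.sum_insert hc, hermForm_add_left, hermForm_smul_left, ih]
  have h2 : ∀ f : invFun k n, duality χ f = ∑ c : Composition n, (-1 : ℂ) ^ ssRank c •
      hcInd (compLabel c) (χ.elt c) (hcRes (compLabel c) (χ.elt c) f) := by
    intro f
    rw [duality, LinearMap.sum_apply]
    rfl
  rw [← conj_hermForm _ f, h2, h2, h1, h1, map_sum]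
  refine Finset.sum_congr rfl fun c _ => ?_
  rw [hermForm_hcInd_hcRes, map_mul, conj_hermForm]
  simp

/-! ### Generation by pre-cuspidal functions -/

/-- The functions obtained by Harish-Chandra induction from two smaller blocks. -/
inductive IsProduct : ∀ n, invFun k n → Prop
  | mk (n₁ n₂ : ℕ) (h₁ : 0 < n₁) (h₂ : 0 < n₂) (f₁ : invFun k n₁) (f₂ : invFun k n₂) :
    IsProduct (n₁ + n₂) (hcInd (twoLabel n₁ n₂) 1 (boxProd f₁ f₂))

/-- The indicator function of an adjoint orbit. -/
def orbitFun (M : Matrix (Fin n) (Fin n) k) : invFun k n :=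
  ⟨fun X => if ∃ g : GL (Fin n) k, X = adj g M then 1 else 0, fun x X => by
    refine if_congr ⟨?_, ?_⟩ rfl rfl
    · rintro ⟨g, hg⟩
      exact ⟨x⁻¹ * g, by rw [adj_mul, ← hg, ← adj_mul, inv_mul_cancel, adj_one]⟩
    · rintro ⟨g, hg⟩
      exact ⟨x * g, by rw [adj_mul, ← hg]⟩⟩

theorem hcRes_twoLabel_congr {n₁ n₂ : ℕ} (f : invFun k (n₁ + n₂))
    {L L₀ : leviLie (twoLabel n₁ n₂) (1 : GL (Fin (n₁ + n₂)) k)} {g₁ : GL (Fin n₁) k}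
    {g₂ : GL (Fin n₂) k} (h₁ : blockOne L.1 = adj g₁ (blockOne L₀.1))
    (h₂ : blockTwo L.1 = adj g₂ (blockTwo L₀.1)) :
    (hcRes (twoLabel n₁ n₂) 1 f).1 L = (hcRes (twoLabel n₁ n₂) 1 f).1 L₀ := by
  have h3 := sum_nilradLie_twoLabel f L
  rw [h₁, h₂, ← res_congr (toLin'_adj g₁ (blockOne L₀.1)),
    ← val_congr _ (toLin'_adj g₂ (blockTwo L₀.1)), ← sum_nilradLie_twoLabel] at h3
  exact congrArg ((Nat.card (unipRadical (twoLabel n₁ n₂) (1 : GL (Fin (n₁ + n₂)) k)) : ℂ)⁻¹ * ·) h3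

/-- Testing against the product of the orbit indicators of the two blocks of L₀ isolates the value
of the restriction at L₀, multiplied by the nonzero number of elements in that orbit of the Levi
algebra. -/
theorem hcRes_twoLabel_eq_zero_of_orthogonal {n₁ n₂ : ℕ} {f : invFun k (n₁ + n₂)}
    (h : ∀ f₁ f₂, hermForm (hcInd (twoLabel n₁ n₂) 1 (boxProd f₁ f₂)) f = 0) :
    hcRes (twoLabel n₁ n₂) 1 f = 0 := by
  have hP : (Nat.card (parabolic (twoLabel n₁ n₂) (1 : GL (Fin (n₁ + n₂)) k)) : ℂ) ≠ 0 :=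
    Nat.cast_ne_zero.2 Nat.card_pos.ne'
  have hU := card_unipRadical_ne_zero (twoLabel n₁ n₂) (1 : GL (Fin (n₁ + n₂)) k)
  apply Subtype.ext
  funext L₀
  have h1 := h (orbitFun (blockOne L₀.1)) (orbitFun (blockTwo L₀.1))
  rw [hermForm_hcInd] at h1
  have h2 := (mul_eq_zero.1 h1).resolve_left (mul_ne_zero (inv_ne_zero hP) hU)
  have h3 : ∀ L, (boxProd (orbitFun (blockOne L₀.1)) (orbitFun (blockTwo L₀.1))).1 L *
      (starRingEnd ℂ) ((hcRes (twoLabel n₁ n₂) 1 f).1 L) =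
      (if (∃ g : GL (Fin n₁) k, blockOne L.1 = adj g (blockOne L₀.1)) ∧
        ∃ g : GL (Fin n₂) k, blockTwo L.1 = adj g (blockTwo L₀.1) then 1 else 0) *
      (starRingEnd ℂ) ((hcRes (twoLabel n₁ n₂) 1 f).1 L₀) := by
    intro L
    change ((if ∃ g : GL (Fin n₁) k, blockOne L.1 = adj g (blockOne L₀.1) then 1 else 0) *
      (if ∃ g : GL (Fin n₂) k, blockTwo L.1 = adj g (blockTwo L₀.1) then 1 else 0)) * _ = _
    by_cases h₁ : ∃ g : GL (Fin n₁) k, blockOne L.1 = adj g (blockOne L₀.1)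
    · by_cases h₂ : ∃ g : GL (Fin n₂) k, blockTwo L.1 = adj g (blockTwo L₀.1)
      · rw [if_pos h₁, if_pos h₂, if_pos ⟨h₁, h₂⟩, mul_one]
        obtain ⟨g₁, hg₁⟩ := h₁
        obtain ⟨g₂, hg₂⟩ := h₂
        rw [hcRes_twoLabel_congr f hg₁ hg₂]
      · rw [if_neg h₂, if_neg (not_and_of_not_right _ h₂), mul_zero, zero_mul, zero_mul]
    · rw [if_neg h₁, if_neg (not_and_of_not_left _ h₁), zero_mul, zero_mul, zero_mul]
  rw [Finset.sum_congr rfl fun L _ => h3 L, ← Finset.sum_mul, Finset.sum_boole, mul_eq_zero] at h2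
  rcases h2 with h2 | h2
  · exfalso
    rw [Nat.cast_eq_zero, Finset.card_eq_zero, Finset.filter_eq_empty_iff] at h2
    exact h2 (Finset.mem_univ L₀) ⟨⟨1, (adj_one _).symm⟩, ⟨1, (adj_one _).symm⟩⟩
  · exact (map_eq_zero _).1 h2

theorem exists_add_orthogonal (W : Submodule ℂ (invFun k n)) (f : invFun k n) :
    ∃ w ∈ W, ∃ z, f = w + z ∧ ∀ w ∈ W, hermForm w z = 0 := by
  -- The form is a positive multiple of the standard inner product on functions, so orthogonal
  -- projection in Euclidean space applies.
  let T : invFun k n →ₗ[ℂ] EuclideanSpace ℂ (Matrix (Fin n) (Fin n) k) :=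
    (WithLp.linearEquiv 2 ℂ (Matrix (Fin n) (Fin n) k → ℂ)).symm.toLinearMap ∘ₗ
      (invFun k n).subtype
  obtain ⟨_, ⟨w, hw, rfl⟩, z, hz, h⟩ := (W.map T).exists_add_mem_mem_orthogonal (T f)
  refine ⟨w, hw, f - w, by rw [add_sub_cancel], fun w' hw' => ?_⟩
  have h1 : z = T (f - w) := by rw [map_sub, h, add_sub_cancel_left]
  have h2 := (Submodule.mem_orthogonal _ _).1 hz (T w') ⟨w', hw', rfl⟩
  rw [h1, PiLp.inner_apply] at h2
  rw [← conj_hermForm, map_eq_zero, hermForm]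
  refine mul_eq_zero_of_right _ (Eq.trans (Finset.sum_congr rfl fun X _ => ?_) h2)
  rfl

theorem isPreCuspidal_of_orthogonal {z : invFun k n}
    (hz : ∀ w, IsProduct n w → hermForm w z = 0) : IsPreCuspidal z := by
  refine isPreCuspidal_of_hcRes_twoLabel ?_
  intro n₁ n₂ h h₁ h₂
  cases h
  exact hcRes_twoLabel_eq_zero_of_orthogonal fun f₁ f₂ => hz _ (IsProduct.mk n₁ n₂ h₁ h₂ f₁ f₂)

theorem exists_span_isProduct_add_isPreCuspidal (f : invFun k n) :
    ∃ w ∈ Submodule.span ℂ {f : invFun k n | IsProduct n f}, ∃ z, f = w + z ∧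
      IsPreCuspidal z := by
  obtain ⟨w, hw, z, hf, hz⟩ := exists_add_orthogonal (Submodule.span ℂ {f | IsProduct n f}) f
  exact ⟨w, hw, z, hf, isPreCuspidal_of_orthogonal fun w hw => hz w (Submodule.subset_span hw)⟩

/-- The induction principle behind everything that follows: a property stable under linear
combinations need only be checked on pre-cuspidal functions and on functions induced from two
smaller blocks. -/
theorem invFun_induction {P : invFun k n → Prop} (hcusp : ∀ f, IsPreCuspidal f → P f)
    (hprod : ∀ f, IsProduct n f → P f) (hadd : ∀ f f', P f → P f' → P (f + f'))
    (hsmul : ∀ (a : ℂ) f, P f → P (a • f)) (f : invFun k n) : P f := by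
  obtain ⟨w, hw, z, rfl, hz⟩ := exists_span_isProduct_add_isPreCuspidal f
  refine hadd _ _ ?_ (hcusp z hz)
  induction hw using Submodule.span_induction with
  | mem f hf => exact hprod f hf
  -- P 0 is not assumed; it follows by scaling the pre-cuspidal component z by 0.
  | zero => simpa using hsmul 0 z (hcusp z hz)
  | add f f' _ _ hf hf' => exact hadd f f' hf hf'
  | smul a f _ hf => exact hsmul a f hf

end

/-! ### Homogeneous class functions -/

section

variable {k : Type u} [Field k]

/-- The class functions that vanish outside dimension `n`. -/
def IsHomogeneous (n : ℕ) (F : ClassFun k) : Prop :=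
  ∀ (V : Type u) [AddCommGroup V] [Module k V] [Finite V] (X : Module.End k V),
    Module.finrank k V ≠ n → F.1 (of X) = 0

theorem isHomogeneous_extend {n : ℕ} (f : invFun k n) : IsHomogeneous n (extend n f) :=
  fun _ _ _ _ X h => extend_of_ne f X h

theorem IsHomogeneous.mul {m n : ℕ} {F G : ClassFun k} (hF : IsHomogeneous m F)
    (hG : IsHomogeneous n G) : IsHomogeneous (m + n) (mul F G) := by
  intro V _ _ _ X h
  rw [mul_apply]
  refine Finset.sum_eq_zero fun W _ => ?_
  have h1 := W.1.finrank_quotient_add_finrank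
  by_cases h2 : Module.finrank k W.1 = m
  · rw [hG _ _ (by omega), mul_zero]
  · rw [hF _ _ h2, zero_mul]

theorem IsHomogeneous.sub {n : ℕ} {F G : ClassFun k} (hF : IsHomogeneous n F)
    (hG : IsHomogeneous n G) : IsHomogeneous n (F - G) := by
  intro V _ _ _ X h
  change F.1 _ - G.1 _ = 0
  rw [hF V X h, hG V X h, sub_zero]

theorem res_eq_zero {V V' : Type u} [AddCommGroup V] [Module k V] [Finite V] [AddCommGroup V']
    [Module k V'] [Finite V'] {d : ℕ} {F : ClassFun k}
    (hF : ∀ (V : Type u) [AddCommGroup V] [Module k V] [Finite V] (X : Module.End k V),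
      Module.finrank k V = d → F.1 (of X) = 0) (X : Module.End k V) (X' : Module.End k V')
    (h : Module.finrank k V + Module.finrank k V' = d) : (res X F).1 (of X') = 0 := by
  rw [res_apply, Finset.sum_eq_zero, mul_zero]
  exact fun Y _ => hF _ _ (by rw [Module.finrank_prod, h])

/-- In the recursion, dim W and dim V / W add up to d, so only the values of F in dimension d ever
enter. -/
theorem altSum_eq_zero (d : ℕ) :
    ∀ (F : ClassFun k), (∀ (V : Type u) [AddCommGroup V] [Module k V] [Finite V]
      (X : Module.End k V), Module.finrank k V = d → F.1 (of X) = 0) →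
    ∀ (V : Type u) [AddCommGroup V] [Module k V] [Finite V] (X : Module.End k V),
      Module.finrank k V = d → (altSum k F).1 (of X) = 0 := by
  induction d using Nat.strong_induction_on with
  | _ d ih =>
    intro F hF V _ _ _ X hV
    cases subsingleton_or_nontrivial V with
    | inl hs => rw [altSum_of_subsingleton, hF V X hV]
    | inr hn =>
      rw [altSum_of_nontrivial, Finset.sum_eq_zero, neg_zero]
      intro W _
      split_ifs with hW
      · rfl
      · have h1 := W.1.finrank_quotient_add_finrank
        have h2 : 0 < Module.finrank k W.1 := by
          rw [Nat.pos_iff_ne_zero]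
          exact fun h => hW (Stab.ext (Submodule.finrank_eq_zero.1 h))
        refine ih _ (by omega) _ (fun V' _ _ _ X' hV' => ?_) _ _ rfl
        exact res_eq_zero hF _ _ (by omega)

theorem IsHomogeneous.altSum {n : ℕ} {F : ClassFun k} (hF : IsHomogeneous n F) :
    IsHomogeneous n (altSum k F) := fun V _ _ _ X h =>
  altSum_eq_zero _ F (fun V' _ _ _ X' h' => hF V' X' (h'.trans_ne h)) V X rfl

variable [Finite k]

theorem IsHomogeneous.extend_toInv {n : ℕ} {F : ClassFun k} (hF : IsHomogeneous n F) :
    extend n (toInv k n F) = F := by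
  apply ClassFun.ext
  intro V _ _ _ X
  by_cases h : Module.finrank k V = n
  · exact extend_toInv_apply F X h
  · rw [extend_of_ne _ _ h, hF V X h]

theorem extend_zero (f : invFun k 0) : extend 0 f = f.1 0 • one k := by
  rw [← (isHomogeneous_extend f).extend_toInv, toInv_extend]
  apply ClassFun.ext
  intro V _ _ _ X
  rw [val_smul, one_apply]
  split_ifs with h
  · rw [extend_apply f (Module.finBasisOfFinrankEq k V Module.finrank_zero_of_subsingleton),
      mul_one, Subsingleton.elim (LinearMap.toMatrix _ _ X) 0]
  · rw [mul_zero, extend_of_ne]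
    intro h'
    exact h (Module.finrank_zero_iff.1 h')

end

/-! ### Commutativity and multiplicativity of the alternating sum -/

section

variable {k : Type u} [Field k] [Fintype k]

theorem extend_hcInd_boxProd {m n : ℕ} (f : invFun k m) (g : invFun k n) :
    extend (m + n) (hcInd (twoLabel m n) 1 (boxProd f g)) = mul (extend m f) (extend n g) := by
  rw [hcInd_boxProd, ((isHomogeneous_extend f).mul (isHomogeneous_extend g)).extend_toInv]

theorem isProduct_toInv_mul {m n N : ℕ} (h : m + n = N) (hm : 0 < m) (hn : 0 < n) (f : invFun k m)
    (g : invFun k n) : IsProduct N (toInv k N (mul (extend m f) (extend n g))) := by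
  subst h
  rw [← hcInd_boxProd]
  exact IsProduct.mk m n hm hn f g

theorem IsProduct.hermForm_eq_zero {n : ℕ} {w : invFun k n} (hw : IsProduct n w) {z : invFun k n}
    (hz : IsPreCuspidal z) : hermForm w z = 0 := by
  cases hw with
  | mk n₁ n₂ h₁ h₂ f₁ f₂ =>
    rw [hermForm_hcInd, hz.hcRes_twoLabel n₁ n₂ rfl h₁ h₂, Finset.sum_eq_zero, mul_zero]
    intro L _
    change _ * (starRingEnd ℂ) 0 = 0
    rw [map_zero, mul_zero]

theorem IsPreCuspidal.isPrimitive {n : ℕ} (hn : 0 < n) {f : invFun k n} (hf : IsPreCuspidal f) :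
    IsPrimitive (extend n f) := isPrimitive_extend hn hf.hcRes_twoLabel

theorem isPreCuspidal_toInv {n : ℕ} {F : ClassFun k} (hF : IsHomogeneous n F)
    (h : ∀ (V V' : Type u) [AddCommGroup V] [Module k V] [Finite V] [AddCommGroup V']
      [Module k V'] [Finite V'] (X : Module.End k V) (X' : Module.End k V'),
      Nontrivial V → Nontrivial V' → (res X F).1 (of X') = 0) :
    IsPreCuspidal (toInv k n F) := by
  refine isPreCuspidal_of_hcRes_twoLabel ?_
  intro n₁ n₂ hn h₁ h₂
  cases hn
  refine (hcRes_twoLabel_eq_zero_iff _).2 fun X₁ X₂ => ?_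
  have := Fin.pos_iff_nonempty.1 h₁
  have := Fin.pos_iff_nonempty.1 h₂
  rw [hF.extend_toInv]
  exact h _ _ X₁ X₂ inferInstance inferInstance

/-- The induction product of pre-cuspidal functions is commutative: the difference of the two
products is pre-cuspidal and orthogonal to all products. -/
theorem IsPreCuspidal.mul_comm {m n : ℕ} (hm : 0 < m) (hn : 0 < n) {f : invFun k m}
    {g : invFun k n} (hf : IsPreCuspidal f) (hg : IsPreCuspidal g) :
    mul (extend m f) (extend n g) = mul (extend n g) (extend m f) := by
  have h1 := (isHomogeneous_extend f).mul (isHomogeneous_extend g)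
  have h2 := (isHomogeneous_extend g).mul (isHomogeneous_extend f)
  rw [add_comm n m] at h2
  have h3 : IsPreCuspidal (toInv k (m + n)
      (mul (extend m f) (extend n g) - mul (extend n g) (extend m f))) := by
    refine isPreCuspidal_toInv (h1.sub h2) fun V V' _ _ _ _ _ _ X X' hV hV' => ?_
    rw [map_sub]
    change (res X _).1 _ - (res X _).1 _ = 0
    rw [res_mul_primitive_apply (hf.isPrimitive hm) (hg.isPrimitive hn),
      res_mul_primitive_apply (hg.isPrimitive hn) (hf.isPrimitive hm)]
    ring
  -- The commutator is a difference of products, each orthogonal to every pre-cuspidal function and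
  -- in particular to the commutator itself.
  have h4 := eq_zero_of_hermForm_self (f := toInv k (m + n)
      (mul (extend m f) (extend n g) - mul (extend n g) (extend m f))) (by
    have h5 := (isProduct_toInv_mul rfl hm hn f g).hermForm_eq_zero h3
    have h6 := (isProduct_toInv_mul (add_comm n m) hn hm g f).hermForm_eq_zero h3
    rw [map_sub] at h5 h6
    rw [map_sub]
    nth_rw 1 [sub_eq_add_neg]
    rw [← neg_one_smul ℂ, hermForm_add_left, hermForm_smul_left, h5, h6, mul_zero, add_zero])
  rw [← sub_eq_zero, ← (h1.sub h2).extend_toInv, h4, map_zero]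

/-- By the induction principle in the second factor: f moves past a product by moving past its two
factors of smaller degree. -/
theorem IsPreCuspidal.mul_comm_extend {m : ℕ} (hm : 0 < m) {f : invFun k m}
    (hf : IsPreCuspidal f) (n : ℕ) :
    ∀ g : invFun k n, mul (extend m f) (extend n g) = mul (extend n g) (extend m f) := by
  induction n using Nat.strong_induction_on with
  | _ n ih =>
    rcases Nat.eq_zero_or_pos n with rfl | hn
    · intro g
      rw [extend_zero, mul_smul', smul_mul', one_mul', mul_one']
    refine invFun_induction (fun g hg => hf.mul_comm hm hn hg) ?_ ?_ ?_
    · rintro _ ⟨n₁, n₂, h₁, h₂, f₁, f₂⟩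
      rw [extend_hcInd_boxProd, ← mul_assoc', ih n₁ (by omega), mul_assoc', ih n₂ (by omega),
        mul_assoc']
    · intro g g' h h'
      rw [map_add, mul_add', add_mul', h, h']
    · intro a g h
      rw [map_smul, mul_smul', smul_mul', h]

/-- For a pre-cuspidal right factor g, S(f g) = -g S(f), and commutativity rewrites this as S(f)
S(g). Products are handled by associativity and induction on the degree of the right factor. -/
theorem altSum_mul_extend (n : ℕ) :
    ∀ (m : ℕ) (f : invFun k m) (g : invFun k n), altSum k (mul (extend m f) (extend n g)) =
      mul (altSum k (extend m f)) (altSum k (extend n g)) := by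
  induction n using Nat.strong_induction_on with
  | _ n ih =>
    intro m f
    rcases Nat.eq_zero_or_pos n with rfl | hn
    · intro g
      rw [extend_zero, mul_smul', map_smul, map_smul, mul_smul', mul_one', altSum_one, mul_one']
    refine invFun_induction (fun g hg => ?_) ?_ ?_ ?_
    · have h1 := (isHomogeneous_extend f).altSum.extend_toInv
      rw [altSum_mul_primitive _ (hg.isPrimitive hn), altSum_primitive (hg.isPrimitive hn), ← h1,
        hg.mul_comm_extend hn, ← neg_one_smul ℂ (extend n g), mul_smul']
      exact (neg_one_smul ℂ _).symm
    · rintro _ ⟨n₁, n₂, h₁, h₂, f₁, f₂⟩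
      -- The product of f and f₁ is again an extended invariant function, of degree m + n₁; the
      -- induction hypothesis applies to it because m is arbitrary.
      rw [extend_hcInd_boxProd, ← mul_assoc', ← extend_hcInd_boxProd, ih n₂ (by omega),
        extend_hcInd_boxProd, ih n₁ (by omega), mul_assoc', ← ih n₂ (by omega)]
    · intro g g' h h'
      rw [map_add, mul_add', map_add, map_add, mul_add', h, h']
    · intro a g h
      rw [map_smul, mul_smul', map_smul, map_smul, mul_smul', h]

/-! ### The duality operation -/

variable (k) in
/-- The duality operation. -/
def dual (n : ℕ) : invFun k n →ₗ[ℂ] invFun k n :=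
  (-1 : ℂ) ^ n • (toInv k n ∘ₗ altSum k ∘ₗ extend n)

theorem duality_eq_dual {n : ℕ} (χ : BorelLeviChoice k n) : duality χ = dual k n :=
  LinearMap.ext fun f => duality_eq χ f

theorem extend_dual {n : ℕ} (f : invFun k n) :
    extend n (dual k n f) = (-1 : ℂ) ^ n • altSum k (extend n f) := by
  change extend n ((-1 : ℂ) ^ n • toInv k n (altSum k (extend n f))) = _
  rw [map_smul, (isHomogeneous_extend f).altSum.extend_toInv]

theorem extend_injective {n : ℕ} : Function.Injective (extend (k := k) n) := fun f g h => by
  rw [← toInv_extend f, h, toInv_extend]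

/-- The sign (-1)^n is multiplicative in the degree, and turns S(p) = -p into the sign (-1)^(n-1)
demanded on pre-cuspidal functions. -/
theorem isDualityFamily_dual : IsDualityFamily (dual k) where
  zero := LinearMap.ext fun f => extend_injective (by
    rw [extend_dual, extend_zero, map_smul, altSum_one, pow_zero, one_smul, LinearMap.id_apply,
      extend_zero])
  ind n₁ n₂ h₁ h₂ f₁ f₂ := extend_injective (by
    rw [extend_dual, extend_hcInd_boxProd, extend_hcInd_boxProd, altSum_mul_extend, extend_dual,
      extend_dual, smul_mul', mul_smul', smul_smul, pow_add])
  preCuspidal n hn f hf := extend_injective (by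
    rw [extend_dual, altSum_primitive (hf.isPrimitive hn), map_smul]
    obtain ⟨n, rfl⟩ := Nat.exists_eq_add_one.2 hn
    rw [smul_neg, ← neg_smul, pow_succ, mul_neg_one, neg_neg, Nat.add_sub_cancel])

theorem IsDualityFamily.eq {D D' : ∀ n : ℕ, invFun k n →ₗ[ℂ] invFun k n} (h : IsDualityFamily D)
    (h' : IsDualityFamily D') : D = D' := by
  funext n
  induction n using Nat.strong_induction_on with
  | _ n ih =>
    rcases Nat.eq_zero_or_pos n with rfl | hn
    · rw [h.zero, h'.zero]
    refine LinearMap.ext (invFun_induction (fun g hg => ?_) ?_ ?_ ?_)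
    · rw [h.preCuspidal n hn g hg, h'.preCuspidal n hn g hg]
    · rintro _ ⟨n₁, n₂, h₁, h₂, f₁, f₂⟩
      rw [h.ind n₁ n₂ h₁ h₂, h'.ind n₁ n₂ h₁ h₂, ih n₁ (by omega), ih n₂ (by omega)]
    · intro g g' hg hg'
      rw [map_add, map_add, hg, hg']
    · intro a g hg
      rw [map_smul, map_smul, hg]

/-- On pre-cuspidal functions the sign squares to one, and on products the claim reduces to smaller
degrees; only the characterising properties are used. -/
theorem IsDualityFamily.isInvolutive {D : ∀ n : ℕ, invFun k n →ₗ[ℂ] invFun k n}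
    (h : IsDualityFamily D) (n : ℕ) : IsInvolutive (D n) := by
  induction n using Nat.strong_induction_on with
  | _ n ih =>
    rcases Nat.eq_zero_or_pos n with rfl | hn
    · rw [IsInvolutive, h.zero, LinearMap.id_comp]
    have ih' : ∀ m < n, ∀ f, D m (D m f) = f := fun m hm f => LinearMap.congr_fun (ih m hm) f
    refine LinearMap.ext (invFun_induction (fun g hg => ?_) ?_ ?_ ?_)
    · rw [LinearMap.comp_apply, h.preCuspidal n hn g hg, map_smul, h.preCuspidal n hn g hg,
        smul_smul, ← mul_pow, neg_one_mul, neg_neg, one_pow, one_smul, LinearMap.id_apply]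
    · rintro _ ⟨n₁, n₂, h₁, h₂, f₁, f₂⟩
      rw [LinearMap.comp_apply, h.ind n₁ n₂ h₁ h₂, h.ind n₁ n₂ h₁ h₂, ih' n₁ (by omega),
        ih' n₂ (by omega), LinearMap.id_apply]
    · intro g g' hg hg'
      rw [map_add, map_add, hg, hg']
    · intro a g hg
      rw [map_smul, map_smul, hg]

variable (k) in
/-- The choice of the upper triangular Borel subgroup and of the block diagonal Levi subgroups. -/
def stdBorelLeviChoice (n : ℕ) : BorelLeviChoice k n where
  borel := 1
  elt _ := 1
  elt_mem c := by
    rw [inv_one, mul_one]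
    exact one_mem _

theorem isIsometric_dual (n : ℕ) : IsIsometric (dual k n) := fun f f' => by
  have h := LinearMap.congr_fun (isDualityFamily_dual.isInvolutive n) f'
  change dual k n (dual k n f') = f' at h
  -- Self-adjointness is available for the operators built from a Borel and Levi choice, so the
  -- standard choice is inserted; with the involution property it gives (Df, Df') = (f, DDf') = (f,
  -- f').
  rw [← duality_eq_dual (stdBorelLeviChoice k n)] at h ⊢
  rw [hermForm_duality, h]

end

end GlDuality

end

theorem mainTheorem7 (k : Type*) [Field k] [Fintype k] :
    ∃ D : ∀ n : ℕ, GlDuality.invFun k n →ₗ[ℂ] GlDuality.invFun k n,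
      GlDuality.IsDualityFamily D ∧
      (∀ D' : ∀ n : ℕ, GlDuality.invFun k n →ₗ[ℂ] GlDuality.invFun k n,
        GlDuality.IsDualityFamily D' → D' = D) ∧
      ∀ n : ℕ,
        GlDuality.IsInvolutive (D n) ∧ GlDuality.IsIsometric (D n) ∧
        ∀ χ : GlDuality.BorelLeviChoice k n,
          GlDuality.duality χ = D n ∧
          GlDuality.IsInvolutive (GlDuality.duality χ) ∧
          GlDuality.IsIsometric (GlDuality.duality χ) := by
  have h := GlDuality.isDualityFamily_dual (k := k)
  refine ⟨GlDuality.dual k, h, fun D' h' => h'.eq h, fun n =>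
    ⟨h.isInvolutive n, GlDuality.isIsometric_dual n, fun χ => ?_⟩⟩
  rw [GlDuality.duality_eq_dual]
  exact ⟨rfl, h.isInvolutive n, GlDuality.isIsometric_dual n⟩
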